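/- **Lemma 5.25 (Bach-relation).** Let $(X,g)$ be a smooth Riemannian manifold of dimension $4$ (possibly with boundary), $\iota:M\hookrightarrow X$ a smooth embedding of a manifold $M$ of dimension $3$, and $\partial_0=N$ a smooth unit normal field along $\iota$. Let $h=\iota^*g$, and let $\bar\nabla$ and $\nabla$ be the Levi-Civita connections of $g$ and $h$. The curvature tensor of $g$ is $\bar R(Y,Z)V=\bar\nabla_Y\bar\nabla_ZV-\bar\nabla_Z\bar\nabla_YV-\bar\nabla_{[Y,Z]}V$, with components $\bar R(\partial_a,\partial_b)\partial_c=\bar R_{abc}{}^d\partial_d$. With $6\bar{\mathsf J}=\overline{\mathrm{scal}}$ and $2\bar{\mathsf P}=\overline{\mathrm{Ric}}-\bar{\mathsf J}g$, its Weyl tensor $\overline W$ is defined by $$\bar R_{abcd}=\overline W_{abcd}-\bar{\mathsf P}_{ac}g_{bd}+\bar{\mathsf P}_{bc}g_{ad}-\bar{\mathsf P}_{bd}g_{ac}+\bar{\mathsf P}_{ad}g_{bc},$$ and its Cotton tensor by $\bar C_{abc}=\bar\nabla^d\overline W_{abcd}$, where $d$ runs over all directions of $X$. An index $0$ means insertion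 of $\partial_0$; the indices $i,j,k,l$ refer to $M$; indices are raised with the respective metric; repeated indices are summed; and $(ij)$ denotes symmetrization, $T_{(ij)}=\tfrac12(T_{ij}+T_{ji})$. Put $$L(Y,Z)=-g(\bar\nabla_YZ,\partial_0),\quad 3H=\mathrm{tr}_h L,\quad \mathring L=L-Hh,\quad (\mathring L^2)_{ij}=\mathring L_i{}^k\mathring L_{kj},\quad (\overline{\mathcal W})_{ij}=\overline W_{0ij0},$$ and write $(\cdot,\cdot)$ for the scalar product of bilinear forms on $M$ defined by $h$. The *hypersurface Bach tensor* is the symmetric bilinear form on $M$ with components $$B_{ij}=\bar C_{0(ij)}-H\,\overline W_{0ij0}+\nabla^k\overline W_{0(ij)k},$$ where $\nabla^k$ acts on the $3$-tensor $\overline W_{0ijk}$ on $M$. 1. Let $\varphi\in C^\infty(X)$, and let $\hat B$ be the hypersurface Bach tensor of $\iota$ for the metric $\hat g=e^{2\varphi}g$ and the unit normal field $\hat\partial_0=e^{-\varphi}\partial_0$. Then $e^{\varphi}\hat B=B$ on $M$. 2. On $M$, $$(\mathring L,B)=\mathring L^{ij}\,\bar\nabla^0(\overline W)_{0ij0}+2H(\mathring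 L,\overline{\mathcal W})-2\mathring L^{ij}\nabla^k\overline W_{jki0}-(\mathring L^2,\overline{\mathcal W})-\mathring L^{ij}\mathring L^{kl}\,\overline W_{kijl},$$ where $\bar\nabla^0(\overline W)_{0ij0}$ is the component $(\bar\nabla_{\partial_0}\overline W)(\partial_0,\partial_i,\partial_j,\partial_0)$ and $\nabla^k$ acts on the $3$-tensor $\overline W_{ijk0}$ on $M$. -/

import Mathlib

open scoped Manifold ContDiff

noncomputable section

namespace HypersurfaceBach

/-! ### Riemannian tensor calculus in coordinates

Everything in this part takes place on a set `S` of coordinate vectors in dimension `n`.  For a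
manifold modelled on `I` one takes `S = Set.range I`, which is the whole space if there is no
boundary.  A metric is given by its matrix of components, and the components of the other tensors
are functions of their indices. -/

/-- The coordinate space of dimension `n`. -/
abbrev Coord (n : ℕ) := EuclideanSpace ℝ (Fin n)

/-- The coordinate vector `∂_a`. -/
def basisVec {n : ℕ} (a : Fin n) : Coord n := EuclideanSpace.single a 1

/-- The partial derivative `∂_a f` at `u`. -/
def partialD {n : ℕ} (S : Set (Coord n)) (a : Fin n) (f : Coord n → ℝ) (u : Coord n) : ℝ :=
  fderivWithin ℝ f S u (basisVec a)

section Curvature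

variable {n : ℕ} (S : Set (Coord n)) (G : Coord n → Matrix (Fin n) (Fin n) ℝ)

/-- The Christoffel symbol `Γ^c_{ab}` of the Levi-Civita connection,
`∇_{∂_a} ∂_b = Γ^c_{ab} ∂_c`. -/
def christoffel (c a b : Fin n) (u : Coord n) : ℝ :=
  (1 / 2) * ∑ d, (G u)⁻¹ c d *
    (partialD S a (fun v => G v b d) u + partialD S b (fun v => G v a d) u
      - partialD S d (fun v => G v a b) u)

/-- The components `R_{abc}^d` of the curvature tensor, `R(∂_a, ∂_b) ∂_c = R_{abc}^d ∂_d`, for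
`R(X, Y) Z = ∇_X ∇_Y Z - ∇_Y ∇_X Z - ∇_{[X, Y]} Z`. -/
def riemannUp (a b c d : Fin n) (u : Coord n) : ℝ :=
  partialD S a (christoffel S G d b c) u - partialD S b (christoffel S G d a c) u
    + ∑ e, (christoffel S G e b c u * christoffel S G d a e u
      - christoffel S G e a c u * christoffel S G d b e u)

/-- The components `R_{abcd}` of the curvature tensor, the last index being lowered. -/
def riemann (a b c d : Fin n) (u : Coord n) : ℝ :=
  ∑ e, riemannUp S G a b c e u * G u e d

/-- The Ricci tensor `Ric_{bc} = R_{abc}^a`, which is positive on round spheres. -/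
def ricci (b c : Fin n) (u : Coord n) : ℝ :=
  ∑ a, riemannUp S G a b c a u

/-- The scalar curvature. -/
def scalarCurv (u : Coord n) : ℝ :=
  ∑ a, ∑ b, (G u)⁻¹ a b * ricci S G a b u

/-- The normalized scalar curvature `J`, where `2 (n - 1) J = scal`. -/
def schoutenTrace (u : Coord n) : ℝ :=
  scalarCurv S G u / (2 * ((n : ℝ) - 1))

/-- The Schouten tensor `P`, where `(n - 2) P = Ric - J g`. -/
def schouten (a b : Fin n) (u : Coord n) : ℝ :=
  (ricci S G a b u - schoutenTrace S G u * G u a b) / ((n : ℝ) - 2)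

/-- The components `W_{abcd}` of the Weyl tensor, from the decomposition
`R_{abcd} = W_{abcd} - P_{ac} g_{bd} + P_{bc} g_{ad} - P_{bd} g_{ac} + P_{ad} g_{bc}`. -/
def weyl (a b c d : Fin n) (u : Coord n) : ℝ :=
  riemann S G a b c d u
    + schouten S G a c u * G u b d - schouten S G b c u * G u a d
    + schouten S G b d u * G u a c - schouten S G a d u * G u b c

/-- The component `(∇_e T)_{abc}` of the covariant derivative of a covariant 3-tensor. -/
def nabla3 (T : Fin n → Fin n → Fin n → Coord n → ℝ) (e a b c : Fin n) (u : Coord n) : ℝ :=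
  partialD S e (T a b c) u
    - ∑ f, (christoffel S G f e a u * T f b c u + christoffel S G f e b u * T a f c u
      + christoffel S G f e c u * T a b f u)

/-- The component `(∇_e T)_{abcd}` of the covariant derivative of a covariant 4-tensor. -/
def nabla4 (T : Fin n → Fin n → Fin n → Fin n → Coord n → ℝ) (e a b c d : Fin n)
    (u : Coord n) : ℝ :=
  partialD S e (T a b c d) u
    - ∑ f, (christoffel S G f e a u * T f b c d u + christoffel S G f e b u * T a f c d u
      + christoffel S G f e c u * T a b f d u + christoffel S G f e d u * T a b c f u)

/-- The Cotton tensor `C`, where `(n - 3) C_{abc} = ∇^d W_{abcd}`. -/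
def cotton (a b c : Fin n) (u : Coord n) : ℝ :=
  (∑ d, ∑ e, (G u)⁻¹ d e * nabla4 S G (weyl S G) e a b c d u) / ((n : ℝ) - 3)

end Curvature

/-! ### A hypersurface of dimension 3 in dimension 4, in coordinates -/

/-- A hypersurface in coordinates: the coordinate domain of the ambient space, the matrix of
components of the ambient metric, the embedding, and the components of the normal field `∂_0`. -/
structure CoordHypersurface where
  /-- The coordinate domain of the ambient space. -/
  dom : Set (Coord 4)
  /-- The components of the ambient metric. -/
  metric : Coord 4 → Matrix (Fin 4) (Fin 4) ℝ
  /-- The embedding. -/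
  emb : Coord 3 → Coord 4
  /-- The components of the normal field. -/
  normal : Coord 3 → Coord 4

namespace CoordHypersurface

variable (D : CoordHypersurface)

/-- The component with index `a` of the tangent vector `∂_i` of the hypersurface, as a vector of
the ambient space. -/
def tangent (i : Fin 3) (a : Fin 4) (x : Coord 3) : ℝ :=
  partialD Set.univ i (fun y => D.emb y a) x

/-- The induced metric `h`. -/
def h (x : Coord 3) : Matrix (Fin 3) (Fin 3) ℝ :=
  Matrix.of fun i j => ∑ a, ∑ b, D.metric (D.emb x) a b * D.tangent i a x * D.tangent j b x

/-- The component with index `a` of the ambient covariant derivative of `∂_j` along `∂_i`. -/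
def ambientDeriv (i j : Fin 3) (a : Fin 4) (x : Coord 3) : ℝ :=
  partialD Set.univ i (D.tangent j a) x
    + ∑ b, ∑ c, christoffel D.dom D.metric a b c (D.emb x) * D.tangent i b x * D.tangent j c x

/-- The second fundamental form `L(X, Y) = - g(∇_X Y, ∂_0)`. -/
def L (x : Coord 3) : Matrix (Fin 3) (Fin 3) ℝ :=
  Matrix.of fun i j =>
    -∑ a, ∑ b, D.metric (D.emb x) a b * D.ambientDeriv i j a x * D.normal x b

/-- The mean curvature `H`, where `3 H` is the trace of `L`. -/
def H (x : Coord 3) : ℝ :=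
  (∑ i, ∑ j, (D.h x)⁻¹ i j * D.L x i j) / 3

/-- The trace-free part of the second fundamental form. -/
def Lo (x : Coord 3) : Matrix (Fin 3) (Fin 3) ℝ :=
  D.L x - D.H x • D.h x

/-- The square of `Lo`, with components `h^{kl} Lo_{ik} Lo_{lj}`. -/
def LoSq (x : Coord 3) : Matrix (Fin 3) (Fin 3) ℝ :=
  D.Lo x * (D.h x)⁻¹ * D.Lo x

/-- The components `Lo^{ij}`, both indices being raised. -/
def LoUp (x : Coord 3) : Matrix (Fin 3) (Fin 3) ℝ :=
  (D.h x)⁻¹ * D.Lo x * (D.h x)⁻¹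

/-- The scalar product `(A, B) = h^{ik} h^{jl} A_{ij} B_{kl}` of bilinear forms. -/
def pairing (x : Coord 3) (A B : Matrix (Fin 3) (Fin 3) ℝ) : ℝ :=
  ∑ i, ∑ j, ∑ k, ∑ l, (D.h x)⁻¹ i k * (D.h x)⁻¹ j l * A i j * B k l

/-- The components `W_{abcd}` of the ambient Weyl tensor. -/
def ambientWeyl (a b c d : Fin 4) (u : Coord 4) : ℝ :=
  weyl D.dom D.metric a b c d u

/-- The tangential components `W_{kijl}` of the ambient Weyl tensor. -/
def weylTan (k i j l : Fin 3) (x : Coord 3) : ℝ :=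
  ∑ a, ∑ b, ∑ c, ∑ d, D.ambientWeyl a b c d (D.emb x)
    * D.tangent k a x * D.tangent i b x * D.tangent j c x * D.tangent l d x

/-- The 3-tensor `W_{ijk0}` on the hypersurface, the normal being inserted into the last slot. -/
def weylLast (i j k : Fin 3) (x : Coord 3) : ℝ :=
  ∑ a, ∑ b, ∑ c, ∑ d, D.ambientWeyl a b c d (D.emb x)
    * D.tangent i a x * D.tangent j b x * D.tangent k c x * D.normal x d

/-- The 3-tensor `W_{0ijk}` on the hypersurface, the normal being inserted into the first slot. -/
def weylFirst (i j k : Fin 3) (x : Coord 3) : ℝ :=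
  ∑ a, ∑ b, ∑ c, ∑ d, D.ambientWeyl a b c d (D.emb x)
    * D.normal x a * D.tangent i b x * D.tangent j c x * D.tangent k d x

/-- The bilinear form `W_{0ij0}` on the hypersurface. -/
def weylNN (x : Coord 3) : Matrix (Fin 3) (Fin 3) ℝ :=
  Matrix.of fun i j => ∑ a, ∑ b, ∑ c, ∑ d, D.ambientWeyl a b c d (D.emb x)
    * D.normal x a * D.tangent i b x * D.tangent j c x * D.normal x d

/-- The bilinear form `(∇̄_0 W)_{0ij0}` on the hypersurface; here `∇̄` is the ambient
connection. -/
def nablaWeylNN (x : Coord 3) : Matrix (Fin 3) (Fin 3) ℝ :=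
  Matrix.of fun i j => ∑ e, ∑ a, ∑ b, ∑ c, ∑ d,
    nabla4 D.dom D.metric D.ambientWeyl e a b c d (D.emb x)
      * D.normal x e * D.normal x a * D.tangent i b x * D.tangent j c x * D.normal x d

/-- The components `C_{0ij}` on the hypersurface of the ambient Cotton tensor. -/
def cottonFirst (i j : Fin 3) (x : Coord 3) : ℝ :=
  ∑ a, ∑ b, ∑ c, cotton D.dom D.metric a b c (D.emb x)
    * D.normal x a * D.tangent i b x * D.tangent j c x

/-- The divergence `∇^k W_{0ijk}` of the 3-tensor `W_{0ijk}` with respect to the Levi-Civita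
connection of the induced metric. -/
def divWeylFirst (i j : Fin 3) (x : Coord 3) : ℝ :=
  ∑ k, ∑ l, (D.h x)⁻¹ k l * nabla3 Set.univ D.h D.weylFirst l i j k x

/-- The bilinear form with components `∇^k W_{jki0}` in `i, j`, with respect to the Levi-Civita
connection of the induced metric. -/
def divWeylLast (x : Coord 3) : Matrix (Fin 3) (Fin 3) ℝ :=
  Matrix.of fun i j => ∑ k, ∑ l, (D.h x)⁻¹ k l * nabla3 Set.univ D.h D.weylLast l j k i x

/-- The hypersurface Bach tensor `B_{ij} = C_{0(ij)} - H W_{0ij0} + ∇^k W_{0(ij)k}`. -/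
def bach (x : Coord 3) : Matrix (Fin 3) (Fin 3) ℝ :=
  Matrix.of fun i j =>
    (D.cottonFirst i j x + D.cottonFirst j i x) / 2 - D.H x * D.weylNN x i j
      + (D.divWeylFirst i j x + D.divWeylFirst j i x) / 2

end CoordHypersurface

/-! ### Hypersurfaces in manifolds -/

section Manifold

variable {H₄ : Type*} [TopologicalSpace H₄] (I : ModelWithCorners ℝ (Coord 4) H₄)
  {X : Type*} [TopologicalSpace X] [ChartedSpace H₄ X] [IsManifold I ∞ X]
  {M : Type*} [TopologicalSpace M] [ChartedSpace (Coord 3) M]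

/-- A smooth Riemannian metric on the 4-manifold `X`. -/
abbrev SmoothMetric (X : Type*) [TopologicalSpace X] [ChartedSpace H₄ X] [IsManifold I ∞ X] :=
  Bundle.ContMDiffRiemannianMetric I ∞ (Coord 4) (fun q : X => TangentSpace I q)

variable {I}

/-- The conformal metric `exp(2 φ) g`. -/
def conformalMetric (g : SmoothMetric I X) (φ : X → ℝ) (hφ : ContMDiff I 𝓘(ℝ) ∞ φ) :
    SmoothMetric I X where
  inner q := Real.exp (2 * φ q) • g.inner q
  symm q v w := by simp [g.symm q v w]
  pos q v hv := by
    have := g.pos q v hv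
    simp only [smul_apply, smul_eq_mul]
    positivity
  isVonNBounded q := by
    refine ((g.isVonNBounded q).image
      (Real.exp (-φ q) • ContinuousLinearMap.id ℝ (TangentSpace I q))).subset ?_
    intro v hv
    refine ⟨Real.exp (φ q) • v, ?_, ?_⟩
    · have h2 : Real.exp (2 * φ q) = Real.exp (φ q) * Real.exp (φ q) := by
        rw [← Real.exp_add]
        ring_nf
      simpa [h2, mul_assoc] using hv
    · simp [smul_smul, ← Real.exp_add]
  contMDiff := by
    have h1 : ContMDiff I 𝓘(ℝ) ∞ (fun q => Real.exp (2 * φ q)) :=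
      (Real.contDiff_exp.comp (contDiff_const.mul contDiff_id)).contMDiff.comp hφ
    exact h1.smul_section g.contMDiff

/-- The coordinate vector field `∂_a` of the chart `e` of `X`, at the point with coordinates `u`. -/
def coordField (e : OpenPartialHomeomorph X H₄) (a : Fin 4) (u : Coord 4) :
    TangentSpace I ((e.extend I).symm u) :=
  mfderivWithin 𝓘(ℝ, Coord 4) I (e.extend I).symm (Set.range I) u (basisVec a)

/-- The embedding `ι` and the normal field `N` along it, in a chart `c` of `M` and a chart `e`
of `X`.  For a tensor on `M`, such as the hypersurface Bach tensor, the functions of the resulting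
`CoordHypersurface` are its components with respect to the coordinate vector fields of `c`. -/
def inCharts (g : SmoothMetric I X) (ι : M → X) (N : ∀ p : M, TangentSpace I (ι p))
    (c : OpenPartialHomeomorph M (Coord 3)) (e : OpenPartialHomeomorph X H₄) :
    CoordHypersurface where
  dom := Set.range I
  metric u := Matrix.of fun a b =>
    g.inner ((e.extend I).symm u) (coordField e a u) (coordField e b u)
  emb x := e.extend I (ι (c.symm x))
  normal x := mfderiv I 𝓘(ℝ, Coord 4) (e.extend I) (ι (c.symm x)) (N (c.symm x))

/-- `N` is a smooth unit normal field along `ι`, for the metric `g`. -/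
structure IsUnitNormalField [IsManifold (𝓡 3) ∞ M] (g : SmoothMetric I X) (ι : M → X)
    (N : ∀ p : M, TangentSpace I (ι p)) : Prop where
  smooth : ContMDiff (𝓡 3) I.tangent ∞ (fun p => (⟨ι p, N p⟩ : TangentBundle I X))
  unit (p : M) : g.inner (ι p) (N p) (N p) = 1
  normal (p : M) (v : TangentSpace (𝓡 3) p) :
    g.inner (ι p) (N p) (mfderiv (𝓡 3) I ι p v) = 0

end Manifold

end HypersurfaceBach

end

namespace HypersurfaceBach

open Filter Topology

/-! ### Partial derivatives -/

/-! All computations take place in a chart of `M` and a chart of `X`, with tensors given by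
components and derivatives taken within `Set.range I`, so that boundary points need no separate
treatment. `isRegularAt_inCharts` supplies what the calculus needs: a smooth metric, a smooth unit
normal field, and an invertible induced metric because an immersion has injective differential.

The basis is `riemann_eq`: the lowered curvature is an expression in second derivatives of the
metric and in products of Christoffel symbols of the first kind, and the inverse metric is never
differentiated. The symmetries of the curvature follow by algebra. So does `riemann_conformal`: for
the metric exp(2f) g the curvature changes by an algebraic product of g with a symmetric tensor,
which the Schouten tensor absorbs. Hence the Weyl tensor only scales (`weyl_conformal`), and its
divergence in dimension 4 changes by the term W(·,·,·,grad f) (`cotton_conformal`).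

Conformal covariance. Split grad f along the hypersurface into its tangential part, the gradient of
the restriction of f, and its normal part N(f) ∂_0. Up to the common factor exp(-f), the component
C_{0ij} gains W_{0ij m} f^m + N(f) W_{0ij0}. The form W_{0ij0} is invariant and H gains N(f), so the
H-term removes the normal contribution. The 3-tensor W_{0ijk} is trace-free of weight one; in
dimension 3 its divergence gains -W_{0ijm} f^m, which removes the tangential contribution, and a
term skew in i, j, which symmetrization removes.

The formula for (Lo, B). In the frame of ∂_0 and the tangent vectors, the divergence of W has the
normal term (∇_0 W)_{0ij0} and tangential terms. By the formulas of Gauss and Weingarten (`gauss`,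
`weingarten`) the tangential terms are the intrinsic divergence of W_{0ijk} plus contractions of L
with W (`nablaWeyl_tangent`, `cottonFirst_eq`). Inserting L = Lo + H h and using that W is
trace-free (`weylForm_trace`) gives `cottonFirst_eq_Lo`. Contraction with the symmetric tensor Lo
then makes the symmetrization in B irrelevant. -/

/-- Coordinate domains on which partial derivatives are well defined and commute. -/
structure IsCoordDomain {n : ℕ} (S : Set (Coord n)) : Prop where
  uniqueDiffOn : UniqueDiffOn ℝ S
  subset_closure : S ⊆ closure (interior S)

theorem isCoordDomain_univ {n : ℕ} : IsCoordDomain (Set.univ : Set (Coord n)) :=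
  ⟨uniqueDiffOn_univ, by simp⟩

section PartialD

variable {n : ℕ} {S : Set (Coord n)} {u : Coord n} {f g : Coord n → ℝ} {a b : Fin n}

theorem differentiableWithinAt_of_smooth (hf : ContDiffWithinAt ℝ ∞ f S u) :
    DifferentiableWithinAt ℝ f S u :=
  hf.differentiableWithinAt (by simp)

theorem partialD_congr (h : f =ᶠ[𝓝[S] u] g) (hu : u ∈ S) :
    partialD S a f u = partialD S a g u := by
  unfold partialD
  rw [h.fderivWithin_eq (h.self_of_nhdsWithin hu)]

theorem partialD_add (hS : IsCoordDomain S) (hu : u ∈ S) (hf : ContDiffWithinAt ℝ ∞ f S u)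
    (hg : ContDiffWithinAt ℝ ∞ g S u) :
    partialD S a (fun v => f v + g v) u = partialD S a f u + partialD S a g u := by
  unfold partialD
  rw [fderivWithin_fun_add (hS.uniqueDiffOn u hu) (differentiableWithinAt_of_smooth hf)
    (differentiableWithinAt_of_smooth hg)]
  rfl

theorem partialD_neg (hS : IsCoordDomain S) (hu : u ∈ S) :
    partialD S a (fun v => - f v) u = - partialD S a f u := by
  unfold partialD
  rw [fderivWithin_fun_neg (hS.uniqueDiffOn u hu)]
  rfl

theorem partialD_sub (hS : IsCoordDomain S) (hu : u ∈ S) (hf : ContDiffWithinAt ℝ ∞ f S u)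
    (hg : ContDiffWithinAt ℝ ∞ g S u) :
    partialD S a (fun v => f v - g v) u = partialD S a f u - partialD S a g u := by
  unfold partialD
  rw [fderivWithin_fun_sub (hS.uniqueDiffOn u hu) (differentiableWithinAt_of_smooth hf)
    (differentiableWithinAt_of_smooth hg)]
  rfl

theorem partialD_mul (hS : IsCoordDomain S) (hu : u ∈ S) (hf : ContDiffWithinAt ℝ ∞ f S u)
    (hg : ContDiffWithinAt ℝ ∞ g S u) :
    partialD S a (fun v => f v * g v) u = partialD S a f u * g u + f u * partialD S a g u := by
  unfold partialD
  rw [fderivWithin_fun_mul (hS.uniqueDiffOn u hu) (differentiableWithinAt_of_smooth hf)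
    (differentiableWithinAt_of_smooth hg)]
  simp
  ring

theorem partialD_const_mul (hS : IsCoordDomain S) (hu : u ∈ S) (r : ℝ)
    (hf : ContDiffWithinAt ℝ ∞ f S u) :
    partialD S a (fun v => r * f v) u = r * partialD S a f u := by
  unfold partialD
  rw [fderivWithin_const_mul (hS.uniqueDiffOn u hu) (differentiableWithinAt_of_smooth hf)]
  rfl

theorem partialD_const (r : ℝ) : partialD S a (fun _ => r) u = 0 := by
  unfold partialD
  rw [fderivWithin_fun_const]
  rfl

theorem partialD_sum (hS : IsCoordDomain S) (hu : u ∈ S) {ι : Type*} {s : Finset ι}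
    {F : ι → Coord n → ℝ} (hF : ∀ i ∈ s, ContDiffWithinAt ℝ ∞ (F i) S u) :
    partialD S a (fun v => ∑ i ∈ s, F i v) u = ∑ i ∈ s, partialD S a (F i) u := by
  unfold partialD
  rw [fderivWithin_fun_sum (hS.uniqueDiffOn u hu)
    (fun i hi => differentiableWithinAt_of_smooth (hF i hi))]
  simp

theorem partialD_exp (hS : IsCoordDomain S) (hu : u ∈ S) (hf : ContDiffWithinAt ℝ ∞ f S u) :
    partialD S a (fun v => Real.exp (f v)) u = Real.exp (f u) * partialD S a f u := by
  unfold partialD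
  rw [fderivWithin_exp (differentiableWithinAt_of_smooth hf) (hS.uniqueDiffOn u hu)]
  rfl

theorem contDiffWithinAt_partialD (hS : IsCoordDomain S) (hu : u ∈ S)
    (hf : ContDiffWithinAt ℝ ∞ f S u) : ContDiffWithinAt ℝ ∞ (partialD S a f) S u :=
  (hf.fderivWithin_right hS.uniqueDiffOn (by simp) hu).clm_apply contDiffWithinAt_const

/-- The second derivative within `S` is symmetric at points in the closure of the interior. This
covers boundary points and is the reason for the second field of `IsCoordDomain`. -/
theorem partialD_comm (hS : IsCoordDomain S) (hu : u ∈ S) (hf : ContDiffWithinAt ℝ ∞ f S u) :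
    partialD S a (partialD S b f) u = partialD S b (partialD S a f) u := by
  have key : ∀ v w : Coord n, fderivWithin ℝ (fun x => fderivWithin ℝ f S x w) S u v
      = fderivWithin ℝ (fderivWithin ℝ f S) S u v w := by
    intro v w
    have hd : DifferentiableWithinAt ℝ (fderivWithin ℝ f S) S u :=
      (hf.fderivWithin_right (m := ∞) hS.uniqueDiffOn (by simp) hu).differentiableWithinAt
        (by simp)
    rw [fderivWithin_clm_apply (hS.uniqueDiffOn u hu) hd (differentiableWithinAt_const w)]
    simp
  -- Over ℝ, order two is enough for symmetry.
  have hs := hf.isSymmSndFDerivWithinAt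
    (by rw [minSmoothness_of_isRCLikeNormedField]; exact WithTop.coe_le_coe.mpr (le_top : (2 : ℕ∞) ≤ ⊤)) hS.uniqueDiffOn (hS.subset_closure hu) hu
  change fderivWithin ℝ (fun x => fderivWithin ℝ f S x (basisVec b)) S u (basisVec a)
    = fderivWithin ℝ (fun x => fderivWithin ℝ f S x (basisVec a)) S u (basisVec b)
  rw [key, key]
  exact hs _ _

end PartialD

/-! ### The jet of a metric at a point -/

/-- `G` is a smooth, symmetric and invertible matrix-valued function near `u` in `S`. -/
structure IsMetricAt {n : ℕ} (S : Set (Coord n)) (G : Coord n → Matrix (Fin n) (Fin n) ℝ)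
    (u : Coord n) : Prop where
  dom : IsCoordDomain S
  mem : u ∈ S
  smooth (a b : Fin n) : ContDiffWithinAt ℝ ∞ (fun v => G v a b) S u
  symm : ∀ᶠ v in 𝓝[S] u, ∀ a b, G v a b = G v b a
  det : (G u).det ≠ 0

/-! ### Contraction of two indices -/

section Algebra

variable {n : ℕ}

/-- The full contraction of a two-index array with `A`. -/
def contract (A : Matrix (Fin n) (Fin n) ℝ) (X : Fin n → Fin n → ℝ) : ℝ :=
  ∑ a, ∑ b, A a b * X a b

variable (A : Matrix (Fin n) (Fin n) ℝ) (X Y : Fin n → Fin n → ℝ)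

theorem contract_add : contract A (fun a b => X a b + Y a b) = contract A X + contract A Y := by
  simp [contract, mul_add, Finset.sum_add_distrib]

theorem contract_sub : contract A (fun a b => X a b - Y a b) = contract A X - contract A Y := by
  simp [contract, mul_sub, Finset.sum_sub_distrib]

theorem contract_neg : contract A (fun a b => - X a b) = - contract A X := by
  simp [contract]

theorem contract_const_mul (r : ℝ) : contract A (fun a b => r * X a b) = r * contract A X := by
  simp only [contract, Finset.mul_sum]
  exact Finset.sum_congr rfl fun a _ => Finset.sum_congr rfl fun b _ => by ring

theorem contract_mul_const (r : ℝ) : contract A (fun a b => X a b * r) = contract A X * r := by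
  simp only [contract, Finset.sum_mul]
  exact Finset.sum_congr rfl fun a _ => Finset.sum_congr rfl fun b _ => by ring

theorem contract_smul (r : ℝ) : contract (r • A) X = r * contract A X := by
  simp only [contract, Finset.mul_sum, Matrix.smul_apply, smul_eq_mul]
  exact Finset.sum_congr rfl fun a _ => Finset.sum_congr rfl fun b _ => by ring

variable {A} in
theorem contract_swap (hA : ∀ a b, A a b = A b a) :
    contract A (fun a b => X b a) = contract A X := by
  unfold contract
  rw [Finset.sum_comm]
  exact Finset.sum_congr rfl fun a _ => Finset.sum_congr rfl fun b _ => by rw [hA]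

end Algebra

/-! ### The inverse metric and the scalar product of covectors -/

section Inverse

variable {n : ℕ} {G : Matrix (Fin n) (Fin n) ℝ}

theorem inv_symm (hs : ∀ a b, G a b = G b a) (a b : Fin n) : G⁻¹ a b = G⁻¹ b a := by
  have h : G.transpose = G := by ext i j; exact hs j i
  have : G⁻¹.transpose = G⁻¹ := by rw [Matrix.transpose_nonsing_inv, h]
  exact congrFun (congrFun this b) a |>.symm ▸ rfl

theorem sum_inv_mul (hd : G.det ≠ 0) (a b : Fin n) :
    ∑ c, G⁻¹ a c * G c b = if a = b then 1 else 0 := by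
  have := Matrix.nonsing_inv_mul G (isUnit_iff_ne_zero.mpr hd)
  rw [← Matrix.mul_apply, this, Matrix.one_apply]

theorem sum_mul_inv (hd : G.det ≠ 0) (a b : Fin n) :
    ∑ c, G a c * G⁻¹ c b = if a = b then 1 else 0 := by
  have := Matrix.mul_nonsing_inv G (isUnit_iff_ne_zero.mpr hd)
  rw [← Matrix.mul_apply, this, Matrix.one_apply]

/-- Contraction over the first index of the metric. -/
theorem contract_metric_left (hd : G.det ≠ 0) (c : Fin n) (Y : Fin n → ℝ) :
    contract G⁻¹ (fun a b => G b c * Y a) = Y c := by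
  unfold contract
  calc ∑ a, ∑ b, G⁻¹ a b * (G b c * Y a) = ∑ a, (∑ b, G⁻¹ a b * G b c) * Y a := by
        simp only [Finset.sum_mul, mul_assoc]
    _ = Y c := by simp [sum_inv_mul hd]

theorem contract_metric_right (hd : G.det ≠ 0) (c : Fin n) (Y : Fin n → ℝ) :
    contract G⁻¹ (fun a b => G c a * Y b) = Y c := by
  unfold contract
  rw [Finset.sum_comm]
  calc ∑ b, ∑ a, G⁻¹ a b * (G c a * Y b) = ∑ b, (∑ a, G c a * G⁻¹ a b) * Y b := by
        simp only [Finset.sum_mul]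
        exact Finset.sum_congr rfl fun a _ => Finset.sum_congr rfl fun b _ => by ring
    _ = Y c := by simp [sum_mul_inv hd]

theorem contract_metric (hs : ∀ a b, G a b = G b a) (hd : G.det ≠ 0) :
    contract G⁻¹ (fun a b => G a b) = n := by
  unfold contract
  calc ∑ a, ∑ b, G⁻¹ a b * G a b = ∑ a, ∑ b, G⁻¹ a b * G b a := by
        exact Finset.sum_congr rfl fun a _ => Finset.sum_congr rfl fun b _ => by rw [hs]
    _ = n := by simp [sum_inv_mul hd]

/-- The bilinear form on covectors defined by `A`. -/
def coform (A : Matrix (Fin n) (Fin n) ℝ) (X Y : Fin n → ℝ) : ℝ :=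
  contract A (fun a b => X a * Y b)

variable (A : Matrix (Fin n) (Fin n) ℝ) (X X' Y Y' : Fin n → ℝ) (r : ℝ)

theorem coform_add_left :
    coform A (fun a => X a + X' a) Y = coform A X Y + coform A X' Y := by
  simp only [coform, add_mul, contract_add]

theorem coform_add_right :
    coform A X (fun a => Y a + Y' a) = coform A X Y + coform A X Y' := by
  simp only [coform, mul_add, contract_add]

theorem coform_sub_left :
    coform A (fun a => X a - X' a) Y = coform A X Y - coform A X' Y := by
  simp only [coform, sub_mul, contract_sub]

theorem coform_sub_right :
    coform A X (fun a => Y a - Y' a) = coform A X Y - coform A X Y' := by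
  simp only [coform, mul_sub, contract_sub]

theorem coform_mul_left : coform A (fun a => r * X a) Y = r * coform A X Y := by
  simp only [coform, mul_assoc, contract_const_mul]

theorem coform_mul_right : coform A X (fun a => r * Y a) = r * coform A X Y := by
  simp only [coform, mul_left_comm, contract_const_mul]

theorem coform_smul : coform (r • A) X Y = r * coform A X Y := by
  simp only [coform, contract_smul]

variable {A} in
theorem coform_comm (hA : ∀ a b, A a b = A b a) : coform A X Y = coform A Y X := by
  unfold coform
  rw [← contract_swap _ hA]
  simp only [mul_comm]

theorem coform_metric_left (hd : G.det ≠ 0) (c : Fin n) :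
    coform G⁻¹ (fun a => G c a) Y = Y c :=
  contract_metric_right hd c Y

theorem coform_metric_right (hd : G.det ≠ 0) (c : Fin n) :
    coform G⁻¹ X (fun a => G a c) = X c := by
  simp only [coform, mul_comm (X _)]
  exact contract_metric_left hd c X

end Inverse

/-! ### Smoothness of the curvature and its lowered form -/

/-- The Christoffel symbol of the first kind, `Γ_{d,ab}`. -/
noncomputable def christoffelLow {n : ℕ} (S : Set (Coord n)) (G : Coord n → Matrix (Fin n) (Fin n) ℝ)
    (d a b : Fin n) (u : Coord n) : ℝ :=
  (1 / 2) * (partialD S a (fun v => G v b d) u + partialD S b (fun v => G v a d) u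
      - partialD S d (fun v => G v a b) u)

theorem christoffel_eq {n : ℕ} (S : Set (Coord n)) (G : Coord n → Matrix (Fin n) (Fin n) ℝ)
    (c a b : Fin n) (u : Coord n) :
    christoffel S G c a b u = ∑ d, (G u)⁻¹ c d * christoffelLow S G d a b u := by
  unfold christoffel christoffelLow
  rw [Finset.mul_sum]
  exact Finset.sum_congr rfl fun d _ => by ring

theorem contDiffWithinAt_det {E : Type*} [NormedAddCommGroup E] [NormedSpace ℝ E] {m : ℕ}
    {F : E → Matrix (Fin m) (Fin m) ℝ} {S : Set E} {u : E}
    (hF : ∀ a b, ContDiffWithinAt ℝ ∞ (fun v => F v a b) S u) :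
    ContDiffWithinAt ℝ ∞ (fun v => (F v).det) S u := by
  simp only [Matrix.det_apply']
  exact ContDiffWithinAt.sum fun σ _ =>
    contDiffWithinAt_const.mul (contDiffWithinAt_prod fun i _ => hF _ _)

theorem contDiffWithinAt_inv {E : Type*} [NormedAddCommGroup E] [NormedSpace ℝ E] {m : ℕ}
    {F : E → Matrix (Fin m) (Fin m) ℝ} {S : Set E} {u : E}
    (hF : ∀ a b, ContDiffWithinAt ℝ ∞ (fun v => F v a b) S u) (hd : (F u).det ≠ 0)
    (a b : Fin m) : ContDiffWithinAt ℝ ∞ (fun v => (F v)⁻¹ a b) S u := by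
  simp only [Matrix.inv_def, Ring.inverse_eq_inv', Matrix.smul_apply, smul_eq_mul,
    Matrix.adjugate_apply]
  refine ((contDiffWithinAt_det hF).inv hd).mul (contDiffWithinAt_det fun i j => ?_)
  -- Cramer's rule: an entry of the adjugate is a determinant with row `b` replaced by a constant
  -- vector; the other rows are those of `F`.
  by_cases h : i = b
  · subst h
    simp only [Matrix.updateRow_self]
    exact contDiffWithinAt_const
  · simp only [Matrix.updateRow_ne h]
    exact hF i j

namespace IsMetricAt

variable {n : ℕ} {S : Set (Coord n)} {G : Coord n → Matrix (Fin n) (Fin n) ℝ} {u : Coord n}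
  (hG : IsMetricAt S G u)

include hG

theorem symm_self (a b : Fin n) : G u a b = G u b a :=
  hG.symm.self_of_nhdsWithin hG.mem a b

theorem smooth_inv (a b : Fin n) : ContDiffWithinAt ℝ ∞ (fun v => (G v)⁻¹ a b) S u :=
  contDiffWithinAt_inv hG.smooth hG.det a b

theorem det_eventually : ∀ᶠ v in 𝓝[S] u, (G v).det ≠ 0 :=
  (contDiffWithinAt_det hG.smooth).continuousWithinAt.eventually_ne hG.det

theorem partialD_symm (e a b : Fin n) :
    partialD S e (fun v => G v a b) u = partialD S e (fun v => G v b a) u :=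
  partialD_congr (hG.symm.mono fun _ h => h a b) hG.mem

theorem smooth_christoffelLow (d a b : Fin n) :
    ContDiffWithinAt ℝ ∞ (christoffelLow S G d a b) S u := by
  have h := fun e a b => contDiffWithinAt_partialD (a := e) hG.dom hG.mem (hG.smooth a b)
  exact contDiffWithinAt_const.mul (((h _ _ _).add (h _ _ _)).sub (h _ _ _))

theorem smooth_christoffel (c a b : Fin n) :
    ContDiffWithinAt ℝ ∞ (christoffel S G c a b) S u := by
  have : christoffel S G c a b
      = fun v => ∑ d, (G v)⁻¹ c d * christoffelLow S G d a b v := by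
    funext v; exact christoffel_eq S G c a b v
  rw [this]
  exact ContDiffWithinAt.sum fun d _ => (hG.smooth_inv _ _).mul (hG.smooth_christoffelLow _ _ _)

theorem christoffelLow_symm (d a b : Fin n) :
    christoffelLow S G d a b u = christoffelLow S G d b a u := by
  unfold christoffelLow
  rw [hG.partialD_symm d a b]
  ring

theorem christoffel_symm (c a b : Fin n) :
    christoffel S G c a b u = christoffel S G c b a u := by
  simp only [christoffel_eq, hG.christoffelLow_symm _ a b]

/-- Compatibility of the Levi-Civita connection with the metric, in first-kind symbols. -/
theorem partialD_metric (e a b : Fin n) :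
    partialD S e (fun v => G v a b) u
      = christoffelLow S G a e b u + christoffelLow S G b e a u := by
  unfold christoffelLow
  rw [hG.partialD_symm e a b, hG.partialD_symm b e a]
  ring

end IsMetricAt

/-- Lowering the first index of the Christoffel symbol. -/
theorem sum_christoffel_mul_metric {n : ℕ} {S : Set (Coord n)}
    {G : Coord n → Matrix (Fin n) (Fin n) ℝ} {u : Coord n} (hs : ∀ a b, G u a b = G u b a)
    (hd : (G u).det ≠ 0) (d a b : Fin n) :
    ∑ c, christoffel S G c a b u * G u c d = christoffelLow S G d a b u := by
  simp only [christoffel_eq, Finset.sum_mul]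
  rw [Finset.sum_comm]
  calc ∑ e, ∑ c, (G u)⁻¹ c e * christoffelLow S G e a b u * G u c d
      = ∑ e, (∑ c, G u d c * (G u)⁻¹ c e) * christoffelLow S G e a b u := by
        simp only [Finset.sum_mul]
        refine Finset.sum_congr rfl fun e _ => Finset.sum_congr rfl fun c _ => ?_
        rw [hs d c]; ring
    _ = _ := by simp [sum_mul_inv hd]

/-! ### Symmetries of the curvature -/

namespace IsMetricAt

variable {n : ℕ} {S : Set (Coord n)} {G : Coord n → Matrix (Fin n) (Fin n) ℝ} {u : Coord n}
  (hG : IsMetricAt S G u)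

include hG

theorem partialD_christoffelLow (a d b c : Fin n) :
    partialD S a (christoffelLow S G d b c) u
      = (1 / 2) * (partialD S a (partialD S b (fun v => G v c d)) u
        + partialD S a (partialD S c (fun v => G v b d)) u
        - partialD S a (partialD S d (fun v => G v b c)) u) := by
  have h := fun e a b => contDiffWithinAt_partialD (a := e) hG.dom hG.mem (hG.smooth a b)
  unfold christoffelLow
  rw [partialD_const_mul hG.dom hG.mem _ (((h _ _ _).add (h _ _ _)).sub (h _ _ _)),
    partialD_sub hG.dom hG.mem ((h _ _ _).add (h _ _ _)) (h _ _ _),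
    partialD_add hG.dom hG.mem (h _ _ _) (h _ _ _)]

theorem inv_symm_self (a b : Fin n) : (G u)⁻¹ a b = (G u)⁻¹ b a :=
  inv_symm hG.symm_self a b

theorem sum_christoffel_mul (d a b : Fin n) :
    ∑ c, christoffel S G c a b u * G u c d = christoffelLow S G d a b u :=
  sum_christoffel_mul_metric hG.symm_self hG.det d a b

/-- Turns a product of a second-kind symbol with a covector into `coform`, so that quadratic terms
contain only first-kind symbols and one inverse metric. -/
theorem sum_christoffel_mul_covector (X : Fin n → ℝ) (a b : Fin n) :
    ∑ c, christoffel S G c a b u * X c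
      = coform (G u)⁻¹ (fun c => christoffelLow S G c a b u) X := by
  simp only [christoffel_eq, coform, contract, Finset.sum_mul]
  rw [Finset.sum_comm]
  refine Finset.sum_congr rfl fun c _ => Finset.sum_congr rfl fun d _ => ?_
  rw [hG.inv_symm_self d c]
  ring

/-- The lowering identity for the Christoffel symbol holds near `u` and may be differentiated there
by the product rule. This avoids any derivative of the inverse metric. -/
theorem sum_partialD_christoffel (a b c d : Fin n) :
    ∑ e, partialD S a (christoffel S G e b c) u * G u e d
      = partialD S a (christoffelLow S G d b c) u
        - ∑ e, christoffel S G e b c u * partialD S a (fun v => G v e d) u := by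
  have h : (fun v => ∑ e, christoffel S G e b c v * G v e d) =ᶠ[𝓝[S] u]
      christoffelLow S G d b c := by
    filter_upwards [hG.symm, hG.det_eventually] with v h1 h2
    exact sum_christoffel_mul_metric h1 h2 d b c
  rw [← partialD_congr h hG.mem, partialD_sum hG.dom hG.mem
    (fun e _ => (hG.smooth_christoffel e b c).mul (hG.smooth e d)), ← Finset.sum_sub_distrib]
  refine Finset.sum_congr rfl fun e _ => ?_
  rw [partialD_mul hG.dom hG.mem (hG.smooth_christoffel e b c) (hG.smooth e d)]
  ring

/-- One of the two halves whose difference is the curvature. By `partialD_metric` the derivative of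
the metric splits into two symbols; one of them cancels the lowered product ΓΓ, the other leaves the
`coform` term. -/
theorem sum_riemannUp_part (a b c d : Fin n) :
    ∑ e, partialD S a (christoffel S G e b c) u * G u e d
      + ∑ e, (∑ f, christoffel S G f b c u * christoffel S G e a f u) * G u e d
      = partialD S a (christoffelLow S G d b c) u
        - coform (G u)⁻¹ (fun e => christoffelLow S G e b c u)
            (fun e => christoffelLow S G e a d u) := by
  have h : ∑ e, (∑ f, christoffel S G f b c u * christoffel S G e a f u) * G u e d
      = ∑ f, christoffel S G f b c u * christoffelLow S G d a f u := by
    simp only [← hG.sum_christoffel_mul, Finset.mul_sum, Finset.sum_mul]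
    rw [Finset.sum_comm]
    simp only [mul_assoc]
  rw [hG.sum_partialD_christoffel, h, ← hG.sum_christoffel_mul_covector]
  simp only [hG.partialD_metric, mul_add, Finset.sum_add_distrib]
  ring

/-- The lowered curvature tensor in terms of the second derivatives of the metric. -/
theorem riemann_eq (a b c d : Fin n) :
    riemann S G a b c d u
      = (1 / 2) * (partialD S a (partialD S c (fun v => G v b d)) u
          - partialD S a (partialD S d (fun v => G v b c)) u
          - partialD S b (partialD S c (fun v => G v a d)) u
          + partialD S b (partialD S d (fun v => G v a c)) u)
        + coform (G u)⁻¹ (fun e => christoffelLow S G e a c u)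
            (fun e => christoffelLow S G e b d u)
        - coform (G u)⁻¹ (fun e => christoffelLow S G e b c u)
            (fun e => christoffelLow S G e a d u) := by
  have h1 := hG.sum_riemannUp_part a b c d
  have h2 := hG.sum_riemannUp_part b a c d
  have h3 : riemann S G a b c d u
      = (∑ e, partialD S a (christoffel S G e b c) u * G u e d
          + ∑ e, (∑ f, christoffel S G f b c u * christoffel S G e a f u) * G u e d)
        - (∑ e, partialD S b (christoffel S G e a c) u * G u e d
          + ∑ e, (∑ f, christoffel S G f a c u * christoffel S G e b f u) * G u e d) := by
    simp only [riemann, riemannUp, add_mul, sub_mul, Finset.sum_add_distrib,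
      Finset.sum_sub_distrib]
    ring
  -- Both halves contain a second derivative of the component `c d`, in opposite orders; commuting
  -- them makes these terms cancel.
  rw [h3, h1, h2, hG.partialD_christoffelLow, hG.partialD_christoffelLow,
    partialD_comm (a := b) (b := a) hG.dom hG.mem (hG.smooth c d)]
  ring

/-- Symmetry of the metric holds on a neighbourhood, hence so does symmetry of its first
derivatives, which can then be differentiated once more. -/
theorem partialD_partialD_symm (e f a b : Fin n) :
    partialD S e (partialD S f (fun v => G v a b)) u
      = partialD S e (partialD S f (fun v => G v b a)) u := by
  refine partialD_congr ?_ hG.mem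
  have h := eventually_eventually_nhdsWithin.mpr hG.symm
  filter_upwards [h, self_mem_nhdsWithin] with v hv hm
  exact partialD_congr (hv.mono fun _ h => h a b) hm

theorem riemann_antisymm (a b c d : Fin n) :
    riemann S G b a c d u = - riemann S G a b c d u := by
  rw [hG.riemann_eq, hG.riemann_eq]
  ring

/-- Read off from `riemann_eq`: once commuting derivatives and symmetric index pairs are put in a
fixed order, both sides agree term by term. The Bianchi identity below is obtained in the same way.
-/
theorem riemann_pair_symm (a b c d : Fin n) :
    riemann S G c d a b u = riemann S G a b c d u := by
  rw [hG.riemann_eq, hG.riemann_eq]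
  have hc := fun e f a b =>
    partialD_comm (a := e) (b := f) hG.dom hG.mem (hG.smooth a b)
  simp only [hG.christoffelLow_symm _ c a, hG.christoffelLow_symm _ d b,
    hG.christoffelLow_symm _ d a, hG.christoffelLow_symm _ c b, hc c a, hc c b, hc d a, hc d b,
    hG.partialD_partialD_symm _ _ d b, hG.partialD_partialD_symm _ _ d a,
    hG.partialD_partialD_symm _ _ c b, hG.partialD_partialD_symm _ _ c a]
  rw [coform_comm (fun e => christoffelLow S G e a d u) _ hG.inv_symm_self]
  ring

theorem riemann_antisymm_right (a b c d : Fin n) :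
    riemann S G a b d c u = - riemann S G a b c d u := by
  rw [← hG.riemann_pair_symm, hG.riemann_antisymm, hG.riemann_pair_symm]

theorem riemann_bianchi (a b c d : Fin n) :
    riemann S G a b c d u + riemann S G b c a d u + riemann S G c a b d u = 0 := by
  simp only [hG.riemann_eq]
  have hc := fun e f a b =>
    partialD_comm (a := e) (b := f) hG.dom hG.mem (hG.smooth a b)
  simp only [hG.christoffelLow_symm _ c a, hG.christoffelLow_symm _ b a,
    hG.christoffelLow_symm _ c b, hc b a, hc c a, hc c b,
    hG.partialD_partialD_symm _ _ b a, hG.partialD_partialD_symm _ _ c a,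
    hG.partialD_partialD_symm _ _ c b]
  ring

theorem riemannUp_eq (a b c d : Fin n) :
    riemannUp S G a b c d u = ∑ e, (G u)⁻¹ d e * riemann S G a b c e u := by
  simp only [riemann, Finset.mul_sum]
  rw [Finset.sum_comm]
  calc riemannUp S G a b c d u
      = ∑ f, riemannUp S G a b c f u * ∑ e, G u f e * (G u)⁻¹ e d := by
        simp [sum_mul_inv hG.det]
    _ = _ := by
        simp only [Finset.mul_sum]
        refine Finset.sum_congr rfl fun e _ => Finset.sum_congr rfl fun c _ => ?_
        rw [hG.inv_symm_self d c]
        ring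

theorem ricci_eq (b c : Fin n) :
    ricci S G b c u = contract (G u)⁻¹ (fun a d => riemann S G a b c d u) := by
  simp only [ricci, hG.riemannUp_eq, contract]

theorem ricci_symm (b c : Fin n) : ricci S G b c u = ricci S G c b u := by
  rw [hG.ricci_eq, hG.ricci_eq, ← contract_swap _ hG.inv_symm_self]
  congr 1
  funext a d
  rw [← hG.riemann_pair_symm, hG.riemann_antisymm, hG.riemann_antisymm_right, neg_neg]

theorem schouten_symm (b c : Fin n) : schouten S G b c u = schouten S G c b u := by
  unfold schouten
  rw [hG.ricci_symm, hG.symm_self b c]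

/-! ### Symmetries of the Weyl tensor -/

theorem weyl_antisymm (a b c d : Fin n) : weyl S G b a c d u = - weyl S G a b c d u := by
  unfold weyl
  rw [hG.riemann_antisymm]
  ring

theorem weyl_antisymm_right (a b c d : Fin n) :
    weyl S G a b d c u = - weyl S G a b c d u := by
  unfold weyl
  rw [hG.riemann_antisymm_right]
  ring

theorem weyl_pair_symm (a b c d : Fin n) : weyl S G c d a b u = weyl S G a b c d u := by
  unfold weyl
  rw [hG.riemann_pair_symm, hG.schouten_symm c a, hG.schouten_symm d a, hG.schouten_symm d b,
    hG.schouten_symm c b, hG.symm_self d b, hG.symm_self c b, hG.symm_self c a,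
    hG.symm_self d a]
  ring

theorem weyl_bianchi (a b c d : Fin n) :
    weyl S G a b c d u + weyl S G b c a d u + weyl S G c a b d u = 0 := by
  have h := hG.riemann_bianchi a b c d
  unfold weyl
  rw [hG.schouten_symm c b, hG.schouten_symm b a, hG.schouten_symm c a, hG.symm_self b a,
    hG.symm_self c a, hG.symm_self c b]
  linear_combination h

/-- The trace of Ric is 2(n-1)J and that of J g is nJ; their difference is (n-2)J. -/
theorem contract_schouten (h1 : (n : ℝ) - 1 ≠ 0) (h2 : (n : ℝ) - 2 ≠ 0) :
    contract (G u)⁻¹ (fun a b => schouten S G a b u) = schoutenTrace S G u := by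
  simp only [schouten, div_eq_mul_inv]
  rw [contract_mul_const, contract_sub, contract_const_mul _ (fun a b => G u a b),
    contract_metric hG.symm_self hG.det]
  have : contract (G u)⁻¹ (fun a b => ricci S G a b u)
      = 2 * ((n : ℝ) - 1) * schoutenTrace S G u := by
    unfold schoutenTrace scalarCurv contract
    field_simp
  rw [this]
  field_simp
  ring

/-- The Weyl tensor is trace-free. -/
theorem contract_weyl (h1 : (n : ℝ) - 1 ≠ 0) (h2 : (n : ℝ) - 2 ≠ 0) (b c : Fin n) :
    contract (G u)⁻¹ (fun a d => weyl S G a b c d u) = 0 := by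
  unfold weyl
  rw [contract_sub, contract_add, contract_sub, contract_add, ← hG.ricci_eq]
  -- The four Schouten terms have traces P, -nP, P and -J g, in total -(n-2)P - J g = -Ric, which
  -- cancels the trace of the curvature.
  have e1 : contract (G u)⁻¹ (fun a d => schouten S G a c u * G u b d) = schouten S G b c u := by
    simp only [hG.symm_self b, mul_comm (schouten S G _ c u)]
    exact contract_metric_left hG.det b fun a => schouten S G a c u
  have e2 : contract (G u)⁻¹ (fun a d => schouten S G b c u * G u a d)
      = schouten S G b c u * n := by
    rw [contract_const_mul _ (fun a b => G u a b), contract_metric hG.symm_self hG.det]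
  have e3 : contract (G u)⁻¹ (fun a d => schouten S G b d u * G u a c) = schouten S G b c u := by
    simp only [hG.symm_self _ c, mul_comm (schouten S G b _ u)]
    exact contract_metric_right hG.det c fun d => schouten S G b d u
  have e4 : contract (G u)⁻¹ (fun a d => schouten S G a d u * G u b c)
      = schoutenTrace S G u * G u b c := by
    rw [contract_mul_const, hG.contract_schouten h1 h2]
  rw [e1, e2, e3, e4]
  have : ((n : ℝ) - 2) * schouten S G b c u
      = ricci S G b c u - schoutenTrace S G u * G u b c := by
    unfold schouten; field_simp
  linear_combination -this

end IsMetricAt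

/-! ### Smoothness of the curvature -/

namespace IsMetricAt

variable {n : ℕ} {S : Set (Coord n)} {G : Coord n → Matrix (Fin n) (Fin n) ℝ} {u : Coord n}
  (hG : IsMetricAt S G u)

include hG

theorem smooth_riemannUp (a b c d : Fin n) :
    ContDiffWithinAt ℝ ∞ (riemannUp S G a b c d) S u := by
  have h := hG.smooth_christoffel
  refine ((contDiffWithinAt_partialD hG.dom hG.mem (h _ _ _)).sub
    (contDiffWithinAt_partialD hG.dom hG.mem (h _ _ _))).add ?_
  exact ContDiffWithinAt.sum fun e _ => ((h _ _ _).mul (h _ _ _)).sub ((h _ _ _).mul (h _ _ _))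

theorem smooth_riemann (a b c d : Fin n) :
    ContDiffWithinAt ℝ ∞ (riemann S G a b c d) S u :=
  ContDiffWithinAt.sum fun _ _ => (hG.smooth_riemannUp _ _ _ _).mul (hG.smooth _ _)

theorem smooth_ricci (a b : Fin n) : ContDiffWithinAt ℝ ∞ (ricci S G a b) S u :=
  ContDiffWithinAt.sum fun _ _ => hG.smooth_riemannUp _ _ _ _

theorem smooth_schouten (a b : Fin n) : ContDiffWithinAt ℝ ∞ (schouten S G a b) S u := by
  have h : ContDiffWithinAt ℝ ∞ (schoutenTrace S G) S u :=
    ContDiffWithinAt.div_const (ContDiffWithinAt.sum fun _ _ => ContDiffWithinAt.sum fun _ _ =>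
      (hG.smooth_inv _ _).mul (hG.smooth_ricci _ _)) _
  exact ((hG.smooth_ricci a b).sub (h.mul (hG.smooth a b))).div_const _

theorem smooth_weyl (a b c d : Fin n) : ContDiffWithinAt ℝ ∞ (weyl S G a b c d) S u :=
  ((((hG.smooth_riemann _ _ _ _).add ((hG.smooth_schouten _ _).mul (hG.smooth _ _))).sub
    ((hG.smooth_schouten _ _).mul (hG.smooth _ _))).add
    ((hG.smooth_schouten _ _).mul (hG.smooth _ _))).sub
    ((hG.smooth_schouten _ _).mul (hG.smooth _ _))

end IsMetricAt

/-! ### Conformal change of the metric -/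

/-- The matrix of components of the metric `exp(2 f) g`. -/
noncomputable def conformal {n : ℕ} (f : Coord n → ℝ) (G : Coord n → Matrix (Fin n) (Fin n) ℝ)
    (u : Coord n) : Matrix (Fin n) (Fin n) ℝ :=
  Real.exp (2 * f u) • G u

/-- The components of the gradient of `f`. -/
noncomputable def grad {n : ℕ} (S : Set (Coord n)) (G : Coord n → Matrix (Fin n) (Fin n) ℝ)
    (f : Coord n → ℝ) (a : Fin n) (u : Coord n) : ℝ :=
  ∑ b, (G u)⁻¹ a b * partialD S b f u

section Conformal

variable {n : ℕ} {S : Set (Coord n)} {G : Coord n → Matrix (Fin n) (Fin n) ℝ} {u : Coord n}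
  {f k : Coord n → ℝ}

theorem partialD_exp_mul (r : ℝ) (hS : IsCoordDomain S) (hu : u ∈ S)
    (hf : ContDiffWithinAt ℝ ∞ f S u) (hk : ContDiffWithinAt ℝ ∞ k S u) (a : Fin n) :
    partialD S a (fun v => Real.exp (r * f v) * k v) u
      = Real.exp (r * f u) * (r * partialD S a f u * k u + partialD S a k u) := by
  have h : ContDiffWithinAt ℝ ∞ (fun v => r * f v) S u := contDiffWithinAt_const.mul hf
  rw [partialD_mul hS hu h.exp hk, partialD_exp hS hu h, partialD_const_mul hS hu r hf]
  ring

theorem conformal_inv (hd : (G u).det ≠ 0) :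
    (conformal f G u)⁻¹ = Real.exp (-(2 * f u)) • (G u)⁻¹ := by
  refine Matrix.inv_eq_left_inv ?_
  rw [conformal, Matrix.smul_mul, Matrix.mul_smul, smul_smul, ← Real.exp_add,
    Matrix.nonsing_inv_mul _ (isUnit_iff_ne_zero.mpr hd)]
  simp

variable (hG : IsMetricAt S G u) (hf : ContDiffWithinAt ℝ ∞ f S u)

include hG hf

theorem isMetricAt_conformal : IsMetricAt S (conformal f G) u where
  dom := hG.dom
  mem := hG.mem
  smooth a b := by
    have h : ContDiffWithinAt ℝ ∞ (fun v => Real.exp (2 * f v)) S u :=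
      (contDiffWithinAt_const.mul hf).exp
    exact h.mul (hG.smooth a b)
  symm := hG.symm.mono fun v h a b => by simp [conformal, h a b]
  det := by
    rw [conformal, Matrix.det_smul]
    exact mul_ne_zero (pow_ne_zero _ (Real.exp_ne_zero _)) hG.det

theorem partialD_conformal (e a b : Fin n) :
    partialD S e (fun v => conformal f G v a b) u
      = Real.exp (2 * f u) * (2 * partialD S e f u * G u a b
          + partialD S e (fun v => G v a b) u) :=
  partialD_exp_mul 2 hG.dom hG.mem hf (hG.smooth a b) e

theorem christoffelLow_conformal (d a b : Fin n) :
    christoffelLow S (conformal f G) d a b u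
      = Real.exp (2 * f u) * (christoffelLow S G d a b u + partialD S a f u * G u b d
          + partialD S b f u * G u a d - partialD S d f u * G u a b) := by
  unfold christoffelLow
  simp only [partialD_conformal hG hf]
  ring

/-- The factor exp(2f) of the first-kind symbols cancels the factor exp(-2f) of the inverse metric;
raising the index in the remaining terms produces Kronecker deltas and the gradient. -/
theorem christoffel_conformal (c a b : Fin n) :
    christoffel S (conformal f G) c a b u
      = christoffel S G c a b u + (if c = b then 1 else 0) * partialD S a f u
        + (if c = a then 1 else 0) * partialD S b f u - G u a b * grad S G f c u := by
  simp only [christoffel_eq, conformal_inv hG.det, christoffelLow_conformal hG hf, grad]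
  have h : ∀ d, (Real.exp (-(2 * f u)) • (G u)⁻¹) c d * (Real.exp (2 * f u)
      * (christoffelLow S G d a b u + partialD S a f u * G u b d
          + partialD S b f u * G u a d - partialD S d f u * G u a b))
      = (G u)⁻¹ c d * christoffelLow S G d a b u + (G u)⁻¹ c d * G u d b * partialD S a f u
        + (G u)⁻¹ c d * G u d a * partialD S b f u
        - G u a b * ((G u)⁻¹ c d * partialD S d f u) := by
    intro d
    have he : Real.exp (-(2 * f u)) * Real.exp (2 * f u) = 1 := by
      rw [← Real.exp_add]; simp
    rw [Matrix.smul_apply, smul_eq_mul, hG.symm_self b d, hG.symm_self a d]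
    linear_combination ((G u)⁻¹ c d * (christoffelLow S G d a b u + partialD S a f u * G u d b
          + partialD S b f u * G u d a - partialD S d f u * G u a b)) * he
  simp only [h, Finset.sum_add_distrib, Finset.sum_sub_distrib, ← Finset.sum_mul,
    ← Finset.mul_sum, sum_inv_mul hG.det]

/-- The change of the connection as it acts on one covariant slot, ready to be applied slot by slot
in covariant derivatives. -/
theorem sum_christoffel_conformal (a b : Fin n) (X : Fin n → ℝ) :
    ∑ c, christoffel S (conformal f G) c a b u * X c
      = ∑ c, christoffel S G c a b u * X c + partialD S a f u * X b + partialD S b f u * X a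
        - G u a b * ∑ c, grad S G f c u * X c := by
  simp only [christoffel_conformal hG hf, add_mul, sub_mul, Finset.sum_add_distrib,
    Finset.sum_sub_distrib, Finset.mul_sum, mul_assoc]
  simp

theorem partialD_partialD_conformal (e e' a b : Fin n) :
    partialD S e (partialD S e' (fun v => conformal f G v a b)) u
      = Real.exp (2 * f u) * (partialD S e (partialD S e' (fun v => G v a b)) u
        + 2 * partialD S e f u * partialD S e' (fun v => G v a b) u
        + 2 * partialD S e' f u * partialD S e (fun v => G v a b) u
        + (2 * partialD S e (partialD S e' f) u + 4 * partialD S e f u * partialD S e' f u)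
          * G u a b) := by
  have hS := hG.dom
  have hf' := contDiffWithinAt_partialD (a := e') hS hG.mem hf
  have hG' := contDiffWithinAt_partialD (a := e') hS hG.mem (hG.smooth a b)
  have h0 : ContDiffWithinAt ℝ ∞ (fun v => 2 * partialD S e' f v) S u :=
    contDiffWithinAt_const.mul hf'
  have h : partialD S e' (fun v => conformal f G v a b) =ᶠ[𝓝[S] u]
      fun v => Real.exp (2 * f v) * (2 * partialD S e' f v * G v a b
          + partialD S e' (fun v => G v a b) v) := by
    -- The first derivative has to be known near `u`. Smoothness at one point does not give
    -- smoothness nearby, but differentiability of order one does persist, and the product rule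
    -- needs no more.
    have h2 : ∀ g : Coord n → ℝ, ContDiffWithinAt ℝ ∞ g S u →
        ∀ᶠ v in 𝓝[S] u, DifferentiableWithinAt ℝ g S v := by
      intro g hg
      have := (hg.of_le (m := 1) (by simp)).eventually (by simp)
      rw [Set.insert_eq_of_mem hG.mem] at this
      exact this.mono fun v hv => hv.differentiableWithinAt (by simp)
    filter_upwards [h2 _ hf, h2 _ (hG.smooth a b), self_mem_nhdsWithin] with v hv1 hv2 hv
    unfold partialD
    have hu := hS.uniqueDiffOn v hv
    have h3 : DifferentiableWithinAt ℝ (fun v => 2 * f v) S v := hv1.const_mul 2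
    change fderivWithin ℝ (fun v => Real.exp (2 * f v) * G v a b) S v (basisVec e') = _
    rw [fderivWithin_fun_mul hu h3.exp hv2, fderivWithin_exp h3 hu, fderivWithin_const_mul hu hv1]
    simp
    ring
  rw [partialD_congr h hG.mem, partialD_exp_mul 2 hS hG.mem hf ((h0.mul (hG.smooth a b)).add hG'),
    partialD_add hS hG.mem (h0.mul (hG.smooth a b)) hG',
    partialD_mul hS hG.mem h0 (hG.smooth a b), partialD_const_mul hS hG.mem 2 hf']
  ring

end Conformal

/-- The difference of the Schouten tensors of `g` and `exp(2 f) g`. -/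
noncomputable def schoutenDiff {n : ℕ} (S : Set (Coord n))
    (G : Coord n → Matrix (Fin n) (Fin n) ℝ) (f : Coord n → ℝ) (a b : Fin n) (u : Coord n) : ℝ :=
  partialD S a (partialD S b f) u
    - coform (G u)⁻¹ (fun c => christoffelLow S G c a b u) (fun c => partialD S c f u)
    - partialD S a f u * partialD S b f u
    + (1 / 2) * coform (G u)⁻¹ (fun c => partialD S c f u) (fun c => partialD S c f u) * G u a b

section Conformal

variable {n : ℕ} {S : Set (Coord n)} {G : Coord n → Matrix (Fin n) (Fin n) ℝ} {u : Coord n}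
  {f : Coord n → ℝ} (hG : IsMetricAt S G u) (hf : ContDiffWithinAt ℝ ∞ f S u)

include hG hf

/-- Two factors exp(2f) from the symbols and one factor exp(-2f) from the inverse metric leave
exp(2f). -/
theorem coform_christoffelLow_conformal (a b c d : Fin n) :
    coform (conformal f G u)⁻¹ (fun e => christoffelLow S (conformal f G) e a b u)
        (fun e => christoffelLow S (conformal f G) e c d u)
      = Real.exp (2 * f u) * coform (G u)⁻¹
          (fun e => christoffelLow S G e a b u + partialD S a f u * G u b e
            + partialD S b f u * G u a e - partialD S e f u * G u a b)
          (fun e => christoffelLow S G e c d u + partialD S c f u * G u d e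
            + partialD S d f u * G u c e - partialD S e f u * G u c d) := by
  have he : Real.exp (-(2 * f u)) * Real.exp (2 * f u) = 1 := by
    rw [← Real.exp_add]; simp
  simp only [christoffelLow_conformal hG hf, conformal_inv hG.det]
  rw [coform_smul, coform_mul_left, coform_mul_right]
  rw [← mul_assoc, he, one_mul]

-- Pairing with a row of the metric is evaluation. So the quadratic terms of the transformed
-- curvature reduce to the old ΓΓ term, pairings with df, and the squared norm of df.
omit hf in
theorem coform_expand (X Y : Fin n → ℝ) (p q r p' q' r' : ℝ) (a b c d : Fin n) :
    coform (G u)⁻¹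
        (fun e => X e + p * G u b e + q * G u a e - partialD S e f u * r)
        (fun e => Y e + p' * G u d e + q' * G u c e - partialD S e f u * r')
      = coform (G u)⁻¹ X Y + p' * X d + q' * X c
        - r' * coform (G u)⁻¹ X (fun e => partialD S e f u)
        + p * (Y b + p' * G u b d + q' * G u b c - partialD S b f u * r')
        + q * (Y a + p' * G u a d + q' * G u a c - partialD S a f u * r')
        - r * (coform (G u)⁻¹ Y (fun e => partialD S e f u) + p' * partialD S d f u
            + q' * partialD S c f u
            - r' * coform (G u)⁻¹ (fun e => partialD S e f u) (fun e => partialD S e f u)) := by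
  have hr : ∀ (Z : Fin n → ℝ) (c : Fin n), coform (G u)⁻¹ Z (fun e => G u c e) = Z c := by
    intro Z c
    simp only [hG.symm_self c]
    exact coform_metric_right _ hG.det c
  simp only [mul_comm (partialD S _ f u) r, mul_comm (partialD S _ f u) r']
  simp only [coform_sub_left, coform_add_left, coform_mul_left, coform_sub_right, coform_add_right,
    coform_mul_right, hr, coform_metric_left _ hG.det]
  rw [coform_comm (fun e => partialD S e f u) Y hG.inv_symm_self]
  ring

/-- The Hessian of exp(2f) and the quadratic terms combine into an algebraic product of g with
`schoutenDiff`. This product has the form of the Schouten terms in the definition of the Weyl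
tensor, which is why they can compensate it. -/
theorem riemann_conformal (a b c d : Fin n) :
    riemann S (conformal f G) a b c d u
      = Real.exp (2 * f u) * (riemann S G a b c d u + schoutenDiff S G f a c u * G u b d
        - schoutenDiff S G f b c u * G u a d + schoutenDiff S G f b d u * G u a c
        - schoutenDiff S G f a d u * G u b c) := by
  rw [(isMetricAt_conformal hG hf).riemann_eq, hG.riemann_eq]
  simp only [partialD_partialD_conformal hG hf, coform_christoffelLow_conformal hG hf,
    coform_expand hG, schoutenDiff]
  rw [coform_comm (fun e => christoffelLow S G e b d u) _ hG.inv_symm_self]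
  simp only [hG.partialD_metric, hG.symm_self b a, hG.symm_self c b, hG.symm_self c a,
    hG.christoffelLow_symm _ b a, hG.christoffelLow_symm _ c a,
    hG.christoffelLow_symm _ c b, hG.christoffelLow_symm _ d a, hG.christoffelLow_symm _ d b,
    hG.christoffelLow_symm _ d c]
  ring

omit hf in
theorem contract_schoutenDiff_aux (b c : Fin n) :
    contract (G u)⁻¹ (fun a d => schoutenDiff S G f a c u * G u b d
        - schoutenDiff S G f b c u * G u a d + schoutenDiff S G f b d u * G u a c
        - schoutenDiff S G f a d u * G u b c)
      = -((n : ℝ) - 2) * schoutenDiff S G f b c u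
        - contract (G u)⁻¹ (fun a d => schoutenDiff S G f a d u) * G u b c := by
  have e1 : contract (G u)⁻¹ (fun a d => schoutenDiff S G f a c u * G u b d)
      = schoutenDiff S G f b c u := by
    simp only [hG.symm_self b, mul_comm (schoutenDiff S G f _ c u)]
    exact contract_metric_left hG.det b fun a => schoutenDiff S G f a c u
  have e2 : contract (G u)⁻¹ (fun a d => schoutenDiff S G f b c u * G u a d)
      = schoutenDiff S G f b c u * n := by
    rw [contract_const_mul _ (fun a b => G u a b), contract_metric hG.symm_self hG.det]
  have e3 : contract (G u)⁻¹ (fun a d => schoutenDiff S G f b d u * G u a c)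
      = schoutenDiff S G f b c u := by
    simp only [hG.symm_self _ c, mul_comm (schoutenDiff S G f b _ u)]
    exact contract_metric_right hG.det c fun d => schoutenDiff S G f b d u
  rw [contract_sub, contract_add, contract_sub, e1, e2, e3, contract_mul_const]
  ring

theorem ricci_conformal (b c : Fin n) :
    ricci S (conformal f G) b c u = ricci S G b c u
      - ((n : ℝ) - 2) * schoutenDiff S G f b c u
      - contract (G u)⁻¹ (fun a d => schoutenDiff S G f a d u) * G u b c := by
  have he : Real.exp (-(2 * f u)) * Real.exp (2 * f u) = 1 := by
    rw [← Real.exp_add]; simp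
  rw [(isMetricAt_conformal hG hf).ricci_eq, conformal_inv hG.det, contract_smul]
  simp only [riemann_conformal hG hf]
  rw [contract_const_mul, ← mul_assoc, he, one_mul]
  have h := contract_schoutenDiff_aux (f := f) hG b c
  have h' := contract_add (G u)⁻¹ (fun a d => riemann S G a b c d u)
    (fun a d => schoutenDiff S G f a c u * G u b d
        - schoutenDiff S G f b c u * G u a d + schoutenDiff S G f b d u * G u a c
        - schoutenDiff S G f a d u * G u b c)
  rw [h, ← hG.ricci_eq] at h'
  simp only [← add_sub_assoc, ← add_assoc] at h'
  rw [h']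
  ring

theorem schoutenTrace_conformal (h1 : (n : ℝ) - 1 ≠ 0) :
    schoutenTrace S (conformal f G) u = Real.exp (-(2 * f u)) * (schoutenTrace S G u
      - contract (G u)⁻¹ (fun a d => schoutenDiff S G f a d u)) := by
  have h : scalarCurv S (conformal f G) u = Real.exp (-(2 * f u)) * (scalarCurv S G u
      - 2 * ((n : ℝ) - 1) * contract (G u)⁻¹ (fun a d => schoutenDiff S G f a d u)) := by
    change contract (conformal f G u)⁻¹ (fun a b => ricci S (conformal f G) a b u)
      = _ * (contract (G u)⁻¹ (fun a b => ricci S G a b u) - _)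
    rw [conformal_inv hG.det, contract_smul]
    simp only [ricci_conformal hG hf]
    rw [contract_sub, contract_sub, contract_const_mul,
      contract_const_mul _ (fun a b => G u a b), contract_metric hG.symm_self hG.det]
    ring
  unfold schoutenTrace
  rw [h]
  field_simp

/-- The multiples of g by the trace of `schoutenDiff`, coming from Ric and from J g, cancel; what
remains is divisible by n - 2. -/
theorem schouten_conformal (h1 : (n : ℝ) - 1 ≠ 0) (h2 : (n : ℝ) - 2 ≠ 0) (a b : Fin n) :
    schouten S (conformal f G) a b u = schouten S G a b u - schoutenDiff S G f a b u := by
  have he : Real.exp (-(2 * f u)) * Real.exp (2 * f u) = 1 := by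
    rw [← Real.exp_add]; simp
  unfold schouten
  rw [ricci_conformal hG hf, schoutenTrace_conformal hG hf h1, conformal, Matrix.smul_apply,
    smul_eq_mul]
  rw [div_eq_iff h2, sub_mul _ (schoutenDiff S G f a b u), div_mul_cancel₀ _ h2]
  linear_combination (-(schoutenTrace S G u
      - contract (G u)⁻¹ (fun a d => schoutenDiff S G f a d u)) * G u a b) * he

/-- The Weyl tensor is conformally covariant. -/
theorem weyl_conformal (h1 : (n : ℝ) - 1 ≠ 0) (h2 : (n : ℝ) - 2 ≠ 0) (a b c d : Fin n) :
    weyl S (conformal f G) a b c d u = Real.exp (2 * f u) * weyl S G a b c d u := by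
  unfold weyl
  simp only [riemann_conformal hG hf, schouten_conformal hG hf h1 h2]
  simp only [conformal, Matrix.smul_apply, smul_eq_mul]
  ring

end Conformal

/-! ### Conformal change of divergences -/

section Conformal

variable {n : ℕ} {S : Set (Coord n)} {G : Coord n → Matrix (Fin n) (Fin n) ℝ} {u : Coord n}
  {f : Coord n → ℝ}

theorem contract_partialD_mul (Y : Fin n → ℝ) :
    contract (G u)⁻¹ (fun d e => partialD S e f u * Y d) = ∑ d, grad S G f d u * Y d := by
  simp only [contract, grad, Finset.sum_mul, mul_assoc]

theorem contract_partialD_mul' (hG : IsMetricAt S G u) (Y : Fin n → ℝ) :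
    contract (G u)⁻¹ (fun d e => partialD S d f u * Y e) = ∑ d, grad S G f d u * Y d := by
  rw [← contract_partialD_mul, ← contract_swap _ hG.inv_symm_self]

theorem contract_eq_zero_of_antisymm {A : Matrix (Fin n) (Fin n) ℝ} (hA : ∀ a b, A a b = A b a)
    {X : Fin n → Fin n → ℝ} (hX : ∀ a b, X b a = - X a b) : contract A X = 0 := by
  have h := contract_swap X hA
  rw [show (fun a b => X b a) = fun a b => -X a b from funext₂ hX, contract_neg] at h
  linarith

/-- The coefficient -2 of the derivative of f in direction `e` is the weight 2 minus one for each of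
the four slots. The neighbourhood hypotheses allow the scaling law of the Weyl tensor to be
differentiated. -/
theorem nabla4_weyl_conformal (h1 : (n : ℝ) - 1 ≠ 0) (h2 : (n : ℝ) - 2 ≠ 0)
    (hG : ∀ᶠ v in 𝓝[S] u, IsMetricAt S G v) (hf : ∀ᶠ v in 𝓝[S] u, ContDiffWithinAt ℝ ∞ f S v)
    (hu : u ∈ S) (e a b c d : Fin n) :
    nabla4 S (conformal f G) (weyl S (conformal f G)) e a b c d u
      = Real.exp (2 * f u) * (nabla4 S G (weyl S G) e a b c d u
        - 2 * (partialD S e f u * weyl S G a b c d u)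
        - partialD S a f u * weyl S G e b c d u
        + G u e a * ∑ m, grad S G f m u * weyl S G m b c d u
        - partialD S b f u * weyl S G a e c d u
        + G u e b * ∑ m, grad S G f m u * weyl S G a m c d u
        - partialD S c f u * weyl S G a b e d u
        + G u e c * ∑ m, grad S G f m u * weyl S G a b m d u
        - partialD S d f u * weyl S G a b c e u
        + G u e d * ∑ m, grad S G f m u * weyl S G a b c m u) := by
  have hGu := hG.self_of_nhdsWithin hu
  have hfu := hf.self_of_nhdsWithin hu
  have hw : ∀ a b c d, weyl S (conformal f G) a b c d =ᶠ[𝓝[S] u]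
      fun v => Real.exp (2 * f v) * weyl S G a b c d v := by
    intro a b c d
    filter_upwards [hG, hf] with v h h' using weyl_conformal h h' h1 h2 a b c d
  unfold nabla4
  rw [partialD_congr (hw a b c d) hu, partialD_exp_mul 2 hGu.dom hu hfu (hGu.smooth_weyl a b c d)]
  simp only [weyl_conformal hGu hfu h1 h2, Finset.sum_add_distrib]
  rw [sum_christoffel_conformal hGu hfu e a
      (fun m => Real.exp (2 * f u) * weyl S G m b c d u),
    sum_christoffel_conformal hGu hfu e b
      (fun m => Real.exp (2 * f u) * weyl S G a m c d u),
    sum_christoffel_conformal hGu hfu e c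
      (fun m => Real.exp (2 * f u) * weyl S G a b m d u),
    sum_christoffel_conformal hGu hfu e d
      (fun m => Real.exp (2 * f u) * weyl S G a b c m u)]
  simp only [mul_left_comm _ (Real.exp (2 * f u)), ← Finset.mul_sum]
  ring

/-- The conformal transformation law of the Cotton tensor. -/
theorem cotton_conformal (h1 : (n : ℝ) - 1 ≠ 0) (h2 : (n : ℝ) - 2 ≠ 0) (h3 : (n : ℝ) - 3 ≠ 0)
    (hG : ∀ᶠ v in 𝓝[S] u, IsMetricAt S G v) (hf : ∀ᶠ v in 𝓝[S] u, ContDiffWithinAt ℝ ∞ f S v)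
    (hu : u ∈ S) (a b c : Fin n) :
    cotton S (conformal f G) a b c u
      = cotton S G a b c u + ∑ m, grad S G f m u * weyl S G a b c m u := by
  have hGu := hG.self_of_nhdsWithin hu
  have hs := hGu.inv_symm_self
  change contract (conformal f G u)⁻¹ (fun d e => nabla4 S (conformal f G)
      (weyl S (conformal f G)) e a b c d u) / _
    = contract (G u)⁻¹ (fun d e => nabla4 S G (weyl S G) e a b c d u) / _ + _
  rw [conformal_inv hGu.det, contract_smul]
  simp only [nabla4_weyl_conformal h1 h2 hG hf hu]
  have he : Real.exp (-(2 * f u)) * Real.exp (2 * f u) = 1 := by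
    rw [← Real.exp_add]; simp
  rw [contract_const_mul, ← mul_assoc, he, one_mul]
  rw [contract_add, contract_sub, contract_add, contract_sub, contract_add, contract_sub,
    contract_add, contract_sub, contract_sub, contract_const_mul,
    contract_const_mul _ (fun d e => weyl S G e b c d u),
    contract_const_mul _ (fun d e => weyl S G a e c d u),
    contract_const_mul _ (fun d e => weyl S G a b e d u),
    contract_mul_const _ (fun d e => G u e d)]
  have e1 := contract_partialD_mul (S := S) (G := G) (u := u) (f := f) (fun d => weyl S G a b c d u)
  have e2 : contract (G u)⁻¹ (fun d e => weyl S G e b c d u) = 0 := by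
    rw [← hGu.contract_weyl h1 h2 b c, ← contract_swap _ hs]
  have e3 := contract_metric_left hGu.det a
    (fun d => ∑ m, grad S G f m u * weyl S G m b c d u)
  have e4 : contract (G u)⁻¹ (fun d e => weyl S G a e c d u) = 0 := by
    have := hGu.contract_weyl h1 h2 a c
    rw [← contract_swap _ hs] at this
    simp only [hGu.weyl_antisymm a, contract_neg] at this ⊢
    linarith
  have e5 := contract_metric_left hGu.det b
    (fun d => ∑ m, grad S G f m u * weyl S G a m c d u)
  have e6 : contract (G u)⁻¹ (fun d e => weyl S G a b e d u) = 0 :=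
    contract_eq_zero_of_antisymm hs fun d e => hGu.weyl_antisymm_right _ _ _ _
  have e7 := contract_metric_left hGu.det c
    (fun d => ∑ m, grad S G f m u * weyl S G a b m d u)
  have e8 := contract_partialD_mul' (f := f) hGu (fun d => weyl S G a b c d u)
  have e9 : contract (G u)⁻¹ (fun d e => G u e d) = n := by
    rw [← contract_metric hGu.symm_self hGu.det, ← contract_swap _ hs]
  rw [e1, e2, e3, e4, e5, e6, e7, e8, e9]
  -- By the first Bianchi identity two of the surviving traces combine to W(a,b,c,grad f). With the
  -- sign from `b2`, the coefficients of this term are -2 + 1 - 1 - 1 + n = n - 3, the normalizing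
  -- factor of the Cotton tensor.
  have b1 : ∑ m, grad S G f m u * weyl S G m b c a u + ∑ m, grad S G f m u * weyl S G a m c b u
      = ∑ m, grad S G f m u * weyl S G a b c m u := by
    rw [← Finset.sum_add_distrib]
    refine Finset.sum_congr rfl fun m _ => ?_
    have p5 := hGu.weyl_bianchi a m c b
    have p7 := hGu.weyl_pair_symm m c a b
    have p8 := hGu.weyl_antisymm_right a b m c
    have p10 := hGu.weyl_antisymm_right m b c a
    have p11 := hGu.weyl_pair_symm m b a c
    have p12 := hGu.weyl_antisymm a c m b
    linear_combination (grad S G f m u) * (p5 + p7 - p8 - p12 + p11 + p10)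
  have b2 : ∑ m, grad S G f m u * weyl S G a b m c u
      = - ∑ m, grad S G f m u * weyl S G a b c m u := by
    rw [← Finset.sum_neg_distrib]
    refine Finset.sum_congr rfl fun m _ => ?_
    rw [hGu.weyl_antisymm_right]
    ring
  rw [b2, ← b1]
  rw [div_add' _ _ _ h3]
  congr 1
  ring

end Conformal

/-- The divergence `∇^k T_{ijk}` of a 3-tensor. -/
noncomputable def div3 {n : ℕ} (S : Set (Coord n)) (G : Coord n → Matrix (Fin n) (Fin n) ℝ)
    (T : Fin n → Fin n → Fin n → Coord n → ℝ) (i j : Fin n) (u : Coord n) : ℝ :=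
  contract (G u)⁻¹ fun k l => nabla3 S G T l i j k u

/-- The conformal transformation law of the divergence of a trace-free 3-tensor of weight one. -/
theorem div3_conformal {n : ℕ} {S : Set (Coord n)} {G : Coord n → Matrix (Fin n) (Fin n) ℝ}
    {u : Coord n} {f : Coord n → ℝ} {T T' : Fin n → Fin n → Fin n → Coord n → ℝ}
    (hG : IsMetricAt S G u) (hf : ContDiffWithinAt ℝ ∞ f S u)
    (hT : ∀ i j k, ContDiffWithinAt ℝ ∞ (T i j k) S u)
    (hT' : ∀ i j k, T' i j k =ᶠ[𝓝[S] u] fun v => Real.exp (1 * f v) * T i j k v)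
    (hanti : ∀ i j k, T i k j u = - T i j k u)
    (htr : ∀ j, contract (G u)⁻¹ (fun k l => T l j k u) = 0) (i j : Fin n) :
    div3 S (conformal f G) T' i j u
      = Real.exp (- f u) * (div3 S G T i j u
        + ((n : ℝ) - 4) * ∑ m, grad S G f m u * T i j m u
        + ∑ m, grad S G f m u * T m j i u) := by
  have hu := hG.mem
  have hs := hG.inv_symm_self
  have key : ∀ k l, nabla3 S (conformal f G) T' l i j k u
      = Real.exp (1 * f u) * (nabla3 S G T l i j k u
        - 2 * (partialD S l f u * T i j k u)
        - partialD S i f u * T l j k u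
        + G u l i * ∑ m, grad S G f m u * T m j k u
        - partialD S j f u * T i l k u
        + G u l j * ∑ m, grad S G f m u * T i m k u
        - partialD S k f u * T i j l u
        + G u l k * ∑ m, grad S G f m u * T i j m u) := by
    intro k l
    have hTu : ∀ i j k, T' i j k u = Real.exp (1 * f u) * T i j k u :=
      fun i j k => (hT' i j k).self_of_nhdsWithin hu
    unfold nabla3
    rw [partialD_congr (hT' i j k) hu, partialD_exp_mul 1 hG.dom hu hf (hT i j k)]
    simp only [hTu, Finset.sum_add_distrib]
    rw [sum_christoffel_conformal hG hf l i (fun m => Real.exp (1 * f u) * T m j k u),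
      sum_christoffel_conformal hG hf l j (fun m => Real.exp (1 * f u) * T i m k u),
      sum_christoffel_conformal hG hf l k (fun m => Real.exp (1 * f u) * T i j m u)]
    simp only [mul_left_comm _ (Real.exp (1 * f u)), ← Finset.mul_sum]
    ring
  unfold div3
  simp only [key]
  rw [conformal_inv hG.det, contract_smul, contract_const_mul, ← mul_assoc, ← Real.exp_add]
  rw [contract_add, contract_sub, contract_add, contract_sub, contract_add, contract_sub,
    contract_sub, contract_const_mul,
    contract_const_mul _ (fun k l => T l j k u), contract_const_mul _ (fun k l => T i l k u),
    contract_mul_const _ (fun k l => G u l k)]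
  have e1 := contract_partialD_mul (S := S) (G := G) (u := u) (f := f) (fun k => T i j k u)
  have e3 := contract_metric_left hG.det i (fun k => ∑ m, grad S G f m u * T m j k u)
  have e4 : contract (G u)⁻¹ (fun k l => T i l k u) = 0 :=
    contract_eq_zero_of_antisymm hs fun k l => hanti _ _ _
  have e5 := contract_metric_left hG.det j (fun k => ∑ m, grad S G f m u * T i m k u)
  have e8 := contract_partialD_mul' (f := f) hG (fun k => T i j k u)
  have e9 : contract (G u)⁻¹ (fun k l => G u l k) = n := by
    rw [← contract_metric hG.symm_self hG.det, ← contract_swap _ hs]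
  rw [e1, htr, e3, e4, e5, e8, e9]
  -- The coefficient of T(i,j,grad f) is -2 (weight one minus three slots), then -1 from this term,
  -- -1 from the last slot and n from the trace of the metric: together n - 4.
  have b2 : ∑ m, grad S G f m u * T i m j u = - ∑ m, grad S G f m u * T i j m u := by
    rw [← Finset.sum_neg_distrib]
    refine Finset.sum_congr rfl fun m _ => ?_
    rw [hanti]
    ring
  rw [b2, show -(2 * f u) + 1 * f u = - f u by ring]
  ring

/-! ### Linear algebra of frames -/

/-- The value of a bilinear form with components `G`. -/
def ip {n : ℕ} (G : Matrix (Fin n) (Fin n) ℝ) (Y Z : Fin n → ℝ) : ℝ :=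
  ∑ a, ∑ b, G a b * Y a * Z b

/-- The value of a 4-linear form with components `T`. -/
def mult4 {n : ℕ} (T : Fin n → Fin n → Fin n → Fin n → ℝ) (Y₁ Y₂ Y₃ Y₄ : Fin n → ℝ) : ℝ :=
  ∑ a, ∑ b, ∑ c, ∑ d, T a b c d * Y₁ a * Y₂ b * Y₃ c * Y₄ d

theorem sum_rotate {α β γ δ : Type*} [Fintype α] [Fintype β] [Fintype γ] [Fintype δ]
    (F : α → β → γ → δ → ℝ) :
    ∑ b, ∑ c, ∑ d, ∑ f, F b c d f = ∑ f, ∑ b, ∑ c, ∑ d, F b c d f := by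
  calc ∑ b, ∑ c, ∑ d, ∑ f, F b c d f = ∑ b, ∑ c, ∑ f, ∑ d, F b c d f :=
        Finset.sum_congr rfl fun _ _ => Finset.sum_congr rfl fun _ _ => Finset.sum_comm
    _ = ∑ b, ∑ f, ∑ c, ∑ d, F b c d f := Finset.sum_congr rfl fun _ _ => Finset.sum_comm
    _ = _ := Finset.sum_comm

theorem sum_comm_pairs {α β γ δ : Type*} [Fintype α] [Fintype β] [Fintype γ] [Fintype δ]
    (F : α → β → γ → δ → ℝ) :
    ∑ a, ∑ b, ∑ k, ∑ l, F a b k l = ∑ k, ∑ l, ∑ a, ∑ b, F a b k l := by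
  calc ∑ a, ∑ b, ∑ k, ∑ l, F a b k l = ∑ a, ∑ k, ∑ b, ∑ l, F a b k l :=
        Finset.sum_congr rfl fun _ _ => Finset.sum_comm
    _ = ∑ k, ∑ a, ∑ b, ∑ l, F a b k l := Finset.sum_comm
    _ = ∑ k, ∑ a, ∑ l, ∑ b, F a b k l :=
        Finset.sum_congr rfl fun _ _ => Finset.sum_congr rfl fun _ _ => Finset.sum_comm
    _ = _ := Finset.sum_congr rfl fun _ _ => Finset.sum_comm

section Mult

variable {n : ℕ}

theorem ip_comm {G : Matrix (Fin n) (Fin n) ℝ} (hG : ∀ a b, G a b = G b a) (Y Z : Fin n → ℝ) :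
    ip G Y Z = ip G Z Y := by
  unfold ip
  rw [Finset.sum_comm]
  refine Finset.sum_congr rfl fun a _ => Finset.sum_congr rfl fun b _ => ?_
  rw [hG]
  ring

variable (T : Fin n → Fin n → Fin n → Fin n → ℝ) (Y₁ Y₂ Y₃ Y₄ : Fin n → ℝ)

theorem mult4_eq_sum :
    mult4 T Y₁ Y₂ Y₃ Y₄ = ∑ a, Y₁ a * ∑ b, ∑ c, ∑ d, T a b c d * Y₂ b * Y₃ c * Y₄ d := by
  simp only [mult4, Finset.mul_sum]
  refine Finset.sum_congr rfl fun a _ => Finset.sum_congr rfl fun b _ =>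
    Finset.sum_congr rfl fun c _ => Finset.sum_congr rfl fun d _ => ?_
  ring

theorem mult4_swap12 : mult4 T Y₁ Y₂ Y₃ Y₄ = mult4 (fun b a c d => T a b c d) Y₂ Y₁ Y₃ Y₄ := by
  unfold mult4
  rw [Finset.sum_comm]
  refine Finset.sum_congr rfl fun a _ => Finset.sum_congr rfl fun b _ =>
    Finset.sum_congr rfl fun c _ => Finset.sum_congr rfl fun d _ => ?_
  ring

theorem mult4_swap23 : mult4 T Y₁ Y₂ Y₃ Y₄ = mult4 (fun a c b d => T a b c d) Y₁ Y₃ Y₂ Y₄ := by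
  unfold mult4
  refine Finset.sum_congr rfl fun a _ => ?_
  rw [Finset.sum_comm]
  refine Finset.sum_congr rfl fun b _ =>
    Finset.sum_congr rfl fun c _ => Finset.sum_congr rfl fun d _ => ?_
  ring

theorem mult4_swap34 : mult4 T Y₁ Y₂ Y₃ Y₄ = mult4 (fun a b d c => T a b c d) Y₁ Y₂ Y₄ Y₃ := by
  unfold mult4
  refine Finset.sum_congr rfl fun a _ => Finset.sum_congr rfl fun b _ => ?_
  rw [Finset.sum_comm]
  refine Finset.sum_congr rfl fun c _ => Finset.sum_congr rfl fun d _ => ?_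
  ring

/-- Linearity for combinations of the shape tangential part plus normal part, which is the shape of
the Gauss and Weingarten formulas. The other slots are reduced to the first by transpositions. -/
theorem mult4_combination₁ {m : ℕ} (r : Fin m → ℝ) (V : Fin m → Fin n → ℝ) (s : ℝ)
    (Z : Fin n → ℝ) :
    mult4 T (fun a => ∑ k, r k * V k a + s * Z a) Y₂ Y₃ Y₄
      = ∑ k, r k * mult4 T (V k) Y₂ Y₃ Y₄ + s * mult4 T Z Y₂ Y₃ Y₄ := by
  simp only [mult4_eq_sum, add_mul, Finset.sum_mul, Finset.sum_add_distrib]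
  congr 1
  · rw [Finset.sum_comm]
    refine Finset.sum_congr rfl fun k _ => ?_
    rw [Finset.mul_sum]
    exact Finset.sum_congr rfl fun a _ => by ring
  · rw [Finset.mul_sum]
    exact Finset.sum_congr rfl fun a _ => by ring

theorem mult4_combination₂ {m : ℕ} (r : Fin m → ℝ) (V : Fin m → Fin n → ℝ) (s : ℝ)
    (Z : Fin n → ℝ) :
    mult4 T Y₁ (fun a => ∑ k, r k * V k a + s * Z a) Y₃ Y₄
      = ∑ k, r k * mult4 T Y₁ (V k) Y₃ Y₄ + s * mult4 T Y₁ Z Y₃ Y₄ := by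
  simp only [mult4_swap12 T Y₁]
  exact mult4_combination₁ ..

theorem mult4_combination₃ {m : ℕ} (r : Fin m → ℝ) (V : Fin m → Fin n → ℝ) (s : ℝ)
    (Z : Fin n → ℝ) :
    mult4 T Y₁ Y₂ (fun a => ∑ k, r k * V k a + s * Z a) Y₄
      = ∑ k, r k * mult4 T Y₁ Y₂ (V k) Y₄ + s * mult4 T Y₁ Y₂ Z Y₄ := by
  simp only [mult4_swap23 T Y₁]
  exact mult4_combination₂ ..

theorem mult4_combination₄ {m : ℕ} (r : Fin m → ℝ) (V : Fin m → Fin n → ℝ) (s : ℝ)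
    (Z : Fin n → ℝ) :
    mult4 T Y₁ Y₂ Y₃ (fun a => ∑ k, r k * V k a + s * Z a)
      = ∑ k, r k * mult4 T Y₁ Y₂ Y₃ (V k) + s * mult4 T Y₁ Y₂ Y₃ Z := by
  simp only [mult4_swap34 T Y₁]
  exact mult4_combination₃ ..

variable (Z : Fin n → ℝ) (r : ℝ)

theorem mult4_add₁ : mult4 T (fun a => Y₁ a + Z a) Y₂ Y₃ Y₄
    = mult4 T Y₁ Y₂ Y₃ Y₄ + mult4 T Z Y₂ Y₃ Y₄ := by
  simpa using mult4_combination₁ T Y₂ Y₃ Y₄ (fun _ : Fin 1 => 1) (fun _ => Y₁) 1 Z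

theorem mult4_add₂ : mult4 T Y₁ (fun a => Y₂ a + Z a) Y₃ Y₄
    = mult4 T Y₁ Y₂ Y₃ Y₄ + mult4 T Y₁ Z Y₃ Y₄ := by
  simpa using mult4_combination₂ T Y₁ Y₃ Y₄ (fun _ : Fin 1 => 1) (fun _ => Y₂) 1 Z

theorem mult4_add₃ : mult4 T Y₁ Y₂ (fun a => Y₃ a + Z a) Y₄
    = mult4 T Y₁ Y₂ Y₃ Y₄ + mult4 T Y₁ Y₂ Z Y₄ := by
  simpa using mult4_combination₃ T Y₁ Y₂ Y₄ (fun _ : Fin 1 => 1) (fun _ => Y₃) 1 Z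

theorem mult4_add₄ : mult4 T Y₁ Y₂ Y₃ (fun a => Y₄ a + Z a)
    = mult4 T Y₁ Y₂ Y₃ Y₄ + mult4 T Y₁ Y₂ Y₃ Z := by
  simpa using mult4_combination₄ T Y₁ Y₂ Y₃ (fun _ : Fin 1 => 1) (fun _ => Y₄) 1 Z

variable (K : Fin n → Fin n → ℝ)

/-- Moves a matrix between a slot of the tensor and the vector inserted there. With `K` the
connection matrix, the connection terms of a tensor and of its arguments can be compared. -/
theorem mult4_transfer₁ : mult4 (fun a b c d => ∑ f, K f a * T f b c d) Y₁ Y₂ Y₃ Y₄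
    = mult4 T (fun a => ∑ f, K a f * Y₁ f) Y₂ Y₃ Y₄ := by
  simp only [mult4, Finset.sum_mul, Finset.mul_sum]
  refine (Finset.sum_congr rfl fun a _ => sum_rotate _).trans
    (Eq.trans ?_ (Finset.sum_congr rfl fun a _ => (sum_rotate _).symm))
  rw [Finset.sum_comm]
  refine Finset.sum_congr rfl fun a _ => Finset.sum_congr rfl fun f _ =>
    Finset.sum_congr rfl fun b _ => Finset.sum_congr rfl fun c _ =>
    Finset.sum_congr rfl fun d _ => ?_
  ring

theorem mult4_transfer₂ : mult4 (fun a b c d => ∑ f, K f b * T a f c d) Y₁ Y₂ Y₃ Y₄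
    = mult4 T Y₁ (fun a => ∑ f, K a f * Y₂ f) Y₃ Y₄ := by
  rw [mult4_swap12, mult4_swap12 T]
  exact mult4_transfer₁ ..

theorem mult4_transfer₃ : mult4 (fun a b c d => ∑ f, K f c * T a b f d) Y₁ Y₂ Y₃ Y₄
    = mult4 T Y₁ Y₂ (fun a => ∑ f, K a f * Y₃ f) Y₄ := by
  rw [mult4_swap23, mult4_swap23 T]
  exact mult4_transfer₂ ..

theorem mult4_transfer₄ : mult4 (fun a b c d => ∑ f, K f d * T a b c f) Y₁ Y₂ Y₃ Y₄
    = mult4 T Y₁ Y₂ Y₃ (fun a => ∑ f, K a f * Y₄ f) := by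
  rw [mult4_swap34, mult4_swap34 T]
  exact mult4_transfer₃ ..

end Mult

/-- The inverse metric in terms of an adapted frame. -/
theorem inv_eq_frame {G : Matrix (Fin 4) (Fin 4) ℝ} {h : Matrix (Fin 3) (Fin 3) ℝ}
    {T : Fin 3 → Fin 4 → ℝ} {N : Fin 4 → ℝ} (hs : ∀ a b, G a b = G b a)
    (hT : ∀ i j, ip G (T i) (T j) = h i j) (hN : ip G N N = 1) (hNT : ∀ i, ip G N (T i) = 0)
    (hd : h.det ≠ 0) (a b : Fin 4) :
    G⁻¹ a b = N a * N b + ∑ k, ∑ l, h⁻¹ k l * T k a * T l b := by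
  -- With the frame as columns of `A`, the Gram matrix of the frame is block diagonal with blocks h
  -- and 1, and `Q` is its inverse; so `A * Q * Aᵀ` is the inverse of `G`.
  let A : Matrix (Fin 4) (Fin 3 ⊕ Unit) ℝ := Matrix.of fun a => Sum.elim (fun k => T k a) fun _ => N a
  let Q : Matrix (Fin 3 ⊕ Unit) (Fin 3 ⊕ Unit) ℝ := Matrix.fromBlocks h⁻¹ 0 0 1
  have h1 : A.transpose * G * A = Matrix.fromBlocks h 0 0 1 := by
    have hip : ∀ Y Z : Fin 4 → ℝ, ip G Y Z = ∑ b, (∑ a, Y a * G a b) * Z b := by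
      intro Y Z
      unfold ip
      rw [Finset.sum_comm]
      refine Finset.sum_congr rfl fun b _ => ?_
      rw [Finset.sum_mul]
      exact Finset.sum_congr rfl fun a _ => by ring
    ext (i | i) (j | j)
    · simpa [A, Matrix.mul_apply, hip] using hT i j
    · have := hNT i
      rw [ip_comm hs] at this
      simpa [A, Matrix.mul_apply, hip] using this
    · simpa [A, Matrix.mul_apply, hip] using hNT j
    · simpa [A, Matrix.mul_apply, hip] using hN
  have h2 : (Q * A.transpose * G) * A = 1 := by
    rw [Matrix.mul_assoc, Matrix.mul_assoc, ← Matrix.mul_assoc A.transpose, h1,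
      Matrix.fromBlocks_multiply]
    simp [Matrix.nonsing_inv_mul h (isUnit_iff_ne_zero.mpr hd)]
  -- A left inverse is a right inverse because 3 + 1 = 4.
  have h3 : A * (Q * A.transpose * G) = 1 :=
    (Matrix.mul_eq_one_comm_of_card_eq _ _ _ (by simp)).mp h2
  have h4 : G⁻¹ = A * Q * A.transpose := by
    refine Matrix.inv_eq_left_inv ?_
    rw [← h3]
    simp only [Matrix.mul_assoc]
  rw [h4]
  simp only [Matrix.mul_apply, Fintype.sum_sum_type, A, Q]
  simp only [Matrix.of_apply, Sum.elim_inl, Sum.elim_inr, Matrix.fromBlocks_apply₁₁,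
    Matrix.fromBlocks_apply₁₂, Matrix.fromBlocks_apply₂₁, Matrix.fromBlocks_apply₂₂,
    Matrix.transpose_apply, Matrix.zero_apply, mul_zero, Finset.sum_const_zero, add_zero,
    zero_add, Matrix.one_apply_eq, mul_one, Finset.univ_unique, Finset.sum_singleton]
  rw [add_comm]
  congr 1
  simp only [Finset.sum_mul]
  rw [Finset.sum_comm]
  exact Finset.sum_congr rfl fun k _ => Finset.sum_congr rfl fun l _ => by ring

/-- Insert the frame expression of the inverse metric into V = G⁻¹ (G V). -/
theorem expand_frame {G : Matrix (Fin 4) (Fin 4) ℝ} {h : Matrix (Fin 3) (Fin 3) ℝ}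
    {T : Fin 3 → Fin 4 → ℝ} {N : Fin 4 → ℝ} (hs : ∀ a b, G a b = G b a) (hdG : G.det ≠ 0)
    (hT : ∀ i j, ip G (T i) (T j) = h i j) (hN : ip G N N = 1) (hNT : ∀ i, ip G N (T i) = 0)
    (hd : h.det ≠ 0) (V : Fin 4 → ℝ) (a : Fin 4) :
    V a = ∑ k, (∑ l, h⁻¹ k l * ip G (T l) V) * T k a + ip G N V * N a := by
  have h1 : V a = ∑ b, G⁻¹ a b * ∑ c, G b c * V c := by
    have : ∑ b, G⁻¹ a b * ∑ c, G b c * V c = ∑ c, (∑ b, G⁻¹ a b * G b c) * V c := by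
      simp only [Finset.mul_sum, Finset.sum_mul]
      rw [Finset.sum_comm]
      simp only [mul_assoc]
    simp [this, sum_inv_mul hdG]
  have h2 : ∀ Y : Fin 4 → ℝ, ip G Y V = ∑ b, Y b * ∑ c, G b c * V c := by
    intro Y
    simp only [ip, Finset.mul_sum]
    refine Finset.sum_congr rfl fun a _ => Finset.sum_congr rfl fun b _ => ?_
    ring
  rw [h1]
  simp only [h2, inv_eq_frame hs hT hN hNT hd, add_mul, Finset.sum_add_distrib]
  -- The lowered vector is kept opaque so that its sum is not distributed.
  generalize hW : (fun b => ∑ c, G b c * V c) = W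
  have hW' : ∀ b, ∑ c, G b c * V c = W b := fun b => congrFun hW b
  simp only [hW']
  rw [add_comm]
  congr 1
  · simp only [Finset.sum_mul, Finset.mul_sum]
    rw [Finset.sum_comm]
    refine Finset.sum_congr rfl fun k _ => ?_
    rw [Finset.sum_comm]
    exact Finset.sum_congr rfl fun l _ => Finset.sum_congr rfl fun b _ => by ring
  · rw [Finset.sum_mul]
    exact Finset.sum_congr rfl fun b _ => by ring

/-! ### Hypersurfaces in coordinates -/

namespace CoordHypersurface

/-- The regularity of a hypersurface in coordinates near a point. -/
structure IsRegularAt (D : CoordHypersurface) (x : Coord 3) : Prop where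
  metric : ∀ᶠ v in 𝓝[D.dom] (D.emb x), IsMetricAt D.dom D.metric v
  emb_mem : ∀ᶠ y in 𝓝 x, D.emb y ∈ D.dom
  emb_smooth (a : Fin 4) : ContDiffWithinAt ℝ ∞ (fun y => D.emb y a) Set.univ x
  normal_smooth (a : Fin 4) : ContDiffWithinAt ℝ ∞ (fun y => D.normal y a) Set.univ x
  unit : ∀ᶠ y in 𝓝 x, ip (D.metric (D.emb y)) (D.normal y) (D.normal y) = 1
  orth : ∀ᶠ y in 𝓝 x, ∀ i, ip (D.metric (D.emb y)) (D.normal y) (fun a => D.tangent i a y) = 0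
  det : (D.h x).det ≠ 0

/-- The components of the ambient covariant derivative of the vector field `Y` along the
hypersurface in the direction `∂_i`. -/
noncomputable def covDeriv (D : CoordHypersurface) (Y : Fin 4 → Coord 3 → ℝ) (i : Fin 3)
    (a : Fin 4) (x : Coord 3) : ℝ :=
  partialD Set.univ i (Y a) x
    + ∑ b, ∑ c, christoffel D.dom D.metric a b c (D.emb x) * D.tangent i b x * Y c x

namespace IsRegularAt

variable {D : CoordHypersurface} {x : Coord 3} (hD : D.IsRegularAt x)

include hD

theorem mem : D.emb x ∈ D.dom := hD.emb_mem.self_of_nhds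

theorem metricAt : IsMetricAt D.dom D.metric (D.emb x) :=
  hD.metric.self_of_nhdsWithin hD.mem

theorem emb_contDiff : ContDiffWithinAt ℝ ∞ D.emb Set.univ x :=
  (contDiffWithinAt_euclidean ..).mpr hD.emb_smooth

theorem tendsto_emb : Tendsto D.emb (𝓝 x) (𝓝[D.dom] D.emb x) := by
  refine tendsto_nhdsWithin_iff.mpr ⟨?_, hD.emb_mem⟩
  have := hD.emb_contDiff.continuousWithinAt
  rwa [continuousWithinAt_univ] at this

theorem eventually_metricAt : ∀ᶠ y in 𝓝 x, IsMetricAt D.dom D.metric (D.emb y) :=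
  hD.tendsto_emb.eventually hD.metric

theorem smooth_comp {F : Coord 4 → ℝ} (hF : ContDiffWithinAt ℝ ∞ F D.dom (D.emb x)) :
    ContDiffWithinAt ℝ ∞ (fun y => F (D.emb y)) Set.univ x := by
  refine hF.comp_of_preimage_mem_nhdsWithin x hD.emb_contDiff ?_
  rw [nhdsWithin_univ]
  exact hD.emb_mem

theorem smooth_tangent (i : Fin 3) (a : Fin 4) :
    ContDiffWithinAt ℝ ∞ (D.tangent i a) Set.univ x :=
  contDiffWithinAt_partialD isCoordDomain_univ (Set.mem_univ x) (hD.emb_smooth a)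

/-- The chain rule for restrictions to the hypersurface. -/
theorem partialD_comp {F : Coord 4 → ℝ} (hF : ContDiffWithinAt ℝ ∞ F D.dom (D.emb x))
    (i : Fin 3) :
    partialD Set.univ i (fun y => F (D.emb y)) x
      = ∑ a, partialD D.dom a F (D.emb x) * D.tangent i a x := by
  have h1 := (differentiableWithinAt_of_smooth hF).hasFDerivWithinAt
  have h2 : DifferentiableAt ℝ D.emb x := by
    have := hD.emb_contDiff.differentiableWithinAt (by simp)
    rwa [differentiableWithinAt_univ] at this
  have h3 := h1.comp_hasFDerivAt x h2.hasFDerivAt hD.emb_mem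
  have h4 : ∀ a, D.tangent i a x = fderiv ℝ D.emb x (basisVec i) a := by
    intro a
    unfold tangent partialD
    rw [fderivWithin_univ]
    have h5 : HasFDerivAt (fun y => D.emb y a)
        ((EuclideanSpace.proj a : Coord 4 →L[ℝ] ℝ).comp (fderiv ℝ D.emb x)) x :=
      (EuclideanSpace.proj a : Coord 4 →L[ℝ] ℝ).hasFDerivAt.comp x h2.hasFDerivAt
    rw [h5.fderiv]
    rfl
  have h6 : ∀ v : Coord 4, v = ∑ a, v a • basisVec a := by
    intro v
    ext b
    simp [basisVec, Pi.single_apply]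
  simp only [h4]
  unfold partialD
  rw [fderivWithin_univ]
  change fderiv ℝ (F ∘ D.emb) x (basisVec i) = _
  rw [h3.fderiv, ContinuousLinearMap.comp_apply, h6 (fderiv ℝ D.emb x (basisVec i)), map_sum]
  refine Finset.sum_congr rfl fun a _ => ?_
  rw [← h6, map_smul, smul_eq_mul, mul_comm]

omit hD in
theorem h_eq (i j : Fin 3) :
    D.h x i j = ip (D.metric (D.emb x)) (fun a => D.tangent i a x) (fun a => D.tangent j a x) :=
  rfl

/-- Torsion-freeness: the second derivatives of the embedding commute and the ambient Christoffel
symbols are symmetric. -/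
theorem covDeriv_tangent_symm (i j : Fin 3) (a : Fin 4) :
    D.covDeriv (D.tangent j) i a x = D.covDeriv (D.tangent i) j a x := by
  unfold covDeriv
  congr 1
  · exact partialD_comm isCoordDomain_univ (Set.mem_univ x) (hD.emb_smooth a)
  · rw [Finset.sum_comm]
    refine Finset.sum_congr rfl fun b _ => Finset.sum_congr rfl fun c _ => ?_
    rw [hD.metricAt.christoffel_symm]
    ring

/-- Metric compatibility of the ambient connection along the hypersurface. -/
theorem partialD_ip {Y Z : Fin 4 → Coord 3 → ℝ}
    (hY : ∀ a, ContDiffWithinAt ℝ ∞ (Y a) Set.univ x)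
    (hZ : ∀ a, ContDiffWithinAt ℝ ∞ (Z a) Set.univ x) (i : Fin 3) :
    partialD Set.univ i (fun y => ip (D.metric (D.emb y)) (fun a => Y a y) (fun a => Z a y)) x
      = ip (D.metric (D.emb x)) (fun a => D.covDeriv Y i a x) (fun a => Z a x)
        + ip (D.metric (D.emb x)) (fun a => Y a x) (fun a => D.covDeriv Z i a x) := by
  have hu := Set.mem_univ x
  have hS := isCoordDomain_univ (n := 3)
  have hG := fun a b => hD.smooth_comp (hD.metricAt.smooth a b)
  have hm := hD.metricAt
  unfold ip
  rw [partialD_sum hS hu fun a _ => ContDiffWithinAt.sum fun b _ =>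
    ((hG a b).mul (hY a)).mul (hZ b)]
  have h1 : ∀ a, partialD Set.univ i (fun y => ∑ b, D.metric (D.emb y) a b * Y a y * Z b y) x
      = ∑ b, ((∑ e, (christoffelLow D.dom D.metric a e b (D.emb x)
          + christoffelLow D.dom D.metric b e a (D.emb x)) * D.tangent i e x) * Y a x * Z b x
        + D.metric (D.emb x) a b * partialD Set.univ i (Y a) x * Z b x
        + D.metric (D.emb x) a b * Y a x * partialD Set.univ i (Z b) x) := by
    intro a
    rw [partialD_sum hS hu fun b _ => ((hG a b).mul (hY a)).mul (hZ b)]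
    refine Finset.sum_congr rfl fun b _ => ?_
    rw [partialD_mul hS hu ((hG a b).mul (hY a)) (hZ b), partialD_mul hS hu (hG a b) (hY a),
      hD.partialD_comp (hm.smooth a b)]
    simp only [hm.partialD_metric]
    ring
  -- `K` is the matrix of the ambient connection in direction `∂_i`. The derivative of the metric
  -- along the hypersurface is `K` lowered in each of the two slots, which supplies the connection
  -- terms of `Y` and `Z`.
  let K : Fin 4 → Fin 4 → ℝ := fun a c =>
    ∑ e, christoffel D.dom D.metric a e c (D.emb x) * D.tangent i e x
  have hcov : ∀ (Y : Fin 4 → Coord 3 → ℝ) a,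
      D.covDeriv Y i a x = partialD Set.univ i (Y a) x + ∑ c, K a c * Y c x := by
    intro Y a
    simp only [covDeriv, K, Finset.sum_mul]
    rw [Finset.sum_comm]
  have hlow : ∀ a b, ∑ e, christoffelLow D.dom D.metric b e a (D.emb x) * D.tangent i e x
      = ∑ c, K c a * D.metric (D.emb x) c b := by
    intro a b
    simp only [← hm.sum_christoffel_mul, K, Finset.sum_mul]
    rw [Finset.sum_comm]
    exact Finset.sum_congr rfl fun c _ => Finset.sum_congr rfl fun e _ => by ring
  simp only [h1, hcov, mul_add, add_mul, Finset.sum_add_distrib, hlow]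
  have h2 : ∑ a, ∑ b, D.metric (D.emb x) a b * (∑ c, K a c * Y c x) * Z b x
      = ∑ a, ∑ b, (∑ c, K c a * D.metric (D.emb x) c b) * Y a x * Z b x := by
    simp only [Finset.mul_sum, Finset.sum_mul]
    rw [Finset.sum_comm]
    conv_rhs => rw [Finset.sum_comm]
    refine Finset.sum_congr rfl fun b _ => ?_
    rw [Finset.sum_comm]
    exact Finset.sum_congr rfl fun a _ => Finset.sum_congr rfl fun c _ => by ring
  have h3 : ∑ a, ∑ b, D.metric (D.emb x) a b * Y a x * (∑ c, K b c * Z c x)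
      = ∑ a, ∑ b, (∑ c, K c b * D.metric (D.emb x) c a) * Y a x * Z b x := by
    simp only [Finset.mul_sum, Finset.sum_mul]
    refine Finset.sum_congr rfl fun a _ => ?_
    rw [Finset.sum_comm]
    refine Finset.sum_congr rfl fun b _ => Finset.sum_congr rfl fun c _ => ?_
    rw [hm.symm_self a c]
    ring
  rw [h2, h3]
  ring

/-- The Leibniz rule for a 4-tensor of the ambient space along the hypersurface. -/
theorem partialD_mult4 {W : Fin 4 → Fin 4 → Fin 4 → Fin 4 → Coord 4 → ℝ}
    (hW : ∀ a b c d, ContDiffWithinAt ℝ ∞ (W a b c d) D.dom (D.emb x))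
    {Y₁ Y₂ Y₃ Y₄ : Fin 4 → Coord 3 → ℝ}
    (h₁ : ∀ a, ContDiffWithinAt ℝ ∞ (Y₁ a) Set.univ x)
    (h₂ : ∀ a, ContDiffWithinAt ℝ ∞ (Y₂ a) Set.univ x)
    (h₃ : ∀ a, ContDiffWithinAt ℝ ∞ (Y₃ a) Set.univ x)
    (h₄ : ∀ a, ContDiffWithinAt ℝ ∞ (Y₄ a) Set.univ x) (i : Fin 3) :
    partialD Set.univ i (fun y => mult4 (fun a b c d => W a b c d (D.emb y)) (fun a => Y₁ a y)
        (fun a => Y₂ a y) (fun a => Y₃ a y) (fun a => Y₄ a y)) x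
      = mult4 (fun a b c d => ∑ e, nabla4 D.dom D.metric W e a b c d (D.emb x) * D.tangent i e x)
          (fun a => Y₁ a x) (fun a => Y₂ a x) (fun a => Y₃ a x) (fun a => Y₄ a x)
        + mult4 (fun a b c d => W a b c d (D.emb x)) (fun a => D.covDeriv Y₁ i a x)
            (fun a => Y₂ a x) (fun a => Y₃ a x) (fun a => Y₄ a x)
        + mult4 (fun a b c d => W a b c d (D.emb x)) (fun a => Y₁ a x)
            (fun a => D.covDeriv Y₂ i a x) (fun a => Y₃ a x) (fun a => Y₄ a x)
        + mult4 (fun a b c d => W a b c d (D.emb x)) (fun a => Y₁ a x)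
            (fun a => Y₂ a x) (fun a => D.covDeriv Y₃ i a x) (fun a => Y₄ a x)
        + mult4 (fun a b c d => W a b c d (D.emb x)) (fun a => Y₁ a x)
            (fun a => Y₂ a x) (fun a => Y₃ a x) (fun a => D.covDeriv Y₄ i a x) := by
  have hu := Set.mem_univ x
  have hS := isCoordDomain_univ (n := 3)
  have hW' := fun a b c d => hD.smooth_comp (hW a b c d)
  let K : Fin 4 → Fin 4 → ℝ := fun a c =>
    ∑ e, christoffel D.dom D.metric a e c (D.emb x) * D.tangent i e x
  have hcov : ∀ (Y : Fin 4 → Coord 3 → ℝ) a,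
      D.covDeriv Y i a x = partialD Set.univ i (Y a) x + ∑ c, K a c * Y c x := by
    intro Y a
    simp only [covDeriv, K, Finset.sum_mul]
    rw [Finset.sum_comm]
  -- Once the connection terms of the four vectors sit on the tensor, the identity holds for each
  -- choice of indices: these terms are the ones that `nabla4` subtracts.
  simp only [hcov, mult4_add₁, mult4_add₂, mult4_add₃, mult4_add₄, ← mult4_transfer₁,
    ← mult4_transfer₂, ← mult4_transfer₃, ← mult4_transfer₄]
  have hp : ∀ a b c d, partialD Set.univ i
        (fun y => W a b c d (D.emb y) * Y₁ a y * Y₂ b y * Y₃ c y * Y₄ d y) x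
      = (∑ e, nabla4 D.dom D.metric W e a b c d (D.emb x) * D.tangent i e x)
            * Y₁ a x * Y₂ b x * Y₃ c x * Y₄ d x
        + (W a b c d (D.emb x) * partialD Set.univ i (Y₁ a) x * Y₂ b x * Y₃ c x * Y₄ d x
          + (∑ f, K f a * W f b c d (D.emb x)) * Y₁ a x * Y₂ b x * Y₃ c x * Y₄ d x)
        + (W a b c d (D.emb x) * Y₁ a x * partialD Set.univ i (Y₂ b) x * Y₃ c x * Y₄ d x
          + (∑ f, K f b * W a f c d (D.emb x)) * Y₁ a x * Y₂ b x * Y₃ c x * Y₄ d x)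
        + (W a b c d (D.emb x) * Y₁ a x * Y₂ b x * partialD Set.univ i (Y₃ c) x * Y₄ d x
          + (∑ f, K f c * W a b f d (D.emb x)) * Y₁ a x * Y₂ b x * Y₃ c x * Y₄ d x)
        + (W a b c d (D.emb x) * Y₁ a x * Y₂ b x * Y₃ c x * partialD Set.univ i (Y₄ d) x
          + (∑ f, K f d * W a b c f (D.emb x)) * Y₁ a x * Y₂ b x * Y₃ c x * Y₄ d x) := by
    intro a b c d
    have q1 := (hW' a b c d).mul (h₁ a)
    have q2 := q1.mul (h₂ b)
    have q3 := q2.mul (h₃ c)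
    rw [partialD_mul hS hu q3 (h₄ d), partialD_mul hS hu q2 (h₃ c), partialD_mul hS hu q1 (h₂ b),
      partialD_mul hS hu (hW' a b c d) (h₁ a), hD.partialD_comp (hW a b c d)]
    have hK : ∀ (a : Fin 4) (X : Fin 4 → ℝ), ∑ f, K f a * X f
        = ∑ e, (∑ f, christoffel D.dom D.metric f e a (D.emb x) * X f) * D.tangent i e x := by
      intro a X
      simp only [K, Finset.sum_mul]
      rw [Finset.sum_comm]
      exact Finset.sum_congr rfl fun e _ => Finset.sum_congr rfl fun f _ => by ring
    simp only [hK, nabla4, sub_mul, add_mul, Finset.sum_add_distrib, Finset.sum_sub_distrib]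
    ring
  have hq : ∀ a b c d, ContDiffWithinAt ℝ ∞
      (fun y => W a b c d (D.emb y) * Y₁ a y * Y₂ b y * Y₃ c y * Y₄ d y) Set.univ x :=
    fun a b c d => ((((hW' a b c d).mul (h₁ a)).mul (h₂ b)).mul (h₃ c)).mul (h₄ d)
  have hsum : partialD Set.univ i (fun y => ∑ a, ∑ b, ∑ c, ∑ d,
        W a b c d (D.emb y) * Y₁ a y * Y₂ b y * Y₃ c y * Y₄ d y) x
      = ∑ a, ∑ b, ∑ c, ∑ d, partialD Set.univ i
        (fun y => W a b c d (D.emb y) * Y₁ a y * Y₂ b y * Y₃ c y * Y₄ d y) x := by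
    rw [partialD_sum hS hu fun a _ => ContDiffWithinAt.sum fun b _ => ContDiffWithinAt.sum
      fun c _ => ContDiffWithinAt.sum fun d _ => hq a b c d]
    refine Finset.sum_congr rfl fun a _ => ?_
    rw [partialD_sum hS hu fun b _ => ContDiffWithinAt.sum
      fun c _ => ContDiffWithinAt.sum fun d _ => hq a b c d]
    refine Finset.sum_congr rfl fun b _ => ?_
    rw [partialD_sum hS hu fun c _ => ContDiffWithinAt.sum fun d _ => hq a b c d]
    refine Finset.sum_congr rfl fun c _ => ?_
    rw [partialD_sum hS hu fun d _ => hq a b c d]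
  unfold mult4
  rw [hsum]
  simp only [hp, Finset.sum_add_distrib]

end IsRegularAt

end CoordHypersurface

/-! ### Symmetries of the Weyl tensor as a 4-linear form -/

section Mult

variable {n : ℕ} (T : Fin n → Fin n → Fin n → Fin n → ℝ) (Y₁ Y₂ Y₃ Y₄ : Fin n → ℝ)

theorem mult4_neg : mult4 (fun a b c d => - T a b c d) Y₁ Y₂ Y₃ Y₄ = - mult4 T Y₁ Y₂ Y₃ Y₄ := by
  simp [mult4]

variable {S : Set (Coord n)} {G : Coord n → Matrix (Fin n) (Fin n) ℝ} {u : Coord n}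
  (hG : IsMetricAt S G u)

include hG

theorem mult4_weyl_antisymm :
    mult4 (fun a b c d => weyl S G a b c d u) Y₂ Y₁ Y₃ Y₄
      = - mult4 (fun a b c d => weyl S G a b c d u) Y₁ Y₂ Y₃ Y₄ := by
  rw [mult4_swap12, ← mult4_neg]
  congr 1
  funext a b c d
  exact hG.weyl_antisymm a b c d

theorem mult4_weyl_antisymm_right :
    mult4 (fun a b c d => weyl S G a b c d u) Y₁ Y₂ Y₄ Y₃
      = - mult4 (fun a b c d => weyl S G a b c d u) Y₁ Y₂ Y₃ Y₄ := by
  rw [mult4_swap34, ← mult4_neg]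
  congr 1
  funext a b c d
  exact hG.weyl_antisymm_right a b c d

theorem mult4_weyl_pair_symm :
    mult4 (fun a b c d => weyl S G a b c d u) Y₃ Y₄ Y₁ Y₂
      = mult4 (fun a b c d => weyl S G a b c d u) Y₁ Y₂ Y₃ Y₄ := by
  rw [mult4_swap23, mult4_swap12, mult4_swap34, mult4_swap23]
  simp only [hG.weyl_pair_symm]

theorem mult4_weyl_self : mult4 (fun a b c d => weyl S G a b c d u) Y₁ Y₁ Y₃ Y₄ = 0 := by
  have := mult4_weyl_antisymm Y₁ Y₁ Y₃ Y₄ hG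
  linarith

end Mult

/-! ### Gauss and Weingarten formulas; the ambient Cotton tensor in an adapted frame -/

namespace CoordHypersurface

/-- The components of the ambient Weyl tensor at a point of the hypersurface. -/
noncomputable def weylForm (D : CoordHypersurface) (x : Coord 3)
    (Y₁ Y₂ Y₃ Y₄ : Fin 4 → ℝ) : ℝ :=
  mult4 (fun a b c d => D.ambientWeyl a b c d (D.emb x)) Y₁ Y₂ Y₃ Y₄

/-- The shape operator `L_l^m`. -/
noncomputable def shape (D : CoordHypersurface) (x : Coord 3) (m l : Fin 3) : ℝ :=
  ∑ n, (D.h x)⁻¹ m n * D.L x l n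

theorem weylFirst_eq (D : CoordHypersurface) (i j k : Fin 3) (x : Coord 3) :
    D.weylFirst i j k x = D.weylForm x (D.normal x) (fun a => D.tangent i a x)
      (fun a => D.tangent j a x) (fun a => D.tangent k a x) :=
  rfl

theorem weylLast_eq (D : CoordHypersurface) (i j k : Fin 3) (x : Coord 3) :
    D.weylLast i j k x = D.weylForm x (fun a => D.tangent i a x)
      (fun a => D.tangent j a x) (fun a => D.tangent k a x) (D.normal x) :=
  rfl

theorem weylTan_eq (D : CoordHypersurface) (k i j l : Fin 3) (x : Coord 3) :
    D.weylTan k i j l x = D.weylForm x (fun a => D.tangent k a x)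
      (fun a => D.tangent i a x) (fun a => D.tangent j a x) (fun a => D.tangent l a x) :=
  rfl

theorem weylNN_eq (D : CoordHypersurface) (i j : Fin 3) (x : Coord 3) :
    D.weylNN x i j = D.weylForm x (D.normal x) (fun a => D.tangent i a x)
      (fun a => D.tangent j a x) (D.normal x) :=
  rfl

namespace IsRegularAt

variable {D : CoordHypersurface} {x : Coord 3} (hD : D.IsRegularAt x)

include hD

/-- Makes the coordinate calculus available for the induced metric, on the whole of the parameter
space since `M` has no boundary. -/
theorem isMetricAt_h : IsMetricAt Set.univ D.h x where
  dom := isCoordDomain_univ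
  mem := Set.mem_univ x
  smooth i j := by
    change ContDiffWithinAt ℝ ∞ (fun y => ∑ a, ∑ b, D.metric (D.emb y) a b * D.tangent i a y
      * D.tangent j b y) _ _
    exact ContDiffWithinAt.sum fun a _ => ContDiffWithinAt.sum fun b _ =>
      ((hD.smooth_comp (hD.metricAt.smooth a b)).mul (hD.smooth_tangent i a)).mul
        (hD.smooth_tangent j b)
  symm := by
    rw [nhdsWithin_univ]
    filter_upwards [hD.eventually_metricAt] with y hy i j
    exact HypersurfaceBach.ip_comm hy.symm_self (fun a => D.tangent i a y)
      (fun a => D.tangent j a y)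
  det := hD.det

theorem unit_self : ip (D.metric (D.emb x)) (D.normal x) (D.normal x) = 1 :=
  hD.unit.self_of_nhds

theorem orth_self (i : Fin 3) :
    ip (D.metric (D.emb x)) (D.normal x) (fun a => D.tangent i a x) = 0 :=
  hD.orth.self_of_nhds i

theorem inv_eq (a b : Fin 4) :
    (D.metric (D.emb x))⁻¹ a b = D.normal x a * D.normal x b
      + ∑ k, ∑ l, (D.h x)⁻¹ k l * D.tangent k a x * D.tangent l b x :=
  inv_eq_frame (T := fun k a => D.tangent k a x) hD.metricAt.symm_self
    (fun i j => (h_eq i j).symm) hD.unit_self hD.orth_self hD.det a b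

theorem expand (V : Fin 4 → ℝ) (a : Fin 4) :
    V a = ∑ k, (∑ l, (D.h x)⁻¹ k l
        * ip (D.metric (D.emb x)) (fun a => D.tangent l a x) V) * D.tangent k a x
      + ip (D.metric (D.emb x)) (D.normal x) V * D.normal x a :=
  expand_frame (T := fun k a => D.tangent k a x) hD.metricAt.symm_self hD.metricAt.det
    (fun i j => (h_eq i j).symm) hD.unit_self hD.orth_self hD.det V a

theorem ip_comm (Y Z : Fin 4 → ℝ) :
    ip (D.metric (D.emb x)) Y Z = ip (D.metric (D.emb x)) Z Y :=
  HypersurfaceBach.ip_comm hD.metricAt.symm_self Y Z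

theorem L_eq (i j : Fin 3) :
    D.L x i j = - ip (D.metric (D.emb x)) (D.normal x)
      (fun a => D.covDeriv (D.tangent j) i a x) := by
  rw [hD.ip_comm]
  rfl

theorem L_symm (i j : Fin 3) : D.L x i j = D.L x j i := by
  rw [hD.L_eq, hD.L_eq]
  simp only [hD.covDeriv_tangent_symm i j]

theorem partialD_h (i j k : Fin 3) :
    partialD Set.univ i (fun y => D.h y j k) x
      = ip (D.metric (D.emb x)) (fun a => D.covDeriv (D.tangent j) i a x)
          (fun a => D.tangent k a x)
        + ip (D.metric (D.emb x)) (fun a => D.covDeriv (D.tangent k) i a x)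
          (fun a => D.tangent j a x) := by
  rw [hD.ip_comm (fun a => D.covDeriv (D.tangent k) i a x)]
  exact hD.partialD_ip (hD.smooth_tangent j) (hD.smooth_tangent k) i

/-- Koszul's argument: metric compatibility gives six scalar products, torsion-freeness cancels four
of them and identifies the other two. So the tangential part of the ambient derivative is the
Levi-Civita connection of h. -/
theorem christoffelLow_h (l i j : Fin 3) :
    christoffelLow Set.univ D.h l i j x
      = ip (D.metric (D.emb x)) (fun a => D.tangent l a x)
          (fun a => D.covDeriv (D.tangent j) i a x) := by
  unfold christoffelLow
  rw [hD.ip_comm, hD.partialD_h, hD.partialD_h, hD.partialD_h]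
  simp only [hD.covDeriv_tangent_symm j i, hD.covDeriv_tangent_symm l i,
    hD.covDeriv_tangent_symm l j]
  ring

/-- The Gauss formula. -/
theorem gauss (i j : Fin 3) :
    (fun a => D.covDeriv (D.tangent j) i a x)
      = fun a => ∑ k, christoffel Set.univ D.h k i j x * D.tangent k a x
        + (- D.L x i j) * D.normal x a := by
  funext a
  rw [hD.expand (fun a => D.covDeriv (D.tangent j) i a x) a, hD.L_eq, neg_neg]
  simp only [christoffel_eq, hD.christoffelLow_h]

/-- The Weingarten formula. -/
theorem weingarten (i : Fin 3) :
    (fun a => D.covDeriv (fun a y => D.normal y a) i a x)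
      = fun a => ∑ k, D.shape x k i * D.tangent k a x + 0 * D.normal x a := by
  -- Differentiate (N, N) = 1. The vanishing normal part is kept in the statement as `0 * N` to
  -- match the `mult4_combination` lemmas.
  have h1 : ip (D.metric (D.emb x)) (D.normal x)
      (fun a => D.covDeriv (fun a y => D.normal y a) i a x) = 0 := by
    have h := hD.partialD_ip hD.normal_smooth hD.normal_smooth i
    rw [partialD_congr (g := fun _ => 1) (by rw [nhdsWithin_univ]; exact hD.unit)
      (Set.mem_univ x), partialD_const, hD.ip_comm] at h
    linarith
  -- Differentiate (N, ∂_l) = 0.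
  have h2 : ∀ l, ip (D.metric (D.emb x)) (fun a => D.tangent l a x)
      (fun a => D.covDeriv (fun a y => D.normal y a) i a x) = D.L x i l := by
    intro l
    have h := hD.partialD_ip hD.normal_smooth (hD.smooth_tangent l) i
    rw [partialD_congr (g := fun _ => 0)
      (by rw [nhdsWithin_univ]; exact hD.orth.mono fun y hy => hy l)
      (Set.mem_univ x), partialD_const, hD.ip_comm] at h
    rw [hD.L_eq]
    linarith
  funext a
  rw [hD.expand (fun a => D.covDeriv (fun a y => D.normal y a) i a x) a, h1]
  simp only [h2, shape]

theorem weylForm_antisymm (Y₁ Y₂ Y₃ Y₄ : Fin 4 → ℝ) :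
    D.weylForm x Y₂ Y₁ Y₃ Y₄ = - D.weylForm x Y₁ Y₂ Y₃ Y₄ :=
  mult4_weyl_antisymm Y₁ Y₂ Y₃ Y₄ hD.metricAt

theorem weylForm_antisymm_right (Y₁ Y₂ Y₃ Y₄ : Fin 4 → ℝ) :
    D.weylForm x Y₁ Y₂ Y₄ Y₃ = - D.weylForm x Y₁ Y₂ Y₃ Y₄ :=
  mult4_weyl_antisymm_right Y₁ Y₂ Y₃ Y₄ hD.metricAt

theorem weylForm_pair_symm (Y₁ Y₂ Y₃ Y₄ : Fin 4 → ℝ) :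
    D.weylForm x Y₃ Y₄ Y₁ Y₂ = D.weylForm x Y₁ Y₂ Y₃ Y₄ :=
  mult4_weyl_pair_symm Y₁ Y₂ Y₃ Y₄ hD.metricAt

theorem weylForm_self (Y₁ Y₃ Y₄ : Fin 4 → ℝ) : D.weylForm x Y₁ Y₁ Y₃ Y₄ = 0 :=
  mult4_weyl_self Y₁ Y₃ Y₄ hD.metricAt

/-- Contractions with the ambient metric in terms of the frame. -/
theorem contract_frame (X : Fin 4 → Fin 4 → ℝ) :
    contract (D.metric (D.emb x))⁻¹ X
      = ∑ a, ∑ b, X a b * D.normal x a * D.normal x b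
        + ∑ k, ∑ l, (D.h x)⁻¹ k l
          * ∑ a, ∑ b, X a b * D.tangent k a x * D.tangent l b x := by
  simp only [contract, hD.inv_eq, add_mul, Finset.sum_add_distrib]
  congr 1
  · exact Finset.sum_congr rfl fun a _ => Finset.sum_congr rfl fun b _ => by ring
  · simp only [Finset.sum_mul, Finset.mul_sum]
    rw [sum_comm_pairs]
    exact Finset.sum_congr rfl fun k _ => Finset.sum_congr rfl fun l _ =>
      Finset.sum_congr rfl fun a _ => Finset.sum_congr rfl fun b _ => by ring

/-- The ambient trace over the outer slots, which is zero, splits along the frame. It converts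
tangential traces into W_{0··0}, and with the normal as `Y` it makes W_{0ijk} trace-free. -/
theorem weylForm_trace (Y Z : Fin 4 → ℝ) :
    D.weylForm x (D.normal x) Y Z (D.normal x)
      + ∑ k, ∑ l, (D.h x)⁻¹ k l * D.weylForm x (fun a => D.tangent k a x) Y Z
          (fun a => D.tangent l a x) = 0 := by
  have h : ∀ b c, ∑ a, ∑ d, D.ambientWeyl a b c d (D.emb x) * D.normal x a * D.normal x d
        + ∑ k, ∑ l, (D.h x)⁻¹ k l * ∑ a, ∑ d, D.ambientWeyl a b c d (D.emb x)
          * D.tangent k a x * D.tangent l d x = 0 := by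
    intro b c
    have h := hD.metricAt.contract_weyl (by norm_num) (by norm_num) b c
    rwa [hD.contract_frame] at h
  have hform : ∀ V V' : Fin 4 → ℝ, D.weylForm x V Y Z V'
      = ∑ b, ∑ c, (∑ a, ∑ d, D.ambientWeyl a b c d (D.emb x) * V a * V' d) * (Y b * Z c) := by
    intro V V'
    simp only [weylForm, mult4, Finset.sum_mul]
    rw [Finset.sum_comm]
    refine Finset.sum_congr rfl fun b _ => ?_
    rw [Finset.sum_comm]
    exact Finset.sum_congr rfl fun c _ => Finset.sum_congr rfl fun a _ =>
      Finset.sum_congr rfl fun d _ => by ring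
  simp only [hform]
  have h2 : ∑ k, ∑ l, (D.h x)⁻¹ k l * ∑ b, ∑ c, (∑ a, ∑ d, D.ambientWeyl a b c d (D.emb x)
        * D.tangent k a x * D.tangent l d x) * (Y b * Z c)
      = ∑ b, ∑ c, (∑ k, ∑ l, (D.h x)⁻¹ k l * ∑ a, ∑ d, D.ambientWeyl a b c d (D.emb x)
        * D.tangent k a x * D.tangent l d x) * (Y b * Z c) := by
    generalize hX : (fun b c k l => ∑ a, ∑ d, D.ambientWeyl a b c d (D.emb x)
        * D.tangent k a x * D.tangent l d x) = X
    have hX' : ∀ b c k l, ∑ a, ∑ d, D.ambientWeyl a b c d (D.emb x)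
        * D.tangent k a x * D.tangent l d x = X b c k l := by
      intro b c k l; rw [← hX]
    simp only [hX', Finset.mul_sum, Finset.sum_mul]
    rw [sum_comm_pairs]
    simp only [mul_assoc]
  rw [h2]
  simp only [← Finset.sum_add_distrib, ← add_mul]
  exact Finset.sum_eq_zero fun b _ => Finset.sum_eq_zero fun c _ => by rw [h b c, zero_mul]

/-- The tangential derivatives of the ambient Weyl tensor in terms of the hypersurface. -/
theorem nablaWeyl_tangent (l i j k : Fin 3) :
    mult4 (fun a b c d => ∑ e, nabla4 D.dom D.metric D.ambientWeyl e a b c d (D.emb x)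
        * D.tangent l e x) (D.normal x) (fun a => D.tangent i a x) (fun a => D.tangent j a x)
        (fun a => D.tangent k a x)
      = nabla3 Set.univ D.h D.weylFirst l i j k x
        - ∑ m, D.shape x m l * D.weylTan m i j k x - D.L x l j * D.weylNN x i k
        + D.L x l k * D.weylNN x i j := by
  have h := hD.partialD_mult4 (W := D.ambientWeyl) hD.metricAt.smooth_weyl hD.normal_smooth
    (hD.smooth_tangent i) (hD.smooth_tangent j) (hD.smooth_tangent k) l
  rw [hD.weingarten, hD.gauss, hD.gauss, hD.gauss, mult4_combination₁ _ _ _ _ _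
      (fun m a => D.tangent m a x), mult4_combination₂ _ _ _ _ _ (fun m a => D.tangent m a x),
    mult4_combination₃ _ _ _ _ _ (fun m a => D.tangent m a x),
    mult4_combination₄ _ _ _ _ _ (fun m a => D.tangent m a x)] at h
  -- Normal parts of the differentiated arguments: slot 2 gives two normals in a skew pair, hence
  -- zero; slot 3 gives W_{0i0k} = -W_{0ik0}; slot 4 gives W_{0ij0}. The derivative of the normal
  -- itself is tangential.
  have e1 : mult4 (fun a b c d => D.ambientWeyl a b c d (D.emb x)) (fun a => D.normal x a)
      (fun a => D.normal x a) (fun a => D.tangent j a x) (fun a => D.tangent k a x) = 0 :=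
    hD.weylForm_self _ _ _
  have e2 : mult4 (fun a b c d => D.ambientWeyl a b c d (D.emb x)) (fun a => D.normal x a)
      (fun a => D.tangent i a x) (fun a => D.normal x a) (fun a => D.tangent k a x)
        = - D.weylNN x i k :=
    hD.weylForm_antisymm_right _ _ _ _
  unfold nabla3
  simp only [Finset.sum_add_distrib]
  rw [e1, e2] at h
  -- All terms are recognized as components; the three Christoffel sums complete the intrinsic
  -- covariant derivative.
  change partialD Set.univ l (D.weylFirst i j k) x
    = mult4 (fun a b c d => ∑ e, nabla4 D.dom D.metric D.ambientWeyl e a b c d (D.emb x)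
        * D.tangent l e x) (D.normal x) (fun a => D.tangent i a x) (fun a => D.tangent j a x)
        (fun a => D.tangent k a x)
      + (∑ m, D.shape x m l * D.weylTan m i j k x + 0 * D.weylFirst i j k x)
      + (∑ m, christoffel Set.univ D.h m l i x * D.weylFirst m j k x + -D.L x l i * 0)
      + (∑ m, christoffel Set.univ D.h m l j x * D.weylFirst i m k x
        + -D.L x l j * -D.weylNN x i k)
      + (∑ m, christoffel Set.univ D.h m l k x * D.weylFirst i j m x
        + -D.L x l k * D.weylNN x i j) at h
  rw [h]
  ring

/-- The divergence is split by `contract_frame`: the normal direction gives (∇_0 W)_{0ij0}, the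
tangential ones are given by `nablaWeyl_tangent`, and the term with L_{lk} is traced to 3H. -/
theorem cottonFirst_eq (i j : Fin 3) :
    D.cottonFirst i j x = D.nablaWeylNN x i j + D.divWeylFirst i j x
      - (∑ k, ∑ l, (D.h x)⁻¹ k l * ∑ m, D.shape x m l * D.weylTan m i j k x)
      - (∑ k, ∑ l, (D.h x)⁻¹ k l * (D.L x l j * D.weylNN x i k))
      + 3 * D.H x * D.weylNN x i j := by
  have h1 : D.cottonFirst i j x = D.nablaWeylNN x i j + ∑ k, ∑ l, (D.h x)⁻¹ k l
      * mult4 (fun a b c d => ∑ e, nabla4 D.dom D.metric D.ambientWeyl e a b c d (D.emb x)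
        * D.tangent l e x) (D.normal x) (fun a => D.tangent i a x) (fun a => D.tangent j a x)
        (fun a => D.tangent k a x) := by
    have hc : ∀ a b c, cotton D.dom D.metric a b c (D.emb x)
        = contract (D.metric (D.emb x))⁻¹
          (fun d e => nabla4 D.dom D.metric D.ambientWeyl e a b c d (D.emb x)) := by
      intro a b c
      -- In dimension 4 the normalizing factor n - 3 of the Cotton tensor is one.
      have h4 : ((4 : ℕ) : ℝ) - 3 = 1 := by norm_num
      unfold cotton
      rw [h4, div_one]
      rfl
    unfold cottonFirst nablaWeylNN mult4
    simp only [hc, hD.contract_frame, Matrix.of_apply, add_mul, Finset.sum_add_distrib]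
    congr 1
    · simp only [Finset.sum_mul]
      conv_rhs => rw [Finset.sum_comm]
      refine Finset.sum_congr rfl fun a _ => ?_
      refine Eq.trans ?_ (sum_rotate _)
      exact Finset.sum_congr rfl fun b _ => Finset.sum_congr rfl fun c _ =>
        Finset.sum_congr rfl fun d _ => Finset.sum_congr rfl fun e _ => by ring
    · simp only [Finset.sum_mul, Finset.mul_sum]
      rw [Finset.sum_congr rfl fun a _ => sum_comm_pairs _, Finset.sum_comm]
      refine Finset.sum_congr rfl fun k _ => ?_
      rw [Finset.sum_comm]
      exact Finset.sum_congr rfl fun l _ => Finset.sum_congr rfl fun a _ =>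
        Finset.sum_congr rfl fun b _ => Finset.sum_congr rfl fun c _ =>
        Finset.sum_congr rfl fun d _ => Finset.sum_congr rfl fun e _ => by ring
  have h2 : ∑ k, ∑ l, (D.h x)⁻¹ k l * (D.L x l k * D.weylNN x i j)
      = 3 * D.H x * D.weylNN x i j := by
    unfold H
    rw [mul_div_cancel₀ _ (by norm_num : (3 : ℝ) ≠ 0)]
    simp only [Finset.sum_mul, hD.L_symm _ _, mul_assoc]
  rw [h1, ← h2]
  simp only [hD.nablaWeyl_tangent, divWeylFirst, mul_add, mul_sub, Finset.sum_add_distrib,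
    Finset.sum_sub_distrib]
  ring

end IsRegularAt

end CoordHypersurface

/-! ### The formula for the scalar product of Lo and B -/

namespace CoordHypersurface

theorem pairing_eq (D : CoordHypersurface) (x : Coord 3)
    (hs : ∀ i j, (D.h x)⁻¹ i j = (D.h x)⁻¹ j i) (A B : Matrix (Fin 3) (Fin 3) ℝ) :
    D.pairing x A B = ∑ i, ∑ j, ((D.h x)⁻¹ * A * (D.h x)⁻¹) i j * B i j := by
  unfold pairing
  rw [sum_comm_pairs]
  refine Finset.sum_congr rfl fun k _ => Finset.sum_congr rfl fun l _ => ?_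
  simp only [Matrix.mul_apply, Finset.sum_mul]
  rw [Finset.sum_comm]
  refine Finset.sum_congr rfl fun i _ => Finset.sum_congr rfl fun j _ => ?_
  rw [hs k j]
  ring

namespace IsRegularAt

variable {D : CoordHypersurface} {x : Coord 3} (hD : D.IsRegularAt x)

include hD

theorem h_inv_symm (i j : Fin 3) : (D.h x)⁻¹ i j = (D.h x)⁻¹ j i :=
  hD.isMetricAt_h.inv_symm_self i j

theorem Lo_symm (i j : Fin 3) : D.Lo x i j = D.Lo x j i := by
  simp only [Lo, Matrix.sub_apply, Matrix.smul_apply]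
  rw [hD.L_symm i j, hD.isMetricAt_h.symm_self i j]

theorem LoUp_symm (i j : Fin 3) : D.LoUp x i j = D.LoUp x j i := by
  have h1 : (D.h x)⁻¹.transpose = (D.h x)⁻¹ := by
    ext i j; exact hD.h_inv_symm j i
  have h2 : (D.Lo x).transpose = D.Lo x := by
    ext i j; exact hD.Lo_symm j i
  have h3 : (D.LoUp x).transpose = D.LoUp x := by
    unfold LoUp
    rw [Matrix.transpose_mul, Matrix.transpose_mul, h1, h2, Matrix.mul_assoc]
  exact congrFun (congrFun h3 j) i

theorem pairing_Lo (B : Matrix (Fin 3) (Fin 3) ℝ) :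
    D.pairing x (D.Lo x) B = ∑ i, ∑ j, D.LoUp x i j * B i j :=
  D.pairing_eq x hD.h_inv_symm _ _

/-- Raising both indices of Lo² gives Lo^{ij} times one further factor Lo with one index raised;
this singles out the common factor `LoUp` of all terms. -/
theorem pairing_LoSq (B : Matrix (Fin 3) (Fin 3) ℝ) :
    D.pairing x (D.LoSq x) B
      = ∑ i, ∑ j, D.LoUp x i j * ∑ k, ∑ l, (D.h x)⁻¹ k l * (D.Lo x l j * B i k) := by
  have h : (D.h x)⁻¹ * D.LoSq x * (D.h x)⁻¹ = D.LoUp x * D.Lo x * (D.h x)⁻¹ := by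
    simp only [LoSq, LoUp, Matrix.mul_assoc]
  rw [D.pairing_eq x hD.h_inv_symm, h]
  refine Finset.sum_congr rfl fun i _ => ?_
  simp only [Matrix.mul_apply, Finset.sum_mul, Finset.mul_sum]
  conv_rhs => rw [Finset.sum_comm]
  refine Finset.sum_congr rfl fun k _ => ?_
  conv_rhs => rw [Finset.sum_comm]
  refine Finset.sum_congr rfl fun l _ => Finset.sum_congr rfl fun j _ => ?_
  rw [hD.h_inv_symm k l, hD.Lo_symm l j]
  ring

omit hD in
theorem L_eq_Lo (i j : Fin 3) : D.L x i j = D.Lo x i j + D.H x * D.h x i j := by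
  simp [Lo]

theorem shape_eq (m l : Fin 3) :
    D.shape x m l = ∑ n, (D.h x)⁻¹ m n * D.Lo x n l + D.H x * (if m = l then 1 else 0) := by
  rw [← sum_inv_mul hD.det m l, Finset.mul_sum, ← Finset.sum_add_distrib]
  unfold shape
  refine Finset.sum_congr rfl fun n _ => ?_
  rw [hD.L_symm l n, L_eq_Lo]
  ring

/-- The pure trace part H of the shape operator contracts W_{kijl} to H times its tangential trace,
which is -W_{0ij0} by `weylForm_trace`. -/
theorem sum_shape_weylTan (i j : Fin 3) :
    ∑ k, ∑ l, (D.h x)⁻¹ k l * ∑ m, D.shape x m l * D.weylTan m i j k x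
      = ∑ k, ∑ l, D.LoUp x k l * D.weylTan k i j l x - D.H x * D.weylNN x i j := by
  have h1 := hD.weylForm_trace (fun a => D.tangent i a x) (fun a => D.tangent j a x)
  rw [← weylNN_eq] at h1
  simp only [← weylTan_eq] at h1
  have h2 : ∀ k, ∑ l, (D.h x)⁻¹ k l * ∑ m, D.shape x m l * D.weylTan m i j k x
      = ∑ m, D.LoUp x m k * D.weylTan m i j k x
        + D.H x * ∑ m, (D.h x)⁻¹ m k * D.weylTan m i j k x := by
    intro k
    have h3 : ∀ m, D.LoUp x m k + D.H x * (D.h x)⁻¹ m k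
        = ∑ l, (D.h x)⁻¹ k l * D.shape x m l := by
      intro m
      simp only [hD.shape_eq, mul_add, Finset.sum_add_distrib, LoUp, Matrix.mul_apply]
      congr 1
      · exact Finset.sum_congr rfl fun l _ => by rw [hD.h_inv_symm k l]; ring
      · simp [hD.h_inv_symm k m, mul_comm]
    simp only [Finset.mul_sum]
    rw [Finset.sum_comm, ← Finset.sum_add_distrib]
    refine Finset.sum_congr rfl fun m _ => ?_
    have := h3 m
    calc ∑ l, (D.h x)⁻¹ k l * (D.shape x m l * D.weylTan m i j k x)
        = (∑ l, (D.h x)⁻¹ k l * D.shape x m l) * D.weylTan m i j k x := by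
          rw [Finset.sum_mul]
          exact Finset.sum_congr rfl fun l _ => by ring
      _ = _ := by rw [← this]; ring
  simp only [h2, Finset.sum_add_distrib, ← Finset.mul_sum]
  rw [Finset.sum_comm]
  have h4 : ∑ k, ∑ m, (D.h x)⁻¹ m k * D.weylTan m i j k x = - D.weylNN x i j := by
    rw [Finset.sum_comm]
    linarith
  rw [h4]
  ring

theorem sum_L_weylNN (i j : Fin 3) :
    ∑ k, ∑ l, (D.h x)⁻¹ k l * (D.L x l j * D.weylNN x i k)
      = ∑ k, ∑ l, (D.h x)⁻¹ k l * (D.Lo x l j * D.weylNN x i k)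
        + D.H x * D.weylNN x i j := by
  have h : ∀ k, ∑ l, (D.h x)⁻¹ k l * (D.L x l j * D.weylNN x i k)
      = ∑ l, (D.h x)⁻¹ k l * (D.Lo x l j * D.weylNN x i k)
        + D.H x * ((if k = j then 1 else 0) * D.weylNN x i k) := by
    intro k
    rw [← sum_inv_mul hD.det k j, Finset.sum_mul, Finset.mul_sum, ← Finset.sum_add_distrib]
    refine Finset.sum_congr rfl fun l _ => ?_
    rw [L_eq_Lo]
    ring
  simp [h, Finset.sum_add_distrib]

/-- The Cotton tensor in terms of the trace-free second fundamental form. -/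
theorem cottonFirst_eq_Lo (i j : Fin 3) :
    D.cottonFirst i j x = D.nablaWeylNN x i j + D.divWeylFirst i j x
      - ∑ k, ∑ l, D.LoUp x k l * D.weylTan k i j l x
      - ∑ k, ∑ l, (D.h x)⁻¹ k l * (D.Lo x l j * D.weylNN x i k)
      + 3 * D.H x * D.weylNN x i j := by
  -- The trace parts of the two L-terms contribute +H and -H times W_{0ij0}, so the coefficient 3H
  -- is unchanged.
  rw [hD.cottonFirst_eq, hD.sum_shape_weylTan, hD.sum_L_weylNN]
  ring

/-- W_{0ijk} = W_{jk0i} = -W_{jki0}, by pair symmetry and skewness. -/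
theorem weylFirst_eq_neg_weylLast (i j k : Fin 3) :
    D.weylFirst i j k x = - D.weylLast j k i x := by
  rw [weylFirst_eq, weylLast_eq, ← hD.weylForm_pair_symm, hD.weylForm_antisymm_right]

/-- Needed on a neighbourhood because the identity is differentiated in `divWeylFirst_eq`. -/
theorem eventually_weylFirst (i j k : Fin 3) :
    ∀ᶠ y in 𝓝 x, D.weylFirst i j k y = - D.weylLast j k i y := by
  filter_upwards [hD.eventually_metricAt] with y hy
  rw [weylFirst_eq, weylLast_eq, weylForm, weylForm]
  have h1 := mult4_weyl_pair_symm (D.normal y) (fun a => D.tangent i a y)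
    (fun a => D.tangent j a y) (fun a => D.tangent k a y) hy
  have h2 := mult4_weyl_antisymm_right (fun a => D.tangent j a y) (fun a => D.tangent k a y)
    (D.normal y) (fun a => D.tangent i a y) hy
  exact h1.symm.trans (by rw [eq_comm, neg_eq_iff_eq_neg]; exact h2)

theorem divWeylFirst_eq (i j : Fin 3) : D.divWeylFirst i j x = - D.divWeylLast x i j := by
  unfold divWeylFirst divWeylLast
  simp only [Matrix.of_apply, ← Finset.sum_neg_distrib]
  refine Finset.sum_congr rfl fun k _ => Finset.sum_congr rfl fun l _ => ?_
  unfold nabla3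
  rw [partialD_congr (g := fun y => - D.weylLast j k i y)
    (by rw [nhdsWithin_univ]; exact hD.eventually_weylFirst i j k)
    (Set.mem_univ x), partialD_neg isCoordDomain_univ (Set.mem_univ x)]
  simp only [hD.weylFirst_eq_neg_weylLast, Finset.sum_add_distrib, mul_neg,
    Finset.sum_neg_distrib]
  ring

/-- The formula for the scalar product of `Lo` with the hypersurface Bach tensor. -/
theorem pairing_Lo_bach :
    D.pairing x (D.Lo x) (D.bach x)
      = (∑ i, ∑ j, D.LoUp x i j * D.nablaWeylNN x i j)
        + 2 * D.H x * D.pairing x (D.Lo x) (D.weylNN x)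
        - 2 * (∑ i, ∑ j, D.LoUp x i j * D.divWeylLast x i j)
        - D.pairing x (D.LoSq x) (D.weylNN x)
        - ∑ i, ∑ j, ∑ k, ∑ l, D.LoUp x i j * D.LoUp x k l * D.weylTan k i j l x := by
  -- Contraction with the symmetric Lo^{ij} makes the symmetrizations in B disappear.
  have hsymm : ∀ X : Fin 3 → Fin 3 → ℝ,
      ∑ i, ∑ j, D.LoUp x i j * X j i = ∑ i, ∑ j, D.LoUp x i j * X i j :=
    fun X => contract_swap X hD.LoUp_symm
  have h1 : D.pairing x (D.Lo x) (D.bach x)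
      = ∑ i, ∑ j, D.LoUp x i j
        * (D.cottonFirst i j x - D.H x * D.weylNN x i j + D.divWeylFirst i j x) := by
    have e1 := hsymm fun i j => D.cottonFirst i j x
    have e2 := hsymm fun i j => D.divWeylFirst i j x
    rw [hD.pairing_Lo]
    simp only [bach, Matrix.of_apply, mul_add, mul_sub, mul_div_assoc', Finset.sum_add_distrib,
      Finset.sum_sub_distrib, ← Finset.sum_div]
    rw [e1, e2]
    ring
  rw [h1, hD.pairing_Lo, hD.pairing_LoSq]
  have h2 : ∑ i, ∑ j, ∑ k, ∑ l, D.LoUp x i j * D.LoUp x k l * D.weylTan k i j l x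
      = ∑ i, ∑ j, D.LoUp x i j * ∑ k, ∑ l, D.LoUp x k l * D.weylTan k i j l x := by
    simp only [Finset.mul_sum, mul_assoc]
  rw [h2]
  -- The coefficient of W_{0ij0} is 3H - H = 2H; the intrinsic divergence occurs twice, once in the
  -- Cotton tensor and once in B.
  have h3 : ∀ i j, D.LoUp x i j
        * (D.cottonFirst i j x - D.H x * D.weylNN x i j + D.divWeylFirst i j x)
      = D.LoUp x i j * D.nablaWeylNN x i j + 2 * D.H x * (D.LoUp x i j * D.weylNN x i j)
        - 2 * (D.LoUp x i j * D.divWeylLast x i j)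
        - D.LoUp x i j * ∑ k, ∑ l, (D.h x)⁻¹ k l * (D.Lo x l j * D.weylNN x i k)
        - D.LoUp x i j * ∑ k, ∑ l, D.LoUp x k l * D.weylTan k i j l x := by
    intro i j
    rw [hD.cottonFirst_eq_Lo, hD.divWeylFirst_eq]
    ring
  simp only [h3, Finset.sum_add_distrib, Finset.sum_sub_distrib, Finset.mul_sum]

end IsRegularAt

end CoordHypersurface

/-! ### Conformal change of the data of a hypersurface -/

section Gradient

variable {n : ℕ} {S : Set (Coord n)} {G : Coord n → Matrix (Fin n) (Fin n) ℝ} {u : Coord n}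

/-- The scalar product of a vector with the gradient of a function. -/
theorem ip_grad (hd : (G u).det ≠ 0) (f : Coord n → ℝ) (Y : Fin n → ℝ) :
    ip (G u) Y (fun a => grad S G f a u) = ∑ a, partialD S a f u * Y a := by
  unfold ip grad
  refine Finset.sum_congr rfl fun a _ => ?_
  calc ∑ b, G u a b * Y a * ∑ c, (G u)⁻¹ b c * partialD S c f u
      = Y a * ∑ c, (∑ b, G u a b * (G u)⁻¹ b c) * partialD S c f u := by
        simp only [Finset.mul_sum, Finset.sum_mul]
        rw [Finset.sum_comm]
        exact Finset.sum_congr rfl fun c _ => Finset.sum_congr rfl fun b _ => by ring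
    _ = _ := by simp [sum_mul_inv hd, mul_comm]

end Gradient

namespace CoordHypersurface

/-- The hypersurface for the metric `exp(2 f) g`, with the normal field `N'`. -/
noncomputable def conformalChange (D : CoordHypersurface) (f : Coord 4 → ℝ)
    (N' : Coord 3 → Coord 4) : CoordHypersurface where
  dom := D.dom
  metric := conformal f D.metric
  emb := D.emb
  normal := N'

variable {D : CoordHypersurface} {x : Coord 3} {f : Coord 4 → ℝ} {N' : Coord 3 → Coord 4}

theorem h_conformalChange :
    (D.conformalChange f N').h = conformal (fun y => f (D.emb y)) D.h := by
  funext y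
  ext i j
  simp only [h, conformalChange, conformal, Matrix.of_apply, Matrix.smul_apply, smul_eq_mul,
    Finset.mul_sum, mul_assoc]
  rfl

namespace IsRegularAt

variable (hD : D.IsRegularAt x) (hf : ∀ᶠ v in 𝓝[D.dom] (D.emb x), ContDiffWithinAt ℝ ∞ f D.dom v)
  (hN : ∀ᶠ y in 𝓝 x, N' y = Real.exp (-f (D.emb y)) • D.normal y)

include hD hf

theorem smooth_factor : ContDiffWithinAt ℝ ∞ f D.dom (D.emb x) :=
  hf.self_of_nhdsWithin hD.mem

include hN

/-- Weight 2 of the Weyl tensor, minus 1 for the normal. The statement is local because the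
divergence differentiates it. -/
theorem weylFirst_conformalChange (i j k : Fin 3) :
    ∀ᶠ y in 𝓝 x, (D.conformalChange f N').weylFirst i j k y
      = Real.exp (1 * f (D.emb y)) * D.weylFirst i j k y := by
  filter_upwards [hD.eventually_metricAt, hD.tendsto_emb.eventually hf, hN] with y h1 h2 h3
  have hw := weyl_conformal h1 h2 (by norm_num) (by norm_num)
  have he : Real.exp (1 * f (D.emb y)) = Real.exp (2 * f (D.emb y)) * Real.exp (-f (D.emb y)) := by
    rw [← Real.exp_add]; ring_nf
  change ∑ a, ∑ b, ∑ c, ∑ d, weyl D.dom (conformal f D.metric) a b c d (D.emb y) * N' y a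
    * D.tangent i b y * D.tangent j c y * D.tangent k d y = _
  simp only [hw, h3, he, weylFirst, ambientWeyl, Finset.mul_sum, PiLp.smul_apply, smul_eq_mul]
  refine Finset.sum_congr rfl fun a _ => Finset.sum_congr rfl fun b _ =>
    Finset.sum_congr rfl fun c _ => Finset.sum_congr rfl fun d _ => ?_
  ring

/-- Weight 2 of the Weyl tensor, minus 1 for each of two normals. -/
theorem weylNN_conformalChange (i j : Fin 3) :
    (D.conformalChange f N').weylNN x i j = D.weylNN x i j := by
  have h3 := hN.self_of_nhds
  have hw := weyl_conformal hD.metricAt (hD.smooth_factor hf) (by norm_num) (by norm_num)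
  have he : Real.exp (2 * f (D.emb x)) * Real.exp (-f (D.emb x)) * Real.exp (-f (D.emb x)) = 1 := by
    rw [← Real.exp_add, ← Real.exp_add]; ring_nf; simp
  change ∑ a, ∑ b, ∑ c, ∑ d, weyl D.dom (conformal f D.metric) a b c d (D.emb x) * N' x a
    * D.tangent i b x * D.tangent j c x * N' x d = ∑ a, ∑ b, ∑ c, ∑ d,
      weyl D.dom D.metric a b c d (D.emb x) * D.normal x a
    * D.tangent i b x * D.tangent j c x * D.normal x d
  simp only [hw, h3, PiLp.smul_apply, smul_eq_mul]
  refine Finset.sum_congr rfl fun a _ => Finset.sum_congr rfl fun b _ =>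
    Finset.sum_congr rfl fun c _ => Finset.sum_congr rfl fun d _ => ?_
  linear_combination (weyl D.dom D.metric a b c d (D.emb x) * D.normal x a
    * D.tangent i b x * D.tangent j c x * D.normal x d) * he

-- The ambient gradient is expanded in the frame; by the chain rule its tangential part is the
-- gradient, for h, of the restriction of `f`.
omit hf hN in
theorem weylForm_grad (f : Coord 4 → ℝ) (hf : ContDiffWithinAt ℝ ∞ f D.dom (D.emb x))
    (i j : Fin 3) :
    D.weylForm x (D.normal x) (fun a => D.tangent i a x) (fun a => D.tangent j a x)
        (fun a => grad D.dom D.metric f a (D.emb x))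
      = ∑ m, grad Set.univ D.h (fun y => f (D.emb y)) m x * D.weylFirst i j m x
        + (∑ a, partialD D.dom a f (D.emb x) * D.normal x a) * D.weylNN x i j := by
  have h1 : (fun a => grad D.dom D.metric f a (D.emb x))
      = fun a => ∑ m, grad Set.univ D.h (fun y => f (D.emb y)) m x * D.tangent m a x
        + (∑ a, partialD D.dom a f (D.emb x) * D.normal x a) * D.normal x a := by
    funext a
    rw [hD.expand (fun a => grad D.dom D.metric f a (D.emb x)) a]
    simp only [ip_grad hD.metricAt.det, ← hD.partialD_comp hf]
    rfl
  rw [h1]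
  exact mult4_combination₄ _ _ _ _ _ (fun m a => D.tangent m a x) _ _

theorem cottonFirst_conformalChange (i j : Fin 3) :
    (D.conformalChange f N').cottonFirst i j x
      = Real.exp (-f (D.emb x)) * (D.cottonFirst i j x
        + ∑ m, grad Set.univ D.h (fun y => f (D.emb y)) m x * D.weylFirst i j m x
        + (∑ a, partialD D.dom a f (D.emb x) * D.normal x a) * D.weylNN x i j) := by
  have h3 := hN.self_of_nhds
  have hc := cotton_conformal (n := 4) (by norm_num) (by norm_num) (by norm_num) hD.metric hf
    hD.mem
  rw [add_assoc, ← hD.weylForm_grad f (hD.smooth_factor hf)]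
  change ∑ a, ∑ b, ∑ c, cotton D.dom (conformal f D.metric) a b c (D.emb x) * N' x a
    * D.tangent i b x * D.tangent j c x = _
  simp only [hc, h3, PiLp.smul_apply, smul_eq_mul, cottonFirst, weylForm, mult4, ambientWeyl,
    ← Finset.sum_add_distrib, Finset.mul_sum]
  refine Finset.sum_congr rfl fun a _ => Finset.sum_congr rfl fun b _ =>
    Finset.sum_congr rfl fun c _ => ?_
  have : ∑ d, weyl D.dom D.metric a b c d (D.emb x) * D.normal x a * D.tangent i b x
      * D.tangent j c x * grad D.dom D.metric f d (D.emb x)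
      = (∑ d, grad D.dom D.metric f d (D.emb x) * weyl D.dom D.metric a b c d (D.emb x))
        * (D.normal x a * D.tangent i b x * D.tangent j c x) := by
    rw [Finset.sum_mul]
    exact Finset.sum_congr rfl fun d _ => by ring
  rw [this]
  ring

/-- The change of the connection adds tangential vectors, which are orthogonal to N, and -h_{ij}
grad f, whose product with N gives the normal derivative of `f`. The factor exp(f) is exp(2f) from
the metric times exp(-f) from the normal. -/
theorem L_conformalChange (i j : Fin 3) :
    (D.conformalChange f N').L x i j = Real.exp (f (D.emb x)) * (D.L x i j
      + (∑ a, partialD D.dom a f (D.emb x) * D.normal x a) * D.h x i j) := by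
  have h3 := hN.self_of_nhds
  have he : Real.exp (2 * f (D.emb x)) * Real.exp (-f (D.emb x)) = Real.exp (f (D.emb x)) := by
    rw [← Real.exp_add]; ring_nf
  have hZ : ∀ a, (D.conformalChange f N').ambientDeriv i j a x = D.ambientDeriv i j a x
      + (∑ b, partialD D.dom b f (D.emb x) * D.tangent i b x) * D.tangent j a x
      + (∑ b, partialD D.dom b f (D.emb x) * D.tangent j b x) * D.tangent i a x
      - D.h x i j * grad D.dom D.metric f a (D.emb x) := by
    intro a
    have hc := christoffel_conformal hD.metricAt (hD.smooth_factor hf)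
    change partialD Set.univ i (D.tangent j a) x + ∑ b, ∑ c,
      christoffel D.dom (conformal f D.metric) a b c (D.emb x) * D.tangent i b x
        * D.tangent j c x = _
    simp only [hc, add_mul, sub_mul, Finset.sum_add_distrib, Finset.sum_sub_distrib, ambientDeriv]
    have e1 : ∑ b, ∑ c, (if a = c then (1 : ℝ) else 0) * partialD D.dom b f (D.emb x)
          * D.tangent i b x * D.tangent j c x
        = (∑ b, partialD D.dom b f (D.emb x) * D.tangent i b x) * D.tangent j a x := by
      simp [Finset.sum_mul]
    have e2 : ∑ b, ∑ c, (if a = b then (1 : ℝ) else 0) * partialD D.dom c f (D.emb x)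
          * D.tangent i b x * D.tangent j c x
        = (∑ b, partialD D.dom b f (D.emb x) * D.tangent j b x) * D.tangent i a x := by
      rw [Finset.sum_comm]
      simp [Finset.sum_mul]
      exact Finset.sum_congr rfl fun b _ => by ring
    have e3 : ∑ b, ∑ c, D.metric (D.emb x) b c * grad D.dom D.metric f a (D.emb x)
          * D.tangent i b x * D.tangent j c x
        = D.h x i j * grad D.dom D.metric f a (D.emb x) := by
      simp only [h, Matrix.of_apply, Finset.sum_mul]
      exact Finset.sum_congr rfl fun b _ => Finset.sum_congr rfl fun c _ => by ring
    rw [e1, e2, e3]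
    ring
  have horth := hD.orth_self
  have hgrad := ip_grad (S := D.dom) hD.metricAt.det f (D.normal x)
  rw [hD.ip_comm] at hgrad
  have hLd : (D.conformalChange f N').L x i j = - ∑ a, ∑ b, conformal f D.metric (D.emb x) a b
      * (D.conformalChange f N').ambientDeriv i j a x * N' x b := rfl
  have e4 : ∀ k, ∑ a, ∑ b, D.metric (D.emb x) a b * D.tangent k a x * D.normal x b = 0 := by
    intro k
    have := hD.orth_self k
    rw [hD.ip_comm] at this
    exact this
  have e5 : ∑ a, ∑ b, D.metric (D.emb x) a b * grad D.dom D.metric f a (D.emb x) * D.normal x b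
      = ∑ a, partialD D.dom a f (D.emb x) * D.normal x a := hgrad
  have hterm : ∀ a b, conformal f D.metric (D.emb x) a b
      * (D.conformalChange f N').ambientDeriv i j a x * N' x b
      = Real.exp (f (D.emb x)) * (D.metric (D.emb x) a b * D.ambientDeriv i j a x * D.normal x b
        + (∑ b, partialD D.dom b f (D.emb x) * D.tangent i b x)
            * (D.metric (D.emb x) a b * D.tangent j a x * D.normal x b)
        + (∑ b, partialD D.dom b f (D.emb x) * D.tangent j b x)
            * (D.metric (D.emb x) a b * D.tangent i a x * D.normal x b)
        - D.h x i j * (D.metric (D.emb x) a b * grad D.dom D.metric f a (D.emb x)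
            * D.normal x b)) := by
    intro a b
    rw [hZ, h3, ← he]
    simp only [conformal, Matrix.smul_apply, PiLp.smul_apply, smul_eq_mul]
    ring
  rw [hLd]
  simp only [hterm, ← Finset.mul_sum, Finset.sum_add_distrib, Finset.sum_sub_distrib, e4, e5, L,
    Matrix.of_apply]
  ring

theorem H_conformalChange :
    (D.conformalChange f N').H x = Real.exp (-f (D.emb x)) * (D.H x
      + ∑ a, partialD D.dom a f (D.emb x) * D.normal x a) := by
  have hm := hD.isMetricAt_h
  have he : Real.exp (-(2 * f (D.emb x))) * Real.exp (f (D.emb x)) = Real.exp (-f (D.emb x)) := by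
    rw [← Real.exp_add]; ring_nf
  have h1 := contract_metric hm.symm_self hm.det
  have h2 : (D.conformalChange f N').H x
      = contract ((D.conformalChange f N').h x)⁻¹ (fun i j => (D.conformalChange f N').L x i j)
        / 3 := rfl
  have h3 : D.H x = contract (D.h x)⁻¹ (fun i j => D.L x i j) / 3 := rfl
  rw [h2, h3, h_conformalChange, conformal_inv hm.det, contract_smul]
  simp only [hD.L_conformalChange hf hN]
  rw [contract_const_mul, contract_add _ (fun i j => D.L x i j),
    contract_const_mul _ (fun i j => D.h x i j), h1, ← he]
  push_cast
  ring

theorem divWeylFirst_conformalChange (i j : Fin 3) :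
    (D.conformalChange f N').divWeylFirst i j x = Real.exp (-f (D.emb x)) * (D.divWeylFirst i j x
      - ∑ m, grad Set.univ D.h (fun y => f (D.emb y)) m x * D.weylFirst i j m x
      + ∑ m, grad Set.univ D.h (fun y => f (D.emb y)) m x * D.weylFirst m j i x) := by
  have hm := hD.isMetricAt_h
  have hsm : ∀ i j k, ContDiffWithinAt ℝ ∞ (D.weylFirst i j k) Set.univ x := by
    intro i j k
    exact ContDiffWithinAt.sum fun a _ => ContDiffWithinAt.sum fun b _ =>
      ContDiffWithinAt.sum fun c _ => ContDiffWithinAt.sum fun d _ =>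
      ((((hD.smooth_comp (hD.metricAt.smooth_weyl a b c d)).mul (hD.normal_smooth a)).mul
        (hD.smooth_tangent i b)).mul (hD.smooth_tangent j c)).mul (hD.smooth_tangent k d)
  have hanti : ∀ i j k, D.weylFirst i k j x = - D.weylFirst i j k x := by
    intro i j k
    exact hD.weylForm_antisymm_right _ _ _ _
  -- `weylForm_trace` with the normal in the second slot: the purely normal term vanishes by
  -- skewness.
  have htr : ∀ j, contract (D.h x)⁻¹ (fun k l => D.weylFirst l j k x) = 0 := by
    intro j
    have h := hD.weylForm_trace (D.normal x) (fun a => D.tangent j a x)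
    rw [hD.weylForm_self, zero_add] at h
    have h' : contract (D.h x)⁻¹ (fun k l => D.weylFirst k j l x) = 0 := by
      rw [← neg_eq_zero, ← contract_neg]
      refine Eq.trans ?_ h
      unfold contract
      refine Finset.sum_congr rfl fun k _ => Finset.sum_congr rfl fun l _ => ?_
      beta_reduce
      rw [weylFirst_eq, hD.weylForm_antisymm, neg_neg]
    rw [← h', ← contract_swap _ hD.h_inv_symm]
  have h := div3_conformal (T := D.weylFirst) (T' := (D.conformalChange f N').weylFirst) hm
    (hD.smooth_comp (hD.smooth_factor hf)) hsm
    (fun i j k => by rw [nhdsWithin_univ]; exact hD.weylFirst_conformalChange hf hN i j k)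
    hanti htr i j
  have h1 : (D.conformalChange f N').divWeylFirst i j x
      = div3 Set.univ (D.conformalChange f N').h (D.conformalChange f N').weylFirst i j x := rfl
  have h2 : D.divWeylFirst i j x = div3 Set.univ D.h D.weylFirst i j x := rfl
  rw [h1, h2, h_conformalChange, h]
  push_cast
  ring

/-- The conformal covariance of the hypersurface Bach tensor. -/
theorem bach_conformalChange :
    Real.exp (f (D.emb x)) • (D.conformalChange f N').bach x = D.bach x := by
  have he : Real.exp (f (D.emb x)) * Real.exp (-f (D.emb x)) = 1 := by
    rw [← Real.exp_add]; simp
  ext i j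
  have hs : D.weylNN x j i = D.weylNN x i j := by
    rw [weylNN_eq, weylNN_eq, ← hD.weylForm_pair_symm, hD.weylForm_antisymm,
      hD.weylForm_antisymm_right, neg_neg]
  -- This term of the transformed divergence is skew in `i`, `j` and is removed by symmetrization.
  have ha : ∑ m, grad Set.univ D.h (fun y => f (D.emb y)) m x * D.weylFirst m j i x
      = - ∑ m, grad Set.univ D.h (fun y => f (D.emb y)) m x * D.weylFirst m i j x := by
    rw [← Finset.sum_neg_distrib]
    refine Finset.sum_congr rfl fun m _ => ?_
    rw [weylFirst_eq, hD.weylForm_antisymm_right, ← weylFirst_eq]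
    ring
  simp only [Matrix.smul_apply, smul_eq_mul, bach, Matrix.of_apply,
    hD.cottonFirst_conformalChange hf hN, hD.H_conformalChange hf hN,
    hD.weylNN_conformalChange hf hN, hD.divWeylFirst_conformalChange hf hN, hs, ha]
  -- The tangential gradient terms of the Cotton tensor and of the divergence cancel, as do the
  -- normal derivatives from the Cotton tensor and from H; only the factor exp(f) exp(-f) = 1 is
  -- left.
  linear_combination ((D.cottonFirst i j x + D.cottonFirst j i x) / 2 - D.H x * D.weylNN x i j
      + (D.divWeylFirst i j x + D.divWeylFirst j i x) / 2) * he

end IsRegularAt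

end CoordHypersurface

/-! ### Derivatives of charts -/

section Chart

variable {E H : Type*} [NormedAddCommGroup E] [NormedSpace ℝ E] [TopologicalSpace H]
  {I : ModelWithCorners ℝ E H} {X : Type*} [TopologicalSpace X]
  {e : OpenPartialHomeomorph X H}

/-- Lets derivatives within `Set.range I` be computed on the chart target, also at boundary points.
-/
theorem extend_target_mem {u : E} (hu : u ∈ (e.extend I).target) :
    (e.extend I).target ∈ 𝓝[Set.range I] u := by
  have h := (e.extend I).map_target hu
  rw [e.extend_source] at h
  have h2 := e.extend_target_mem_nhdsWithin (I := I) h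
  rwa [(e.extend I).right_inv hu] at h2

theorem symm_mem_source {u : E} (hu : u ∈ (e.extend I).target) :
    (e.extend I).symm u ∈ e.source := by
  rw [← e.extend_source (I := I)]
  exact (e.extend I).map_target hu

variable [ChartedSpace H X]

theorem mdifferentiableAt_extend (he : e ∈ IsManifold.maximalAtlas I ∞ X) {q : X}
    (hq : q ∈ e.source) : MDifferentiableAt I 𝓘(ℝ, E) (e.extend I) q :=
  (e.contMDiffAt_extend he hq).mdifferentiableAt (by simp)

variable (he : e ∈ IsManifold.maximalAtlas I ∞ X)

include he

theorem contMDiffWithinAt_symm {u : E} (hu : u ∈ (e.extend I).target) :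
    ContMDiffWithinAt 𝓘(ℝ, E) I ∞ (e.extend I).symm (Set.range I) u := by
  have h := contMDiffOn_extend_symm he
  rw [← e.extend_target'] at h
  exact (h u hu).mono_of_mem_nhdsWithin (extend_target_mem hu)

theorem mdifferentiableWithinAt_symm {u : E} (hu : u ∈ (e.extend I).target) :
    MDifferentiableWithinAt 𝓘(ℝ, E) I (e.extend I).symm (Set.range I) u :=
  (contMDiffWithinAt_symm he hu).mdifferentiableWithinAt (by simp)

/-- Chain rule for the chart after its inverse; derivatives within `Set.range I` are unique, also at
the boundary. -/
theorem mfderiv_extend_mfderivWithin_symm {u : E} (hu : u ∈ (e.extend I).target) (v : E) :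
    mfderiv I 𝓘(ℝ, E) (e.extend I) ((e.extend I).symm u)
      (mfderivWithin 𝓘(ℝ, E) I (e.extend I).symm (Set.range I) u v) = v := by
  have hs : UniqueMDiffWithinAt 𝓘(ℝ, E) (Set.range I) u :=
    uniqueMDiffOn_iff_uniqueDiffOn.mpr I.uniqueDiffOn u (e.extend_target_subset_range hu)
  have h1 := ((mdifferentiableAt_extend he (symm_mem_source hu)).hasMFDerivAt).comp_hasMFDerivWithinAt
    u (mdifferentiableWithinAt_symm he hu).hasMFDerivWithinAt
  have h2 : HasMFDerivWithinAt 𝓘(ℝ, E) 𝓘(ℝ, E) (e.extend I ∘ (e.extend I).symm)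
      (Set.range I) u (ContinuousLinearMap.id ℝ E) := by
    refine (hasMFDerivWithinAt_id (I := 𝓘(ℝ, E)) (Set.range I) u).congr_of_eventuallyEq ?_ ?_
    · filter_upwards [extend_target_mem hu] with v hv using (e.extend I).right_inv hv
    · exact (e.extend I).right_inv hu
  exact congrArg (fun A : E →L[ℝ] E => A v) (hs.eq h1 h2)

/-- In finite dimension a one-sided inverse of an endomorphism is two-sided. -/
theorem mfderivWithin_symm_mfderiv_extend [FiniteDimensional ℝ E] {u : E}
    (hu : u ∈ (e.extend I).target) (w : TangentSpace I ((e.extend I).symm u)) :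
    mfderivWithin 𝓘(ℝ, E) I (e.extend I).symm (Set.range I) u
      (mfderiv I 𝓘(ℝ, E) (e.extend I) ((e.extend I).symm u) w) = w := by
  let A : E →L[ℝ] E := mfderiv I 𝓘(ℝ, E) (e.extend I) ((e.extend I).symm u)
  let B : E →L[ℝ] E := mfderivWithin 𝓘(ℝ, E) I (e.extend I).symm (Set.range I) u
  have hAB (v : E) : A (B v) = v := mfderiv_extend_mfderivWithin_symm he hu v
  have hA : Function.Injective A.toLinearMap :=
    LinearMap.injective_iff_surjective.mpr fun v => ⟨B v, hAB v⟩
  exact hA (hAB (A w))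

theorem eq_zero_of_mfderiv_extend [FiniteDimensional ℝ E] {q : X} (hq : q ∈ e.source)
    {w : TangentSpace I q} (hw : mfderiv I 𝓘(ℝ, E) (e.extend I) q w = 0) : w = 0 := by
  rw [← e.extend_source (I := I)] at hq
  obtain ⟨u, hu, rfl⟩ : ∃ u ∈ (e.extend I).target, (e.extend I).symm u = q :=
    ⟨_, (e.extend I).map_source hq, (e.extend I).left_inv hq⟩
  rw [← mfderivWithin_symm_mfderiv_extend he hu w, hw]
  exact map_zero _

omit he in
/-- The differential of an immersion is injective. -/
theorem eq_zero_of_mfderiv_of_isImmersionAt {E' H' : Type*} [NormedAddCommGroup E']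
    [NormedSpace ℝ E'] [FiniteDimensional ℝ E] [TopologicalSpace H']
    {J : ModelWithCorners ℝ E' H'} {Y : Type*} [TopologicalSpace Y] [ChartedSpace H' Y]
    {f : X → Y} {q : X}
    (hf : Manifold.IsImmersionAt I J ∞ f q) {v : TangentSpace I q} (hv : mfderiv I J f q v = 0) :
    v = 0 := by
  refine eq_zero_of_mfderiv_extend hf.domChart_mem_maximalAtlas hf.mem_domChart_source ?_
  -- In the charts of its normal form the immersion is u ↦ (u, 0) up to a linear equivalence, and
  -- `r` projects back to u. So the domain chart factors through `f` near `q`, and its differential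
  -- kills whatever that of `f` kills.
  let r : E' →L[ℝ] E := (ContinuousLinearMap.fst ℝ E hf.complement).comp
    (hf.equiv.symm : E' →L[ℝ] E × hf.complement)
  have h1 := (hf.contMDiffAt.mdifferentiableAt (by simp)).hasMFDerivAt
  have h2 := (mdifferentiableAt_extend hf.codChart_mem_maximalAtlas
    hf.mem_codChart_source).hasMFDerivAt
  have h3 := (r.hasMFDerivAt (x := hf.codChart.extend J (f q))).comp q (h2.comp q h1)
  have h4 : hf.domChart.extend I =ᶠ[𝓝 q] r ∘ (hf.codChart.extend J) ∘ f := by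
    filter_upwards [hf.domChart.open_source.mem_nhds hf.mem_domChart_source] with z hz
    rw [← hf.domChart.extend_source (I := I)] at hz
    have h5 := hf.writtenInCharts ((hf.domChart.extend I).map_source hz)
    simp only [Function.comp_apply, (hf.domChart.extend I).left_inv hz] at h5
    change _ = (hf.equiv.symm (hf.codChart.extend J (f z))).1
    rw [h5, ContinuousLinearEquiv.symm_apply_apply]
  rw [(h3.congr_of_eventuallyEq h4).mfderiv]
  have h6 := congrArg (fun w => r (mfderiv J 𝓘(ℝ, E') (hf.codChart.extend J) (f q) w)) hv
  refine h6.trans ?_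
  rw [map_zero]
  exact map_zero r

end Chart

/-! ### The metric in a chart of the ambient manifold -/

theorem eq_sum_basisVec {n : ℕ} (v : Coord n) : v = ∑ a, v a • basisVec a := by
  ext b
  simp [basisVec, Pi.single_apply]

theorem ip_of_bilin {n : ℕ} {V : Type*} [AddCommGroup V] [Module ℝ V] [TopologicalSpace V]
    (β : V →L[ℝ] V →L[ℝ] ℝ) (B : Coord n →L[ℝ] V) (v w : Coord n) :
    ip (Matrix.of fun a b => β (B (basisVec a)) (B (basisVec b))) v w = β (B v) (B w) := by
  have hB (v : Coord n) : B v = ∑ a, v a • B (basisVec a) := by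
    conv_lhs => rw [eq_sum_basisVec v]
    simp only [map_sum, map_smul]
  rw [hB v, hB w]
  simp only [ip, Matrix.of_apply, map_sum, map_smul, sum_apply, smul_apply,
    smul_eq_mul, Finset.mul_sum]
  rw [Finset.sum_comm]
  exact Finset.sum_congr rfl fun a _ => Finset.sum_congr rfl fun b _ => by ring

/-- A kernel vector of `G` would be a nonzero vector of norm zero. -/
theorem det_ne_zero_of_ip_pos {n : ℕ} {G : Matrix (Fin n) (Fin n) ℝ}
    (hG : ∀ v : Coord n, v ≠ 0 → 0 < ip G v v) : G.det ≠ 0 := by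
  intro h
  obtain ⟨v, hv, hGv⟩ := Matrix.exists_mulVec_eq_zero_iff.mpr h
  have h1 : ip G v v = v ⬝ᵥ G.mulVec v := by
    simp only [ip, dotProduct, Matrix.mulVec, Finset.mul_sum]
    exact Finset.sum_congr rfl fun a _ => Finset.sum_congr rfl fun b _ => by ring
  have h2 := hG (WithLp.toLp 2 v) (by simpa using hv)
  simp [h1, hGv] at h2

theorem isCoordDomain_range {n : ℕ} {H : Type*} [TopologicalSpace H]
    (I : ModelWithCorners ℝ (Coord n) H) : IsCoordDomain (Set.range I) :=
  ⟨I.uniqueDiffOn, I.range_subset_closure_interior⟩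

section ChartMetric

variable {H₄ : Type*} [TopologicalSpace H₄] {I : ModelWithCorners ℝ (Coord 4) H₄}
  {X : Type*} [TopologicalSpace X] [ChartedSpace H₄ X] [IsManifold I ∞ X]
  {e : OpenPartialHomeomorph X H₄}

/-- The matrix of components of a metric in the chart `e`. -/
noncomputable def chartMetric (g : SmoothMetric I X) (e : OpenPartialHomeomorph X H₄)
    (u : Coord 4) : Matrix (Fin 4) (Fin 4) ℝ :=
  Matrix.of fun a b => g.inner ((e.extend I).symm u) (coordField e a u) (coordField e b u)

/-- The components of a tangent vector in the chart `e`. -/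
noncomputable def chartVector (I : ModelWithCorners ℝ (Coord 4) H₄)
    (e : OpenPartialHomeomorph X H₄) (q : X) : TangentSpace I q →L[ℝ] Coord 4 :=
  mfderiv I 𝓘(ℝ, Coord 4) (e.extend I) q

theorem ip_chartMetric (g : SmoothMetric I X) (u v w : Coord 4) :
    ip (chartMetric g e u) v w = g.inner ((e.extend I).symm u)
      (mfderivWithin 𝓘(ℝ, Coord 4) I (e.extend I).symm (Set.range I) u v)
      (mfderivWithin 𝓘(ℝ, Coord 4) I (e.extend I).symm (Set.range I) u w) :=
  ip_of_bilin (g.inner ((e.extend I).symm u))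
    (mfderivWithin 𝓘(ℝ, Coord 4) I (e.extend I).symm (Set.range I) u) v w

theorem chartMetric_symm (g : SmoothMetric I X) (u : Coord 4) (a b : Fin 4) :
    chartMetric g e u a b = chartMetric g e u b a :=
  g.symm _ _ _

variable (he : e ∈ IsManifold.maximalAtlas I ∞ X)

include he

theorem ip_chartMetric_self_pos (g : SmoothMetric I X)
    {u : Coord 4} (hu : u ∈ (e.extend I).target) {v : Coord 4} (hv : v ≠ 0) :
    0 < ip (chartMetric g e u) v v := by
  rw [ip_chartMetric]
  refine g.pos _ _ fun h0 => hv ?_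
  rw [← mfderiv_extend_mfderivWithin_symm he hu v, h0]
  exact map_zero _

/-- Transfers the unit and orthogonality conditions, and the positivity of h, from the manifold to
the chart. -/
theorem ip_chartMetric_chartVector (g : SmoothMetric I X)
    {q : X} (hq : q ∈ e.source) (w w' : TangentSpace I q) :
    ip (chartMetric g e (e.extend I q)) (chartVector I e q w) (chartVector I e q w')
      = g.inner q w w' := by
  rw [← e.extend_source (I := I)] at hq
  obtain ⟨u, hu, rfl⟩ : ∃ u ∈ (e.extend I).target, (e.extend I).symm u = q :=
    ⟨_, (e.extend I).map_source hq, (e.extend I).left_inv hq⟩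
  have h := ip_chartMetric g (e := e) u
    (chartVector I e ((e.extend I).symm u) w) (chartVector I e ((e.extend I).symm u) w')
  rw [show chartMetric g e (e.extend I ((e.extend I).symm u)) = chartMetric g e u by
    rw [(e.extend I).right_inv hu]]
  exact h.trans (congrArg₂ (fun v v' => g.inner _ v v')
    (mfderivWithin_symm_mfderiv_extend he hu w) (mfderivWithin_symm_mfderiv_extend he hu w'))

/-- The coordinate field is the tangent map of the inverse chart applied to a constant section. -/
theorem contMDiffWithinAt_coordField (a : Fin 4)
    {u : Coord 4} (hu : u ∈ (e.extend I).target) :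
    ContMDiffWithinAt 𝓘(ℝ, Coord 4) I.tangent ∞
      (fun v => (⟨(e.extend I).symm v, coordField e a v⟩ : TangentBundle I X))
      (Set.range I) u := by
  have hT : UniqueMDiffOn 𝓘(ℝ, Coord 4) (e.extend I).target :=
    uniqueMDiffOn_iff_uniqueDiffOn.mpr <| by
      rw [e.extend_target]
      exact I.uniqueDiffOn_preimage e.open_target
  have h := contMDiffOn_extend_symm he
  rw [← e.extend_target'] at h
  have h1 := h.contMDiffOn_tangentMapWithin (m := ∞) (by simp) hT
  have h2 : ContMDiffWithinAt 𝓘(ℝ, Coord 4) (𝓘(ℝ, Coord 4)).tangent ∞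
      (fun v => (⟨v, basisVec a⟩ : TangentBundle 𝓘(ℝ, Coord 4) (Coord 4)))
      (e.extend I).target u :=
    contMDiffWithinAt_vectorSpace_iff_contDiffWithinAt.mpr contDiffWithinAt_const
  have h3 := (h1 ⟨u, basisVec a⟩ hu).comp u h2 (fun v hv => hv)
  refine (h3.congr_of_mem ?_ hu).mono_of_mem_nhdsWithin (extend_target_mem hu)
  intro v hv
  simp only [tangentMapWithin, Function.comp, coordField]
  -- The derivatives within the target and within the range agree, the target being a set of unique
  -- differentiability.
  rw [mfderivWithin_subset (e.extend_target_subset_range) (hT v hv)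
    (mdifferentiableWithinAt_symm he hv)]

theorem contDiffWithinAt_chartMetric (g : SmoothMetric I X) (a b : Fin 4) {u : Coord 4}
    (hu : u ∈ (e.extend I).target) :
    ContDiffWithinAt ℝ ∞ (fun v => chartMetric g e v a b) (Set.range I) u := by
  have h1 : ContMDiffWithinAt 𝓘(ℝ, Coord 4) _ ∞ _ (Set.range I) u :=
    (g.contMDiff ((e.extend I).symm u)).comp_contMDiffWithinAt u (contMDiffWithinAt_symm he hu)
  have h2 := ContMDiffWithinAt.clm_bundle_apply₂ (F₁ := Coord 4) (F₂ := Coord 4)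
    (E₃ := Bundle.Trivial X ℝ)
    h1 (contMDiffWithinAt_coordField he a hu) (contMDiffWithinAt_coordField he b hu)
  rw [Bundle.contMDiffWithinAt_totalSpace] at h2
  exact contMDiffWithinAt_iff_contDiffWithinAt.mp h2.2

theorem isMetricAt_chartMetric (g : SmoothMetric I X) {u : Coord 4}
    (hu : u ∈ (e.extend I).target) : IsMetricAt (Set.range I) (chartMetric g e) u where
  dom := isCoordDomain_range I
  mem := e.extend_target_subset_range hu
  smooth a b := contDiffWithinAt_chartMetric he g a b hu
  symm := Eventually.of_forall fun v => chartMetric_symm g v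
  det := det_ne_zero_of_ip_pos fun _ => ip_chartMetric_self_pos he g hu

end ChartMetric

/-! ### Hypersurfaces in charts -/

section Hypersurface

variable {H₄ : Type*} [TopologicalSpace H₄] {I : ModelWithCorners ℝ (Coord 4) H₄}
  {X : Type*} [TopologicalSpace X] [ChartedSpace H₄ X] [IsManifold I ∞ X]
  {M : Type*} [TopologicalSpace M] [ChartedSpace (Coord 3) M]
  {g : SmoothMetric I X} {ι : M → X} {N : ∀ p : M, TangentSpace I (ι p)}
  {c : OpenPartialHomeomorph M (Coord 3)} {e : OpenPartialHomeomorph X H₄}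

omit [ChartedSpace H₄ X] [ChartedSpace (Coord 3) M] in
theorem eventually_mem_charts {p : M} (hι : ContinuousAt ι p) (hpc : p ∈ c.source)
    (hpe : ι p ∈ e.source) :
    ∀ᶠ y in 𝓝 (c p), y ∈ c.target ∧ ι (c.symm y) ∈ e.source := by
  have hp := c.map_source hpc
  refine Filter.Eventually.and (c.open_target.mem_nhds hp) ?_
  have h1 : ContinuousAt (ι ∘ c.symm) (c p) :=
    ContinuousAt.comp (by rwa [c.left_inv hpc]) (c.continuousAt_symm hp)
  refine h1 (e.open_source.mem_nhds ?_)
  simpa [c.left_inv hpc] using hpe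

theorem contMDiffAt_symm_of_mem_target {y : Coord 3} (hc : c ∈ IsManifold.maximalAtlas (𝓡 3) ∞ M)
    (hy : y ∈ c.target) : ContMDiffAt 𝓘(ℝ, Coord 3) (𝓡 3) ∞ c.symm y :=
  (contMDiffOn_symm_of_mem_maximalAtlas hc).contMDiffAt (c.open_target.mem_nhds hy)

theorem eq_zero_of_mfderiv_symm {y : Coord 3} (hc : c ∈ IsManifold.maximalAtlas (𝓡 3) ∞ M)
    (hy : y ∈ c.target) {v : Coord 3} (hv : mfderiv 𝓘(ℝ, Coord 3) (𝓡 3) c.symm y v = 0) :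
    v = 0 := by
  have hy' : y ∈ (c.extend (𝓡 3)).target := by simpa using hy
  have h := mfderiv_extend_mfderivWithin_symm hc hy' v
  have h2 : mfderivWithin 𝓘(ℝ, Coord 3) (𝓡 3) (c.extend (𝓡 3)).symm (Set.range (𝓡 3)) y v = 0 := by
    rw [show Set.range (𝓡 3) = Set.univ by simp, mfderivWithin_univ]
    exact hv
  rw [← h, h2]
  exact map_zero _

/-- The differential of the hypersurface in the chart `c` of its parameters. -/
noncomputable def paramDeriv (I : ModelWithCorners ℝ (Coord 4) H₄) (ι : M → X)
    (c : OpenPartialHomeomorph M (Coord 3)) (y : Coord 3) :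
    Coord 3 →L[ℝ] TangentSpace I (ι (c.symm y)) :=
  (mfderiv (𝓡 3) I ι (c.symm y)).comp (mfderiv 𝓘(ℝ, Coord 3) (𝓡 3) c.symm y)

theorem contDiffAt_emb (hι : ContMDiff (𝓡 3) I ∞ ι)
    (hc : c ∈ IsManifold.maximalAtlas (𝓡 3) ∞ M) (he : e ∈ IsManifold.maximalAtlas I ∞ X)
    {y : Coord 3} (hy : y ∈ c.target) (hye : ι (c.symm y) ∈ e.source) :
    ContDiffAt ℝ ∞ (inCharts g ι N c e).emb y :=
  (ContMDiffAt.comp y (g := e.extend I) (f := ι ∘ c.symm) (e.contMDiffAt_extend he hye)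
    ((hι (c.symm y)).comp y (contMDiffAt_symm_of_mem_target hc hy))).contDiffAt

theorem hasFDerivAt_emb (hι : ContMDiff (𝓡 3) I ∞ ι)
    (hc : c ∈ IsManifold.maximalAtlas (𝓡 3) ∞ M) (he : e ∈ IsManifold.maximalAtlas I ∞ X)
    {y : Coord 3} (hy : y ∈ c.target) (hye : ι (c.symm y) ∈ e.source) :
    HasFDerivAt (inCharts g ι N c e).emb
      ((chartVector I e (ι (c.symm y))).comp (paramDeriv I ι c y)) y := by
  have h1 := ((contMDiffAt_symm_of_mem_target hc hy).mdifferentiableAt (by simp)).hasMFDerivAt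
  have h2 := ((hι (c.symm y)).mdifferentiableAt (by simp)).hasMFDerivAt
  have h3 := (mdifferentiableAt_extend he hye).hasMFDerivAt
  exact (h3.comp y (h2.comp y h1)).hasFDerivAt

theorem tangent_inCharts (hι : ContMDiff (𝓡 3) I ∞ ι)
    (hc : c ∈ IsManifold.maximalAtlas (𝓡 3) ∞ M) (he : e ∈ IsManifold.maximalAtlas I ∞ X)
    {y : Coord 3} (hy : y ∈ c.target) (hye : ι (c.symm y) ∈ e.source) (i : Fin 3) :
    (fun a => (inCharts g ι N c e).tangent i a y)
      = chartVector I e (ι (c.symm y)) (paramDeriv I ι c y (basisVec i)) := by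
  funext a
  have h := (EuclideanSpace.proj (𝕜 := ℝ) a).hasFDerivAt.comp y
    (hasFDerivAt_emb (g := g) (N := N) hι hc he hy hye)
  rw [CoordHypersurface.tangent, partialD, fderivWithin_univ]
  exact congrArg (fun A => A (basisVec i)) h.fderiv

variable [IsManifold (𝓡 3) ∞ M]

/-- The components of N are the fibre part of the tangent map of the chart, composed with the smooth
section N. -/
theorem contDiffAt_normal (hN : IsUnitNormalField g ι N)
    (hc : c ∈ IsManifold.maximalAtlas (𝓡 3) ∞ M) (he : e ∈ IsManifold.maximalAtlas I ∞ X)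
    {y : Coord 3} (hy : y ∈ c.target) (hye : ι (c.symm y) ∈ e.source) :
    ContDiffAt ℝ ∞ (inCharts g ι N c e).normal y := by
  have h1 := (hN.smooth (c.symm y)).comp y (contMDiffAt_symm_of_mem_target hc hy)
  have h2 := ((e.contMDiffOn_extend he).contMDiffOn_tangentMapWithin (m := ∞) (by simp)
    e.open_source.uniqueMDiffOn).congr (f₁ := tangentMap I 𝓘(ℝ, Coord 4) (e.extend I)) (by
      intro w hw
      rw [tangentMapWithin, mfderivWithin_of_isOpen e.open_source hw, tangentMap])
  have h3 := h2.contMDiffAt (x := ⟨ι (c.symm y), N (c.symm y)⟩)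
    ((e.open_source.preimage (FiberBundle.continuous_proj _ _)).mem_nhds hye)
  have h4 := (contMDiff_snd_tangentBundle_modelSpace (Coord 4) 𝓘(ℝ, Coord 4)).contMDiffAt.comp y
    (h3.comp y h1)
  exact h4.contDiffAt

theorem isRegularAt_inCharts (hι : Manifold.IsSmoothEmbedding (𝓡 3) I ∞ ι)
    (hN : IsUnitNormalField g ι N) (hc : c ∈ IsManifold.maximalAtlas (𝓡 3) ∞ M)
    (he : e ∈ IsManifold.maximalAtlas I ∞ X) {p : M} (hpc : p ∈ c.source) (hpe : ι p ∈ e.source) :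
    (inCharts g ι N c e).IsRegularAt (c p) := by
  have hs : ContMDiff (𝓡 3) I ∞ ι := hι.contMDiff
  have hev := eventually_mem_charts (hs p).continuousAt hpc hpe
  obtain ⟨hy, hye⟩ := hev.self_of_nhds
  refine ⟨?_, Eventually.of_forall fun y => Set.mem_range_self _, ?_, ?_, ?_, ?_, ?_⟩
  · have hu : e.extend I (ι (c.symm (c p))) ∈ (e.extend I).target :=
      (e.extend I).map_source (by rwa [e.extend_source])
    filter_upwards [extend_target_mem hu] with v hv using isMetricAt_chartMetric he g hv
  · exact (contDiffWithinAt_euclidean ..).mp (contDiffAt_emb hs hc he hy hye).contDiffWithinAt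
  · exact (contDiffWithinAt_euclidean ..).mp (contDiffAt_normal hN hc he hy hye).contDiffWithinAt
  · filter_upwards [hev] with y hy
    exact (ip_chartMetric_chartVector he g hy.2 _ _).trans (hN.unit _)
  · filter_upwards [hev] with y hy i
    rw [tangent_inCharts hs hc he hy.1 hy.2 i]
    exact (ip_chartMetric_chartVector he g hy.2 _ _).trans (hN.normal _ _)
  -- The induced metric is the Gram matrix of g under the differential of ι ∘ c⁻¹, which is
  -- injective because ι is an immersion; hence it is positive definite.
  · have hh : (inCharts g ι N c e).h (c p) = Matrix.of fun i j =>
        g.inner (ι (c.symm (c p))) (paramDeriv I ι c (c p) (basisVec i))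
          (paramDeriv I ι c (c p) (basisVec j)) := by
      ext i j
      change ip _ (fun a => (inCharts g ι N c e).tangent i a (c p))
        (fun a => (inCharts g ι N c e).tangent j a (c p)) = _
      rw [tangent_inCharts hs hc he hy hye i, tangent_inCharts hs hc he hy hye j]
      exact ip_chartMetric_chartVector he g hye _ _
    rw [hh]
    refine det_ne_zero_of_ip_pos fun v hv => ?_
    rw [ip_of_bilin]
    refine g.pos _ _ fun h0 => hv ?_
    exact eq_zero_of_mfderiv_symm hc hy
      (eq_zero_of_mfderiv_of_isImmersionAt (hι.isImmersion.isImmersionAt _) h0)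

-- Definitional, with f = φ ∘ e⁻¹. The normal is left as it is, because it equals exp(-f) N only
-- near the point in question, where e⁻¹ inverts e.
omit [ChartedSpace (Coord 3) M] [IsManifold (𝓡 3) ∞ M] in
theorem inCharts_conformalMetric (φ : X → ℝ) (hφ : ContMDiff I 𝓘(ℝ) ∞ φ) :
    inCharts (conformalMetric g φ hφ) ι (fun q => Real.exp (-φ (ι q)) • N q) c e
      = (inCharts g ι N c e).conformalChange (φ ∘ (e.extend I).symm)
        (inCharts (conformalMetric g φ hφ) ι (fun q => Real.exp (-φ (ι q)) • N q) c e).normal :=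
  rfl

theorem bach_inCharts_conformalMetric (hι : Manifold.IsSmoothEmbedding (𝓡 3) I ∞ ι)
    (hN : IsUnitNormalField g ι N) (hc : c ∈ IsManifold.maximalAtlas (𝓡 3) ∞ M)
    (he : e ∈ IsManifold.maximalAtlas I ∞ X) {p : M} (hpc : p ∈ c.source) (hpe : ι p ∈ e.source)
    (φ : X → ℝ) (hφ : ContMDiff I 𝓘(ℝ) ∞ φ) :
    Real.exp (φ (ι p)) •
        (inCharts (conformalMetric g φ hφ) ι (fun q => Real.exp (-φ (ι q)) • N q) c e).bach (c p)
      = (inCharts g ι N c e).bach (c p) := by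
  have hD := isRegularAt_inCharts hι hN hc he hpc hpe
  have hev := eventually_mem_charts (hι.contMDiff p).continuousAt hpc hpe
  have hback {y : Coord 3} (hye : ι (c.symm y) ∈ e.source) :
      (e.extend I).symm ((inCharts g ι N c e).emb y) = ι (c.symm y) :=
    (e.extend I).left_inv (by rwa [e.extend_source])
  have h := hD.bach_conformalChange (f := φ ∘ (e.extend I).symm)
    (N' := (inCharts (conformalMetric g φ hφ) ι (fun q => Real.exp (-φ (ι q)) • N q) c e).normal)
    (by
      have hu : e.extend I (ι (c.symm (c p))) ∈ (e.extend I).target :=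
        (e.extend I).map_source (by
          rw [e.extend_source]
          exact hev.self_of_nhds.2)
      filter_upwards [extend_target_mem hu] with v hv
      exact contMDiffWithinAt_iff_contDiffWithinAt.mp
        ((hφ _).comp_contMDiffWithinAt v (contMDiffWithinAt_symm he hv)))
    (by
      filter_upwards [hev] with y hy
      rw [Function.comp_apply, hback hy.2]
      -- The differential of the chart is linear, so the rescaling of the normal passes to its
      -- components.
      exact map_smul (chartVector I e (ι (c.symm y))) _ (N (c.symm y)))
  rw [Function.comp_apply, hback hev.self_of_nhds.2, c.left_inv hpc] at h
  rw [inCharts_conformalMetric]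
  exact h

end Hypersurface

end HypersurfaceBach

open HypersurfaceBach in
theorem lemma5p25 {H₄ : Type*} [TopologicalSpace H₄] (I : ModelWithCorners ℝ (Coord 4) H₄)
    {X : Type*} [TopologicalSpace X] [ChartedSpace H₄ X] [IsManifold I ∞ X]
    {M : Type*} [TopologicalSpace M] [ChartedSpace (Coord 3) M] [IsManifold (𝓡 3) ∞ M]
    (g : SmoothMetric I X)
    (ι : M → X) (hι : Manifold.IsSmoothEmbedding (𝓡 3) I ∞ ι)
    (N : ∀ p : M, TangentSpace I (ι p)) (hN : IsUnitNormalField g ι N)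
    (c : OpenPartialHomeomorph M (Coord 3)) (hc : c ∈ IsManifold.maximalAtlas (𝓡 3) ∞ M)
    (e : OpenPartialHomeomorph X H₄) (he : e ∈ IsManifold.maximalAtlas I ∞ X)
    (p : M) (hpc : p ∈ c.source) (hpe : ι p ∈ e.source) :
    (∀ (φ : X → ℝ) (hφ : ContMDiff I 𝓘(ℝ) ∞ φ),
      Real.exp (φ (ι p)) •
          (inCharts (conformalMetric g φ hφ) ι (fun q => Real.exp (-φ (ι q)) • N q) c e).bach (c p)
        = (inCharts g ι N c e).bach (c p)) ∧
    (let D := inCharts g ι N c e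
      let x := c p
      D.pairing x (D.Lo x) (D.bach x)
        = (∑ i, ∑ j, D.LoUp x i j * D.nablaWeylNN x i j)
          + 2 * D.H x * D.pairing x (D.Lo x) (D.weylNN x)
          - 2 * (∑ i, ∑ j, D.LoUp x i j * D.divWeylLast x i j)
          - D.pairing x (D.LoSq x) (D.weylNN x)
          - ∑ i, ∑ j, ∑ k, ∑ l, D.LoUp x i j * D.LoUp x k l * D.weylTan k i j l x) := by
  refine ⟨fun φ hφ => bach_inCharts_conformalMetric hι hN hc he hpc hpe φ hφ, ?_⟩
  exact (isRegularAt_inCharts hι hN hc he hpc hpe).pairing_Lo_bach
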